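/- **Setting.** Let $0<T<1$, $p>16$ and $C$ be real numbers. Let $\Gamma_B=\mathbb Z\gamma'\oplus\mathbb Z\gamma''$ with $\gamma'=(2,1)$, $\gamma''=(1,2)$, and let $\lambda=\begin{pmatrix}2&1\\1&2\end{pmatrix}^{-1}$. Put $v_0=xyz$ on $(\mathbb C^*)^3$, and let $\Gamma_B$ act (where $0<|T^3v_0|<1$) by $$(-\gamma')\cdot(x,y,z)=(T^3v_0x,\;y,\;T^{-3}v_0^{-1}z),\qquad (-\gamma'')\cdot(x,y,z)=(x,\;T^3v_0y,\;T^{-3}v_0^{-1}z).$$ Away from the singular fiber, $Y$ is the quotient of $(\mathbb C^*)^3$ by this action, with the fibration $v_0:Y\to\mathbb C$. The *vertex charts* of $Y$ are the triples of toric coordinates $\gamma\cdot(x,y,z)$ and $\gamma\cdot(x,y,z)$ followed by $(x,y,z)\mapsto(Tv_0x^{-1},Tv_0y^{-1},T^{-2}z^{-1})$, $\gamma\in\Gamma_B$; every point has all three coordinates of norm at most $T^{-1}$ in some vertex chart. **Symplectic form.** Let $l>0$. Put $\phi_x=\log\frac{1+|Tx|^2}{1+|T^2yz|^2}$, $g_{xy}=\log\big[(1+|Tx|^2)(1+|Ty|^2)(1+|T^2xy|^2)\big]$,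 and define $\phi_y,\phi_z,g_{xz},g_{yz}$ by permuting $x,y,z$. Let $\alpha_3,\alpha_4,\alpha_5,\alpha_6:\mathbb R\to\mathbb R$ be smooth increasing functions such that * $\alpha_3=\frac23$ and $\alpha_5=0$ on $(-\infty,T^{l/2+2}]$, and $\alpha_3=\alpha_5=1$ on $[T^{l/2-2l/p+2},\infty)$; * $\alpha_4$ is odd, $\alpha_4=0$ on $[-T^{3l/4+1},T^{3l/4+1}]$, and $\alpha_4=\frac12$ on $[T^{3l/4-l/p},\infty)$; * $\alpha_6=0$ on $(-\infty,-(\frac l8-\frac lp)]$ and $\alpha_6=1$ on $[-(\frac l8-\frac{2l}p),\infty)$; * $|\mu\,\alpha_j'(\mu)|\le C/l$ and $|\mu^2\alpha_j''(\mu)|\le C/l$ for $j=3,4,5$, and $|\alpha_6'|,|\alpha_6''|\le C/l$. For $|x|\ge|y|\ge|z|$, with $\alpha_6$ evaluated at $\log_{1/T}(|y|/|x|)$, put $$d=\phi_x-\tfrac12(\phi_y+\phi_z)+\tfrac32\alpha_6\phi_y,\qquad \theta=\phi_y-\phi_z,$$ $$F=g_{yz}-\alpha_6\phi_y+\alpha_3(d)\,d+\alpha_5(d)\big(\alpha_4(\theta)\,\theta-\tfrac12\alpha_6\phi_y\big)+K|xyz|^2,$$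 where $K$ is a real constant, and extend $F$ to all $(x,y,z)$ by symmetry under permutations of $x,y,z$. Let $\omega=\frac{i}{2\pi}\partial\bar\partial F$, with the same formula for $F$ in each vertex chart, at the points where the coordinates of that chart have norm at most $T^{-1}$. **Fiber, Lagrangians, monodromy.** Let $c=T^l$ and let $V^\vee=v_0^{-1}(c)\subset Y$, the quotient of $(\mathbb C^*)^2\ni(x,y)$ by $\Gamma_B$, with the form $\omega|_{V^\vee}$. Let $\theta_1=\frac{\arg x}{2\pi}$, $\theta_2=\frac{\arg y}{2\pi}$, and let $\xi=(\xi_1,\xi_2):(\mathbb C^*)^2\to\mathbb R^2$ be the action coordinates, that is, $d\xi_j=\omega|_{V^\vee}(\,\cdot\,,\partial_{\theta_j})$ and $\xi=0$ at $x=y=T^{-1}$. For $k\in\mathbb Z$ let $$\ell_k=\{(\xi,\theta)\in V^\vee : (\theta_1,\theta_2)\equiv-k\lambda(\xi)\bmod\mathbb Z^2\}.$$ A *horizontal lift* of the loop $t\mapsto ce^{it}$, $0\le t\le2\pi$, is a differentiable curve $\gamma$ in $Y$ with $v_0(\gamma(t))=ce^{it}$ and $\omega(\gamma'(t),w)=0$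 for all $w\in\ker dv_0$. The *monodromy* $\phi^H_{2\pi}:V^\vee\to V^\vee$ maps $\gamma(0)$ to $\gamma(2\pi)$ for every horizontal lift $\gamma$ of this loop. **Lemma.** For all $0<T<1$, $p>16$ and $C$ there is $l_0$ such that for all $l\ge l_0$, all $\alpha_3,\dots,\alpha_6$ as above and all $K\in\mathbb R$, the action coordinates $\xi$ exist, the monodromy $\phi^H_{2\pi}$ is defined (through every point of $V^\vee$ there is a horizontal lift, and its end depends only on its start), and for every $i\in\mathbb Z$ the parallel transported $\phi^H_{2\pi}(\ell_i)$ is Hamiltonian isotopic to $\ell_{i+1}$ in $V^\vee$: there are a smooth function $H:\mathbb R\times V^\vee\to\mathbb R$ and a smooth isotopy $\psi_t$ of $V^\vee$ with $\psi_0=\mathrm{id}$, $\omega|_{V^\vee}\big(\tfrac{d}{dt}\psi_t,\,\cdot\,\big)=dH_t$ and $\psi_1\big(\phi^H_{2\pi}(\ell_i)\big)=\ell_{i+1}$. -/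

import Mathlib

open scoped ContDiff

noncomputable section

namespace BananaMirror

/-! ### The Kähler potential

`T` is the Novikov parameter, the fibres of `v₀ = xyz` that we consider lie over `|v₀| = T ^ l`,
and `A, B, D` always stand for squares of `T`-rescaled norms such as `|T x|²`. -/

/-- `φ_x = log ((1 + |Tx|²) / (1 + |T²yz|²))`, for `A = |Tx|²`, `B = |Ty|²`, `D = |Tz|²`. -/
def phi (A B D : ℝ) : ℝ := Real.log ((1 + A) / (1 + B * D))

/-- The toric potential of `ℂP²` blown up in three points,
`g_xy = log ((1 + |Tx|²) (1 + |Ty|²) (1 + |T²xy|²))`, for `A = |Tx|²`, `B = |Ty|²`. -/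
def gPot (A B : ℝ) : ℝ := Real.log ((1 + A) * (1 + B) * (1 + A * B))

/-- The four bump functions that interpolate between the toric potentials. -/
structure Bumps where
  α₃ : ℝ → ℝ
  α₄ : ℝ → ℝ
  α₅ : ℝ → ℝ
  α₆ : ℝ → ℝ

/-- The first two logarithmic derivatives of `α` are bounded by `ε`. -/
def LogSlow (α : ℝ → ℝ) (ε : ℝ) : Prop :=
  ∀ μ : ℝ, |μ * deriv α μ| ≤ ε ∧ |μ ^ 2 * deriv (deriv α) μ| ≤ ε

/-- The requirements on the bump functions.
* `α₃` (from `2/3` to `1`) and `α₅` (from `0` to `1`) are functions of the radial variable `d`,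
  which is about `|Tx|²` where `x` dominates; they move while `|x|` goes from `T ^ (l/4)` to
  `T ^ (l/4 - l/p)`.
* `α₄` (from `-1/2` to `1/2`) is an odd function of the angular variable `θ ≈ |Ty|² - |Tz|²`; it
  vanishes around `θ = 0`, and it is `1/2` from `T ^ (3l/4 - l/p)` on.
* `α₆` (from `0` to `1`) is a function of `log_{1/T} (|y| / |x|)`; it moves between
  `-(l/8 - l/p)` and `-(l/8 - 2l/p)`.
All are smooth, increasing, and have logarithmic derivatives of size `C / l`. -/
structure Bumps.Admissible (b : Bumps) (T p l C : ℝ) : Prop where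
  smooth₃ : ContDiff ℝ ∞ b.α₃
  smooth₄ : ContDiff ℝ ∞ b.α₄
  smooth₅ : ContDiff ℝ ∞ b.α₅
  smooth₆ : ContDiff ℝ ∞ b.α₆
  mono₃ : Monotone b.α₃
  mono₄ : Monotone b.α₄
  mono₅ : Monotone b.α₅
  mono₆ : Monotone b.α₆
  inner₃ : ∀ d ≤ T ^ (l / 2 + 2), b.α₃ d = 2 / 3
  outer₃ : ∀ d ≥ T ^ (l / 2 - 2 * l / p + 2), b.α₃ d = 1
  inner₅ : ∀ d ≤ T ^ (l / 2 + 2), b.α₅ d = 0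
  outer₅ : ∀ d ≥ T ^ (l / 2 - 2 * l / p + 2), b.α₅ d = 1
  odd₄ : ∀ θ, b.α₄ (-θ) = -b.α₄ θ
  inner₄ : ∀ θ, |θ| ≤ T ^ (3 * l / 4 + 1) → b.α₄ θ = 0
  outer₄ : ∀ θ ≥ T ^ (3 * l / 4 - l / p), b.α₄ θ = 1 / 2
  inner₆ : ∀ s ≤ -(l / 8 - l / p), b.α₆ s = 0
  outer₆ : ∀ s ≥ -(l / 8 - 2 * l / p), b.α₆ s = 1
  slow₃ : LogSlow b.α₃ (C / l)
  slow₄ : LogSlow b.α₄ (C / l)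
  slow₅ : LogSlow b.α₅ (C / l)
  slow₆ : ∀ s, |deriv b.α₆ s| ≤ C / l ∧ |deriv (deriv b.α₆) s| ≤ C / l

/-- The interpolated potential where `A = |Tx|² ≥ B = |Ty|² ≥ D = |Tz|²`:
`F = g_yz - α₆ φ_y + α₃(d) d + α₅(d) (α₄(θ) θ - α₆ φ_y / 2)` with
`d = φ_x - (φ_y + φ_z)/2 + (3/2) α₆ φ_y` and `θ = φ_y - φ_z`. Special cases:
* `α₃ = 2/3`, `α₅ = 0` (around the vertex): `F = (g_xy + g_xz + g_yz)/3`;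
* `α₆ = 0` (region I): `F = g_yz + α₃(d) d + α₄(θ) α₅(d) θ`;
* `α₄ = 1/2` (region IIA):
  `F = g_yz - α₆ φ_y + α₃(d) d + (1/2) α₅(d) (φ_y - φ_z - α₆ φ_y)`;
* `α₄ = 1/2`, `α₆ = 1` (region IIB), where `d = φ_x + φ_y - φ_z/2`:
  `F = (g_yz - φ_y) + α₃(d) d - (1/2) α₅(d) φ_z`;
* `α₃ = α₅ = 1`, `α₆ = 0` (along the `x`-axis): `F = (g_xy + g_xz)/2 + α₄(θ) (g_xy - g_xz)`;
* `α₃ = α₅ = 1`, `α₄ = 1/2` (interior of a tile): `F = g_xy`. -/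
def chamberPot (b : Bumps) (T A B D : ℝ) : ℝ :=
  let a₆ := b.α₆ (Real.logb T⁻¹ (Real.sqrt (B / A)))
  let φx := phi A B D
  let φy := phi B A D
  let φz := phi D A B
  let d := φx - (φy + φz) / 2 + 3 / 2 * a₆ * φy
  let θ := φy - φz
  gPot B D - a₆ * φy + b.α₃ d * d + b.α₅ d * (b.α₄ θ * θ - a₆ * φy / 2)

/-- The superpotential `v₀ = xyz`. -/
def v₀ (q : ℂ × ℂ × ℂ) : ℂ := q.1 * q.2.1 * q.2.2

/-- The potential in the toric coordinates at a vertex: symmetric in `(x, y, z)`, given by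
`chamberPot` after ordering the three norms, plus a multiple of `|xyz|²` from the base. -/
def vertexPot (b : Bumps) (T K : ℝ) (q : ℂ × ℂ × ℂ) : ℝ :=
  let X := (T * ‖q.1‖) ^ 2
  let Y := (T * ‖q.2.1‖) ^ 2
  let Z := (T * ‖q.2.2‖) ^ 2
  chamberPot b T (max X (max Y Z)) (max (min X Y) (min (max X Y) Z)) (min X (min Y Z))
    + K * ‖v₀ q‖ ^ 2

/-! ### The total space away from the singular fibre

Away from `v₀ = 0` the infinite-type toric variety `Ỹ` is `(ℂ^*)³`, and `Y = Ỹ / Γ_B`, where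
`Γ_B = ℤ γ' ⊕ ℤ γ''` with `γ' = (2,1)` and `γ'' = (1,2)`. -/

/-- The action of `-(m γ' + n γ'') ∈ Γ_B`, generated by
`(x,y,z) ↦ (T³v₀x, y, T⁻³v₀⁻¹z)` and `(x,y,z) ↦ (x, T³v₀y, T⁻³v₀⁻¹z)`. -/
def deck (T : ℝ) (m n : ℤ) (q : ℂ × ℂ × ℂ) : ℂ × ℂ × ℂ :=
  (((T : ℂ) ^ 3 * v₀ q) ^ m * q.1, ((T : ℂ) ^ 3 * v₀ q) ^ n * q.2.1,
    ((T : ℂ) ^ 3 * v₀ q) ^ (-(m + n)) * q.2.2)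

/-- The toric coordinates `(T v₀ x⁻¹, T v₀ y⁻¹, T⁻² z⁻¹)` at the vertex at the other end of the
`z`-axis. -/
def flipChart (T : ℝ) (q : ℂ × ℂ × ℂ) : ℂ × ℂ × ℂ :=
  ((T : ℂ) * v₀ q / q.1, (T : ℂ) * v₀ q / q.2.1, ((T : ℂ) ^ 2 * q.2.2)⁻¹)

/-- Toric coordinates centred at a vertex near `q`, i.e. coordinates all of which have norm at most
`1/T` at `q`. The numbers `a`, `c`, `1 - a - c` are the ratios of `log |Tx|`, `log |Ty|`,
`log |Tz|` to their sum `log |T³v₀| < 0`; the action `deck T m n` adds `m`, `n`, `-(m+n)` to them,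
and `flipChart` maps them to `1 - a`, `1 - c`, `a + c - 1`. -/
def chartAt (T : ℝ) (q : ℂ × ℂ × ℂ) : ℂ × ℂ × ℂ → ℂ × ℂ × ℂ :=
  let a := Real.log (T * ‖q.1‖) / Real.log (T ^ 3 * ‖v₀ q‖)
  let c := Real.log (T * ‖q.2.1‖) / Real.log (T ^ 3 * ‖v₀ q‖)
  if Int.fract a + Int.fract c ≤ 1 then deck T (-⌊a⌋) (-⌊c⌋)
  else fun q' => flipChart T (deck T (-⌊a⌋) (-⌊c⌋) q')

/-- The real two-form `(i/2π) ∂∂̄Φ` on `ℂ³`: one has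
`i ∂∂̄Φ (u, w) = (D²Φ (iu, w) - D²Φ (u, iw)) / 2`. -/
def ddbar (Φ : ℂ × ℂ × ℂ → ℝ) (q u w : ℂ × ℂ × ℂ) : ℝ :=
  1 / (4 * Real.pi) *
    (fderiv ℝ (fderiv ℝ Φ) q (Complex.I • u) w - fderiv ℝ (fderiv ℝ Φ) q u (Complex.I • w))

/-- The symplectic form `ω` on `Y`, written on the cover `(ℂ^*)³`: near every point it is
`(i/2π) ∂∂̄F`, with the same formula for `F` in the toric coordinates at each vertex. -/
def omega (b : Bumps) (T K : ℝ) (q u w : ℂ × ℂ × ℂ) : ℝ :=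
  ddbar (fun q' => vertexPot b T K (chartAt T q q')) q u w

/-! ### The fibre `V^∨` over a real number `c > 0` -/

/-- `(ℂ^*)²`, the cover of the fibre, with coordinates `(x, y)`. -/
def torusDomain : Set (ℂ × ℂ) := {q | q.1 ≠ 0 ∧ q.2 ≠ 0}

/-- The embedding `(x, y) ↦ (x, y, c/(xy))` of the cover of the fibre over `c`. -/
def fiberIncl (c : ℝ) (q : ℂ × ℂ) : ℂ × ℂ × ℂ := (q.1, q.2, (c : ℂ) / (q.1 * q.2))

/-- The action of `Γ_B` on the fibre over `c`: `(x, y) ↦ ((T³c)^m x, (T³c)^n y)`. -/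
def fiberRel (T c : ℝ) (q q' : torusDomain) : Prop :=
  ∃ m n : ℤ, q'.1.1 = ((T ^ 3 * c : ℝ) : ℂ) ^ m * q.1.1 ∧
    q'.1.2 = ((T ^ 3 * c : ℝ) : ℂ) ^ n * q.1.2

/-- The fibre `V^∨ = (ℂ^*)² / Γ_B` of `v₀ : Y → ℂ` over `c`. -/
def Fiber (T c : ℝ) : Type := Quot (fiberRel T c)

/-- The covering map `(ℂ^*)² → V^∨`. -/
def Fiber.mk (T c : ℝ) (q : torusDomain) : Fiber T c := Quot.mk (fiberRel T c) q

/-- The restriction of `ω` to the fibre over `c`, on the cover. -/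
def fiberForm (b : Bumps) (T K c : ℝ) (q u w : ℂ × ℂ) : ℝ :=
  omega b T K (fiberIncl c q) (fderiv ℝ (fiberIncl c) q u) (fderiv ℝ (fiberIncl c) q w)

/-- `ξ = (ξ₁, ξ₂)` are the action coordinates for the angles `θ = (arg x, arg y) / 2π`, i.e.
`dξ_j = ω(·, ∂/∂θ_j)`, so that `ω|_{V^∨} = dξ₁ ∧ dθ₁ + dξ₂ ∧ dθ₂`. They are multivalued on `V^∨`
and are normalised to vanish at the centre `|Tx| = |Ty| = 1` of the tile of `g_xy`. -/
def IsActionCoord (b : Bumps) (T K c : ℝ) (ξ : ℂ × ℂ → ℝ × ℝ) : Prop :=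
  (∀ q ∈ torusDomain, DifferentiableAt ℝ ξ q ∧ ∀ u : ℂ × ℂ,
    fderiv ℝ ξ q u =
      (fiberForm b T K c q u (2 * Real.pi * Complex.I * q.1, 0),
       fiberForm b T K c q u (0, 2 * Real.pi * Complex.I * q.2))) ∧
  ξ ((T : ℂ)⁻¹, (T : ℂ)⁻¹) = 0

/-- The linear map `λ`, the inverse of the matrix `(2 1; 1 2)`. -/
def lam (ξ : ℝ × ℝ) : ℝ × ℝ := (2 / 3 * ξ.1 - 1 / 3 * ξ.2, -1 / 3 * ξ.1 + 2 / 3 * ξ.2)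

/-- The linear Lagrangian `ℓ_k = {θ ≡ -k λ(ξ) mod ℤ²} ⊆ V^∨`. -/
def linLag (T c : ℝ) (ξ : ℂ × ℂ → ℝ × ℝ) (k : ℤ) : Set (Fiber T c) :=
  Fiber.mk T c '' {q : torusDomain |
    q.1.1 = ‖q.1.1‖ * Complex.exp (2 * Real.pi * Complex.I * ((-k * (lam (ξ q.1)).1 : ℝ) : ℂ)) ∧
    q.1.2 = ‖q.1.2‖ * Complex.exp (2 * Real.pi * Complex.I * ((-k * (lam (ξ q.1)).2 : ℝ) : ℂ))}

/-! ### Parallel transport -/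

/-- A horizontal lift of the loop `t ↦ c exp(it)`, `0 ≤ t ≤ 2π`: a curve in the cover of `Y` lying
over the loop, with velocity in the `ω`-complement of the kernel of `dv₀`. -/
def IsHorizontalLift (b : Bumps) (T K c : ℝ) (γ : ℝ → ℂ × ℂ × ℂ) : Prop :=
  ∀ t ∈ Set.Icc (0 : ℝ) (2 * Real.pi),
    v₀ (γ t) = c * Complex.exp (t * Complex.I) ∧
    ∃ v, HasDerivWithinAt γ v (Set.Icc 0 (2 * Real.pi)) t ∧
      ∀ w : ℂ × ℂ × ℂ, fderiv ℂ v₀ (γ t) w = 0 → omega b T K (γ t) v w = 0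

/-- `φ` is the monodromy of `v₀ : Y → ℂ` around the circle of radius `c`, as a self-map of the
fibre over `c`: every point of the cover is the start of a horizontal lift, and `φ` maps
the start of any horizontal lift to its end. -/
def IsMonodromy (b : Bumps) (T K c : ℝ) (φ : Fiber T c → Fiber T c) : Prop :=
  (∀ q : torusDomain, ∃ γ, IsHorizontalLift b T K c γ ∧ γ 0 = fiberIncl c q.1) ∧
  ∀ (q q' : torusDomain) (γ : ℝ → ℂ × ℂ × ℂ), IsHorizontalLift b T K c γ →
    γ 0 = fiberIncl c q.1 → γ (2 * Real.pi) = fiberIncl c q'.1 →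
    φ (Fiber.mk T c q) = Fiber.mk T c q'

/-! ### Hamiltonian isotopy -/

/-- Two subsets of `V^∨` are Hamiltonian isotopic: there are a smooth time-dependent Hamiltonian `H`
on `V^∨` and an isotopy `ψ` of `V^∨` from the identity, with `ι_{dψ_t/dt} ω = dH_t`, whose
time-one map carries the first subset onto the second. Here `H'` and `ψ'` are the lifts to the
cover, through which smoothness and the differential equation are expressed. -/
def HamiltonianIsotopic (b : Bumps) (T K c : ℝ) (L₀ L₁ : Set (Fiber T c)) : Prop :=
  ∃ (H : ℝ → Fiber T c → ℝ) (ψ : ℝ → Fiber T c → Fiber T c)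
    (H' : ℝ → ℂ × ℂ → ℝ) (ψ' : ℝ → ℂ × ℂ → ℂ × ℂ),
    (∀ (t : ℝ) (q : torusDomain), H' t q.1 = H t (Fiber.mk T c q)) ∧
    (∀ (t : ℝ) (q : torusDomain), ∃ h : ψ' t q.1 ∈ torusDomain,
      ψ t (Fiber.mk T c q) = Fiber.mk T c ⟨ψ' t q.1, h⟩) ∧
    ContDiffOn ℝ ∞ (fun s : ℝ × (ℂ × ℂ) => H' s.1 s.2) (Set.univ ×ˢ torusDomain) ∧
    ContDiffOn ℝ ∞ (fun s : ℝ × (ℂ × ℂ) => ψ' s.1 s.2) (Set.univ ×ˢ torusDomain) ∧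
    (∀ t, Function.Bijective (ψ t)) ∧
    (∀ q ∈ torusDomain, ψ' 0 q = q) ∧
    (∀ (t : ℝ), ∀ q ∈ torusDomain, ∃ v, HasDerivAt (fun τ => ψ' τ q) v t ∧
      ∀ w, fiberForm b T K c (ψ' t q) v w = fderiv ℝ (H' t) (ψ' t q) w) ∧
    ψ 1 '' L₀ = L₁

end BananaMirror

end

/-! Put $u=\log|Tx|^2$, $v=\log|Ty|^2$, $S=\log|T^3v_0|^2$. The chart potentials, corrected by
linear functions of $(u,v,S)$, which $\partial\bar\partial$ does not see, glue to one function
$\Phi(u,v,S)$ with $\omega=\frac{i}{2\pi}\partial\bar\partial\Phi$ along the fibre. It is smooth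
there, its Hessian is positive on fibre directions, and under $(u,v,S)\mapsto(u+iS,v+jS,S)$ it
changes by a linear function (`IsPotential`, `exists_isModel`).

The theorem follows formally from these properties. The action coordinates are
$\xi=(\Phi_u-1,\Phi_v-1)$. A horizontal lift keeps all norms and rotates the arguments with constant
speeds $\sigma$, where $(\sigma_1,\sigma_2,1)$ is Hessian-orthogonal to the fibre (`velocity_eq`,
`lift_end`); the monodromy is therefore rotation by $2\pi\sigma$. A deck transformation adds $(i,j)$
to $\sigma$ and subtracts $(i,j)$ from $\lambda\xi$, so $\sigma+\lambda\xi$ descends to $V^\vee$.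
Orthogonality says $d\Phi_S=-\langle\sigma,d\xi\rangle$ on the fibre, so
$H=\frac12\langle\xi,\lambda\xi\rangle-\Phi_S$ satisfies $dH=\langle\sigma+\lambda\xi,d\xi\rangle$
(`fderiv_hamiltonian`), and $H$ descends too (`hamiltonian_deck`). Its flow preserves norms and
rotates by $-2\pi t(\sigma+\lambda\xi)$. At time one, after the monodromy, what remains is rotation
by $-2\pi\lambda\xi$, which takes $\ell_i$ to $\ell_{i+1}$.

The analytic work is the convexity and smoothness of $\Phi$. Write $X\ge Y\ge Z$ for the squared
rescaled norms in a vertex chart. With the bump functions frozen, the Hessian in a fibre direction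
$(a,b,-a-b)$ is bounded below by a multiple of $Xa^2+Yb^2$ (`toric_main`). Each derivative of a bump
function costs only a factor $C/l$, because $d$ is comparable to $X$ and, where $\alpha_4$ varies
and $\alpha_5\ne0$, $\theta$ is comparable to $Y$ (`le_radial`, `le_angular_of_le`). Smoothness
across the walls $X=Y$ and $Y=Z$, and across chart boundaries, holds because the transition regions
are placed so that a formula with the required symmetry is valid near each wall (`inner₆_or_outer₄`,
`pot_eventuallyEq_chamber`, `pot_mirror`). -/

namespace BananaMirror

open Filter Topology

/-! ### Tools for Hessians: calculus along lines and bounds for the bump function errors. -/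

/-! ### Second-order jets of functions of one variable -/

/-- The function `h` has value `h₀` and first two derivatives `h₁`, `h₂` at `0`. -/
def HasJet (h : ℝ → ℝ) (h₀ h₁ h₂ : ℝ) : Prop :=
  ∃ h' : ℝ → ℝ, (∀ᶠ t in 𝓝 0, HasDerivAt h (h' t) t) ∧ h 0 = h₀ ∧ h' 0 = h₁ ∧
    HasDerivAt h' h₂ 0

namespace HasJet

variable {f g : ℝ → ℝ} {f₀ f₁ f₂ g₀ g₁ g₂ : ℝ}

theorem const (k : ℝ) : HasJet (fun _ => k) k 0 0 :=
  ⟨fun _ => 0, Eventually.of_forall fun t => hasDerivAt_const t k, rfl, rfl, hasDerivAt_const 0 0⟩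

theorem affine (k m : ℝ) : HasJet (fun t => k + t * m) k m 0 :=
  ⟨fun _ => m, Eventually.of_forall fun t => by
    simpa using ((hasDerivAt_id t).mul_const m).const_add k, by simp, rfl, hasDerivAt_const 0 m⟩

theorem add (hf : HasJet f f₀ f₁ f₂) (hg : HasJet g g₀ g₁ g₂) :
    HasJet (fun t => f t + g t) (f₀ + g₀) (f₁ + g₁) (f₂ + g₂) := by
  obtain ⟨f', hf, rfl, rfl, hf'⟩ := hf
  obtain ⟨g', hg, rfl, rfl, hg'⟩ := hg
  refine ⟨fun t => f' t + g' t, ?_, rfl, rfl, hf'.add hg'⟩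
  filter_upwards [hf, hg] with t h1 h2 using h1.add h2

theorem mul (hf : HasJet f f₀ f₁ f₂) (hg : HasJet g g₀ g₁ g₂) :
    HasJet (fun t => f t * g t) (f₀ * g₀) (f₁ * g₀ + f₀ * g₁)
      (f₂ * g₀ + 2 * (f₁ * g₁) + f₀ * g₂) := by
  obtain ⟨f', hf, rfl, rfl, hf'⟩ := hf
  obtain ⟨g', hg, rfl, rfl, hg'⟩ := hg
  refine ⟨fun t => f' t * g t + f t * g' t, ?_, rfl, rfl, ?_⟩
  · filter_upwards [hf, hg] with t h1 h2 using h1.mul h2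
  · exact ((hf'.mul hg.self_of_nhds).add (hf.self_of_nhds.mul hg')).congr_deriv (by ring)

theorem const_mul (k : ℝ) (hf : HasJet f f₀ f₁ f₂) :
    HasJet (fun t => k * f t) (k * f₀) (k * f₁) (k * f₂) := by
  simpa using (const k).mul hf

theorem sub (hf : HasJet f f₀ f₁ f₂) (hg : HasJet g g₀ g₁ g₂) :
    HasJet (fun t => f t - g t) (f₀ - g₀) (f₁ - g₁) (f₂ - g₂) := by
  simpa [sub_eq_add_neg] using hf.add (hg.const_mul (-1))

theorem comp {a : ℝ → ℝ} (ha : ContDiff ℝ ∞ a) (hf : HasJet f f₀ f₁ f₂) :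
    HasJet (fun t => a (f t)) (a f₀) (deriv a f₀ * f₁)
      (deriv (deriv a) f₀ * f₁ ^ 2 + deriv a f₀ * f₂) := by
  obtain ⟨f', hf, rfl, rfl, hf'⟩ := hf
  have h1 : ∀ x, HasDerivAt a (deriv a x) x := fun x =>
    (ha.differentiable (by simp) x).hasDerivAt
  have h2 : ∀ x, HasDerivAt (deriv a) (deriv (deriv a) x) x := fun x =>
    (((contDiff_infty_iff_deriv.1 ha).2.differentiable (by simp)) x).hasDerivAt
  refine ⟨fun t => deriv a (f t) * f' t, ?_, rfl, rfl, ?_⟩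
  · filter_upwards [hf] with t ht using (h1 _).comp t ht
  · exact (((h2 (f 0)).comp 0 hf.self_of_nhds).mul hf').congr_deriv (by
      simp only [Function.comp_apply]; ring)

end HasJet

/-- The second derivative along a line computes the diagonal of the second derivative. -/
theorem HasJet.fderiv_fderiv {E : Type*} [NormedAddCommGroup E] [NormedSpace ℝ E] {g : E → ℝ}
    {p w : E} (hg : ContDiffAt ℝ 2 g p) {h₀ h₁ h₂ : ℝ}
    (h : HasJet (fun t => g (p + t • w)) h₀ h₁ h₂) : fderiv ℝ (fderiv ℝ g) p w w = h₂ := by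
  obtain ⟨h', hh, -, -, hh'⟩ := h
  have hline : ∀ t : ℝ, HasDerivAt (fun t : ℝ => p + t • w) w t := fun t => by
    simpa using ((hasDerivAt_id t).smul_const w).const_add p
  have hc : Tendsto (fun t : ℝ => p + t • w) (𝓝 0) (𝓝 p) := by
    simpa using (hline 0).continuousAt.tendsto
  have hd : ∀ᶠ x in 𝓝 p, DifferentiableAt ℝ g x := by
    filter_upwards [hg.eventually (by simp)] with x hx using hx.differentiableAt (by simp)
  have e : h' =ᶠ[𝓝 0] fun t => fderiv ℝ g (p + t • w) w := by
    filter_upwards [hh, hc.eventually hd] with t h1 h2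
    exact h1.unique (h2.hasFDerivAt.comp_hasDerivAt t (hline t))
  have h2 : HasFDerivAt (fderiv ℝ g) (fderiv ℝ (fderiv ℝ g) p) (p + (0 : ℝ) • w) := by
    simpa using ((hg.fderiv_right (m := 1) (by norm_num)).differentiableAt (by simp)).hasFDerivAt
  have h3 : HasDerivAt (fun t : ℝ => fderiv ℝ g (p + t • w)) (fderiv ℝ (fderiv ℝ g) p w) 0 :=
    h2.comp_hasDerivAt (0 : ℝ) (hline 0)
  have h4 : HasDerivAt (fun t : ℝ => fderiv ℝ g (p + t • w) w)
      (fderiv ℝ (fderiv ℝ g) p w w) 0 := by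
    simpa using h3.clm_apply (hasDerivAt_const (0 : ℝ) w)
  exact (hh'.congr_of_eventuallyEq e.symm |>.unique h4).symm

/-! ### The function `log (1 + exp r)` -/

/-- The function `r ↦ log (1 + exp r)`. -/
noncomputable def softplus (r : ℝ) : ℝ := Real.log (1 + Real.exp r)

theorem contDiff_softplus : ContDiff ℝ ∞ softplus :=
  (contDiff_const.add Real.contDiff_exp).log fun x => by positivity

/-- This identity produces all the linear corrections between potentials of adjacent charts. -/
theorem softplus_neg (r : ℝ) : softplus (-r) = softplus r - r := by
  unfold softplus
  rw [Real.exp_neg, eq_sub_iff_add_eq]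
  conv_lhs => rw [← Real.log_exp r, Real.exp_log (Real.exp_pos r)]
  rw [← Real.log_mul (by positivity) (by positivity)]
  congr 1
  have := Real.exp_pos r
  field_simp
  ring

theorem hasDerivAt_softplus (r : ℝ) :
    HasDerivAt softplus (Real.exp r / (1 + Real.exp r)) r :=
  ((Real.hasDerivAt_exp r).const_add 1).log (by positivity)

theorem deriv_softplus : deriv softplus = fun r => Real.exp r / (1 + Real.exp r) :=
  funext fun r => (hasDerivAt_softplus r).deriv

theorem deriv_deriv_softplus (r : ℝ) :
    deriv (deriv softplus) r = Real.exp r / (1 + Real.exp r) ^ 2 := by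
  rw [deriv_softplus]
  have h := (Real.hasDerivAt_exp r).div ((Real.hasDerivAt_exp r).const_add 1)
    (by positivity : (1 + Real.exp r) ≠ 0)
  refine h.deriv.trans ?_
  congr 1
  ring

theorem softplus_le (r : ℝ) : softplus r ≤ Real.exp r := by
  have := Real.log_le_sub_one_of_pos (show 0 < 1 + Real.exp r by positivity)
  unfold softplus
  linarith

theorem le_softplus (r : ℝ) : Real.exp r / (1 + Real.exp r) ≤ softplus r := by
  have h : (0 : ℝ) < 1 + Real.exp r := by positivity
  have := Real.one_sub_inv_le_log_of_pos h
  unfold softplus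
  refine le_trans (le_of_eq ?_) this
  field_simp
  ring

theorem softplus_pos (r : ℝ) : 0 < softplus r :=
  lt_of_lt_of_le (by positivity) (le_softplus r)

/-- `log (1 + B) - log (1 + A) ≥ (B - A) / (1 + B)`. -/
theorem le_softplus_sub (r s : ℝ) :
    (Real.exp s - Real.exp r) / (1 + Real.exp s) ≤ softplus s - softplus r := by
  have hs : (0 : ℝ) < 1 + Real.exp s := by positivity
  have hr : (0 : ℝ) < 1 + Real.exp r := by positivity
  unfold softplus
  rw [← Real.log_div hs.ne' hr.ne']
  refine le_trans (le_of_eq ?_) (Real.one_sub_inv_le_log_of_pos (div_pos hs hr))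
  field_simp
  ring

theorem HasJet.softplus {f : ℝ → ℝ} {f₀ f₁ f₂ : ℝ} (hf : HasJet f f₀ f₁ f₂) :
    HasJet (fun t => softplus (f t)) (softplus f₀) (Real.exp f₀ / (1 + Real.exp f₀) * f₁)
      (Real.exp f₀ / (1 + Real.exp f₀) ^ 2 * f₁ ^ 2 +
        Real.exp f₀ / (1 + Real.exp f₀) * f₂) := by
  have h := hf.comp contDiff_softplus
  rwa [deriv_deriv_softplus, deriv_softplus] at h

/-! ### Estimates for the error terms

In this section `X ≥ Y ≥ 0` are two norms, `(a, b)` is a direction, and all errors are compared with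
`X a² + Y b²`. -/

/-- The third component of a fibre direction is $-(a+b)$, so errors naturally come as
$Y(|a|+|b|)^2$; since $Y\le X$ they are absorbed by $Xa^2+Yb^2$. -/
theorem mul_sq_add_abs_le {X Y a b : ℝ} (hY : 0 ≤ Y) (hYX : Y ≤ X) :
    Y * (|a| + |b|) ^ 2 ≤ 2 * (X * a ^ 2 + Y * b ^ 2) := by
  have h1 : (|a| + |b|) ^ 2 ≤ 2 * (a ^ 2 + b ^ 2) := by
    nlinarith [sq_nonneg (|a| - |b|), sq_abs a, sq_abs b]
  nlinarith [mul_le_mul_of_nonneg_left h1 hY, mul_le_mul_of_nonneg_right hYX (sq_nonneg a)]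

/-- Logarithmic derivative bounds are scale invariant: a factor $\alpha'(d)$ costs $\kappa/d$, so it
is harmless once it multiplies something of size $d$. -/
theorem LogSlow.abs_deriv_mul_le {α : ℝ → ℝ} {κ d m c : ℝ} (h : LogSlow α κ) (hd : 0 < d)
    (hm : |m| ≤ c * d) : |deriv α d * m| ≤ κ * c := by
  have h1 := (h d).1
  rw [abs_mul, abs_of_pos hd] at h1
  rw [abs_mul]
  have hc : 0 ≤ c := nonneg_of_mul_nonneg_left ((abs_nonneg m).trans hm) hd
  calc |deriv α d| * |m| ≤ |deriv α d| * (c * d) := by gcongr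
    _ = d * |deriv α d| * c := by ring
    _ ≤ κ * c := by gcongr

theorem LogSlow.abs_deriv_deriv_mul_le {α : ℝ → ℝ} {κ d m c : ℝ} (h : LogSlow α κ) (hd : 0 < d)
    (hm : |m| ≤ c * d ^ 2) : |deriv (deriv α) d * m| ≤ κ * c := by
  have h1 := (h d).2
  rw [abs_mul, abs_of_pos (pow_pos hd 2)] at h1
  rw [abs_mul]
  have hc : 0 ≤ c := nonneg_of_mul_nonneg_left ((abs_nonneg m).trans hm) (pow_pos hd 2)
  calc |deriv (deriv α) d| * |m| ≤ |deriv (deriv α) d| * (c * d ^ 2) := by gcongr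
    _ = d ^ 2 * |deriv (deriv α) d| * c := by ring
    _ ≤ κ * c := by gcongr

/-- The derivatives of `α₆` contribute little to the second derivative of `α₆ φ_y`. -/
theorem cutoff_error {X Y a b κ A₁ A₂ f₀ f₁ : ℝ} (hY : 0 ≤ Y) (hYX : Y ≤ X)
    (hκ : 0 ≤ κ) (hA₁ : |A₁| ≤ κ * (|a| + |b|)) (hA₂ : |A₂| ≤ κ * (|a| + |b|) ^ 2)
    (hf₀ : |f₀| ≤ Y) (hf₁ : |f₁| ≤ 2 * Y * (|a| + |b|)) :
    |A₂ * f₀ + 2 * (A₁ * f₁)| ≤ 10 * κ * (X * a ^ 2 + Y * b ^ 2) := by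
  have hN := mul_sq_add_abs_le (a := a) (b := b) hY hYX
  set s := |a| + |b|
  have h1 : |A₂ * f₀| ≤ κ * s ^ 2 * Y := by rw [abs_mul]; gcongr
  have h2 : |A₁ * f₁| ≤ κ * s * (2 * Y * s) := by rw [abs_mul]; gcongr
  have h3 : |A₂ * f₀ + 2 * (A₁ * f₁)| ≤ |A₂ * f₀| + 2 * |A₁ * f₁| := by
    refine (abs_add_le _ _).trans ?_
    rw [abs_mul 2, abs_two]
  nlinarith [mul_le_mul_of_nonneg_left hN hκ]

/-- The derivatives of `α₄` contribute little to the second derivative of `α₄(θ) θ`. -/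
theorem angular_error {X Y a b κ θ θ₁ θ₂ : ℝ} {α : ℝ → ℝ} (hY : 0 < Y) (hYX : Y ≤ X)
    (hκ : 0 ≤ κ) (hα : LogSlow α κ)
    (hθ : (deriv α θ = 0 ∧ deriv (deriv α) θ = 0) ∨ Y ≤ 10 * θ)
    (hθ₁ : |θ₁| ≤ 4 * Y * (|a| + |b|)) (hθ₂ : |θ₂| ≤ 4 * Y * (|a| + |b|) ^ 2) :
    |(deriv (deriv α) θ * θ₁ ^ 2 + deriv α θ * θ₂) * θ + 2 * (deriv α θ * θ₁ * θ₁)|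
      ≤ 1000 * κ * (X * a ^ 2 + Y * b ^ 2) := by
  have hN := mul_sq_add_abs_le (a := a) (b := b) hY.le hYX
  have hQ : 0 ≤ X * a ^ 2 + Y * b ^ 2 := by have := hY.le.trans hYX; positivity
  rcases hθ with ⟨h1, h2⟩ | hθ
  · rw [h1, h2]
    simp only [zero_mul, add_zero, mul_zero, abs_zero]
    positivity
  set s := |a| + |b|
  have hs : 0 ≤ s := by positivity
  have hθ0 : 0 < θ := by linarith
  have k1 : θ₁ ^ 2 ≤ 16 * Y ^ 2 * s ^ 2 := by
    have := pow_le_pow_left₀ (abs_nonneg _) hθ₁ 2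
    rw [sq_abs] at this
    linarith
  -- One of the two factors $Y$ is traded for $10\theta$, which then pays for the bump derivative.
  have k1' : θ₁ ^ 2 ≤ 160 * (Y * s ^ 2) * θ := by
    nlinarith [mul_le_mul_of_nonneg_left hθ (show 0 ≤ 16 * Y * s ^ 2 by positivity)]
  have k2 : |deriv (deriv α) θ * (θ₁ ^ 2 * θ)| ≤ κ * (160 * (Y * s ^ 2)) := by
    refine hα.abs_deriv_deriv_mul_le hθ0 ?_
    rw [abs_of_nonneg (by positivity)]
    nlinarith
  have k3 : |deriv α θ * (θ₂ * θ)| ≤ κ * (4 * Y * s ^ 2) := by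
    refine hα.abs_deriv_mul_le hθ0 ?_
    rw [abs_mul, abs_of_pos hθ0]
    gcongr
  have k4 : |deriv α θ * θ₁ ^ 2| ≤ κ * (160 * (Y * s ^ 2)) := by
    refine hα.abs_deriv_mul_le hθ0 ?_
    rwa [abs_of_nonneg (by positivity)]
  have e : (deriv (deriv α) θ * θ₁ ^ 2 + deriv α θ * θ₂) * θ + 2 * (deriv α θ * θ₁ * θ₁) =
      deriv (deriv α) θ * (θ₁ ^ 2 * θ) + deriv α θ * (θ₂ * θ) + 2 * (deriv α θ * θ₁ ^ 2) := by
    ring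
  rw [e]
  have h3 := abs_add_three (deriv (deriv α) θ * (θ₁ ^ 2 * θ)) (deriv α θ * (θ₂ * θ))
    (2 * (deriv α θ * θ₁ ^ 2))
  rw [abs_mul 2, abs_two] at h3
  nlinarith [mul_le_mul_of_nonneg_left hN hκ, mul_nonneg hκ hQ]

/-- The derivatives of `α₃` contribute little to the second derivative of `α₃(d) d`. -/
theorem radial_error {X Y a b κ d d₁ d₂ : ℝ} {α : ℝ → ℝ} (hY : 0 < Y) (hYX : Y ≤ X)
    (hκ : 0 ≤ κ) (hα : LogSlow α κ) (hd : X ≤ 8 * d)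
    (hd₁ : |d₁| ≤ 6 * (X * |a| + Y * |b|)) (hd₂ : |d₂| ≤ 8 * (X * a ^ 2 + Y * b ^ 2)) :
    |(deriv (deriv α) d * d₁ ^ 2 + deriv α d * d₂) * d + 2 * (deriv α d * d₁ * d₁)|
      ≤ 2000 * κ * (X * a ^ 2 + Y * b ^ 2) := by
  have hX := hY.trans_le hYX
  set Q := X * a ^ 2 + Y * b ^ 2 with hQdef
  have hQ : 0 ≤ Q := by positivity
  have hd0 : 0 < d := by linarith
  -- Since $Y\le X$, $(X|a|+Y|b|)^2\le 2(X^2a^2+Y^2b^2)\le 2XQ$; one factor $X\le 8d$ is then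
  -- available to pay for the bump derivative.
  have k1 : d₁ ^ 2 ≤ 72 * X * Q := by
    have h := pow_le_pow_left₀ (abs_nonneg _) hd₁ 2
    rw [sq_abs] at h
    have h2 : (X * |a| + Y * |b|) ^ 2 ≤ 2 * ((X * |a|) ^ 2 + (Y * |b|) ^ 2) := by
      nlinarith [sq_nonneg (X * |a| - Y * |b|)]
    have h3 : (X * |a|) ^ 2 + (Y * |b|) ^ 2 ≤ X * Q := by
      rw [mul_pow, mul_pow, sq_abs, sq_abs, hQdef]
      nlinarith [mul_nonneg (mul_nonneg hY.le (sub_nonneg.2 hYX)) (sq_nonneg b)]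
    nlinarith
  have k1' : d₁ ^ 2 ≤ 576 * Q * d := by nlinarith [mul_le_mul_of_nonneg_right hd hQ]
  have k2 : |deriv (deriv α) d * (d₁ ^ 2 * d)| ≤ κ * (576 * Q) := by
    refine hα.abs_deriv_deriv_mul_le hd0 ?_
    rw [abs_of_nonneg (by positivity)]
    nlinarith
  have k3 : |deriv α d * (d₂ * d)| ≤ κ * (8 * Q) := by
    refine hα.abs_deriv_mul_le hd0 ?_
    rw [abs_mul, abs_of_pos hd0]
    gcongr
  have k4 : |deriv α d * d₁ ^ 2| ≤ κ * (576 * Q) := by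
    refine hα.abs_deriv_mul_le hd0 ?_
    rwa [abs_of_nonneg (by positivity)]
  have e : (deriv (deriv α) d * d₁ ^ 2 + deriv α d * d₂) * d + 2 * (deriv α d * d₁ * d₁) =
      deriv (deriv α) d * (d₁ ^ 2 * d) + deriv α d * (d₂ * d) + 2 * (deriv α d * d₁ ^ 2) := by
    ring
  rw [e]
  have h3 := abs_add_three (deriv (deriv α) d * (d₁ ^ 2 * d)) (deriv α d * (d₂ * d))
    (2 * (deriv α d * d₁ ^ 2))
  rw [abs_mul 2, abs_two] at h3
  nlinarith [mul_nonneg hκ hQ]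

/-- The derivatives of `α₅` contribute little to the second derivative of `α₅(d) B` where `B` is of
the size of `Y`. -/
theorem mixed_error {X Y a b κ d d₁ d₂ B B₁ : ℝ} {α : ℝ → ℝ} (hY : 0 < Y) (hYX : Y ≤ X)
    (hκ : 0 ≤ κ) (hα : LogSlow α κ) (hd : X ≤ 8 * d)
    (hd₁ : |d₁| ≤ 6 * (X * |a| + Y * |b|)) (hd₂ : |d₂| ≤ 8 * (X * a ^ 2 + Y * b ^ 2))
    (hB : |B| ≤ 2 * Y) (hB₁ : |B₁| ≤ 4 * Y * (|a| + |b|)) :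
    |(deriv (deriv α) d * d₁ ^ 2 + deriv α d * d₂) * B + 2 * (deriv α d * d₁ * B₁)|
      ≤ 12000 * κ * (X * a ^ 2 + Y * b ^ 2) := by
  have hX := hY.trans_le hYX
  have hN := mul_sq_add_abs_le (a := a) (b := b) hY.le hYX
  set Q := X * a ^ 2 + Y * b ^ 2 with hQdef
  have hQ : 0 ≤ Q := by positivity
  have hd0 : 0 < d := by linarith
  have k1 : d₁ ^ 2 ≤ 72 * X * Q := by
    have h := pow_le_pow_left₀ (abs_nonneg _) hd₁ 2
    rw [sq_abs] at h
    have h2 : (X * |a| + Y * |b|) ^ 2 ≤ 2 * ((X * |a|) ^ 2 + (Y * |b|) ^ 2) := by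
      nlinarith [sq_nonneg (X * |a| - Y * |b|)]
    have h3 : (X * |a|) ^ 2 + (Y * |b|) ^ 2 ≤ X * Q := by
      rw [mul_pow, mul_pow, sq_abs, sq_abs, hQdef]
      nlinarith [mul_nonneg (mul_nonneg hY.le (sub_nonneg.2 hYX)) (sq_nonneg b)]
    nlinarith
  have k1' : d₁ ^ 2 ≤ 576 * Q * d := by nlinarith [mul_le_mul_of_nonneg_right hd hQ]
  have hBd : |B| ≤ 16 * d := by linarith
  have k2 : |deriv (deriv α) d * (d₁ ^ 2 * B)| ≤ κ * (576 * Q * 16) := by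
    refine hα.abs_deriv_deriv_mul_le hd0 ?_
    rw [abs_mul, abs_of_nonneg (sq_nonneg d₁)]
    calc d₁ ^ 2 * |B| ≤ (576 * Q * d) * (16 * d) := by gcongr
      _ = _ := by ring
  have k3 : |deriv α d * (d₂ * B)| ≤ κ * (8 * Q * 16) := by
    refine hα.abs_deriv_mul_le hd0 ?_
    rw [abs_mul]
    calc |d₂| * |B| ≤ (8 * Q) * (16 * d) := by gcongr
      _ = _ := by ring
  set s := |a| + |b| with hs
  have k4 : |deriv α d * (d₁ * B₁)| ≤ κ * (192 * (Y * s ^ 2)) := by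
    refine hα.abs_deriv_mul_le hd0 ?_
    rw [abs_mul]
    have h1 : |d₁| ≤ 48 * s * d := by
      have : Y * |b| ≤ X * |b| := by gcongr
      have h2 : X * s ≤ 8 * d * s := by gcongr
      rw [hs] at h2 ⊢
      linarith
    calc |d₁| * |B₁| ≤ (48 * s * d) * (4 * Y * s) := by gcongr
      _ = _ := by ring
  have e : (deriv (deriv α) d * d₁ ^ 2 + deriv α d * d₂) * B + 2 * (deriv α d * d₁ * B₁) =
      deriv (deriv α) d * (d₁ ^ 2 * B) + deriv α d * (d₂ * B) + 2 * (deriv α d * (d₁ * B₁)) := by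
    ring
  rw [e]
  have h3 := abs_add_three (deriv (deriv α) d * (d₁ ^ 2 * B)) (deriv α d * (d₂ * B))
    (2 * (deriv α d * (d₁ * B₁)))
  rw [abs_mul 2, abs_two] at h3
  nlinarith [mul_nonneg hκ hQ, mul_le_mul_of_nonneg_left hN hκ]

/-- The convex combination of toric potentials has positive second derivative. -/
theorem toric_main {X Y a b e κ x₂ y₂ z₂ G A α₃ α₄ α₅ : ℝ} (hY : 0 < Y) (hYX : Y ≤ X)
    (hκ : 0 ≤ κ) (he : e = -(a + b)) (hx₂ : 9 / 10 * X ≤ x₂) (hy₂ : 9 / 10 * Y ≤ y₂)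
    (hz₂ : -(κ * Y) ≤ z₂) (hG : y₂ * b ^ 2 + z₂ * e ^ 2 ≤ G)
    (hA₀ : 0 ≤ A) (hA₁ : A ≤ 1) (h₃ : 2 / 3 ≤ α₃) (h₃' : α₃ ≤ 1) (h₄ : 0 ≤ α₄) (h₄' : α₄ ≤ 1 / 2)
    (h₅ : 0 ≤ α₅) (h₅' : α₅ ≤ 1) :
    (1 / 10 - 4 * κ) * (X * a ^ 2 + Y * b ^ 2) ≤
      G - A * (b ^ 2 * y₂) +
        α₃ * (a ^ 2 * x₂ - 1 / 2 * (b ^ 2 * y₂ + e ^ 2 * z₂) + 3 / 2 * (A * (b ^ 2 * y₂))) +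
        α₅ * (α₄ * (b ^ 2 * y₂ - e ^ 2 * z₂) - 1 / 2 * (A * (b ^ 2 * y₂))) := by
  have hX := hY.trans_le hYX
  have hN := mul_sq_add_abs_le (a := a) (b := b) hY.le hYX
  -- The coefficient of the $y$-term is affine in $A$: at $A=0$ it is at least
  -- $1-\alpha_3/2\ge\frac12$, at $A=1$ at least $\alpha_3-\alpha_5/2\ge\frac23-\frac12$.
  have c1 : 1 / 6 ≤ 1 - A - α₃ / 2 + 3 / 2 * (A * α₃) + α₅ * α₄ - α₅ * A / 2 := by
    linarith [mul_nonneg h₅ h₄, mul_nonneg hA₀ (sub_nonneg.2 h₃), mul_nonneg hA₀ (sub_nonneg.2 h₅'),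
      mul_nonneg (sub_nonneg.2 hA₁) (sub_nonneg.2 h₃')]
  have c2 : 0 ≤ 1 - α₃ / 2 - α₅ * α₄ := by
    nlinarith [mul_nonneg h₄ (sub_nonneg.2 h₅')]
  have c3 : 1 - α₃ / 2 - α₅ * α₄ ≤ 1 := by nlinarith [mul_nonneg h₅ h₄]
  have hes : e ^ 2 ≤ (|a| + |b|) ^ 2 := by
    rw [he, neg_sq]
    exact sq_le_sq' (by linarith [neg_abs_le a, neg_abs_le b]) (by linarith [le_abs_self a, le_abs_self b])
  have m1 : 6 / 10 * (X * a ^ 2) ≤ α₃ * (a ^ 2 * x₂) := by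
    have : 2 / 3 * (9 / 10 * X) ≤ α₃ * x₂ := by gcongr
    linarith [mul_le_mul_of_nonneg_right this (sq_nonneg a)]
  have m2 : 15 / 100 * (Y * b ^ 2) ≤
      (1 - A - α₃ / 2 + 3 / 2 * (A * α₃) + α₅ * α₄ - α₅ * A / 2) * (b ^ 2 * y₂) := by
    have : 1 / 6 * (9 / 10 * Y) ≤
      (1 - A - α₃ / 2 + 3 / 2 * (A * α₃) + α₅ * α₄ - α₅ * A / 2) * y₂ := by gcongr
    linarith [mul_le_mul_of_nonneg_right this (sq_nonneg b)]
  -- The second derivative of $\varphi_z$ can be negative because of its term $\log(1+XY)$, but only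
  -- by $\kappa Y$; its coefficient lies in $[0,1]$.
  have m3 : -(2 * κ * (X * a ^ 2 + Y * b ^ 2)) ≤ (1 - α₃ / 2 - α₅ * α₄) * (e ^ 2 * z₂) := by
    have h1 : -(κ * Y * e ^ 2) ≤ e ^ 2 * z₂ := by
      linarith [mul_le_mul_of_nonneg_left hz₂ (sq_nonneg e)]
    have h2 : κ * Y * e ^ 2 ≤ 2 * κ * (X * a ^ 2 + Y * b ^ 2) := by
      have := mul_le_mul_of_nonneg_left hes (mul_nonneg hκ hY.le)
      linarith [mul_le_mul_of_nonneg_left hN hκ]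
    have h3 : 0 ≤ κ * Y * e ^ 2 := by positivity
    linarith [mul_le_mul_of_nonneg_right c3 h3, mul_le_mul_of_nonneg_left h1 c2]
  have p1 : 0 ≤ X * a ^ 2 := by positivity
  have p2 : 0 ≤ Y * b ^ 2 := by positivity
  have p3 := mul_nonneg hκ (add_nonneg p1 p2)
  have e1 : G - A * (b ^ 2 * y₂) +
        α₃ * (a ^ 2 * x₂ - 1 / 2 * (b ^ 2 * y₂ + e ^ 2 * z₂) + 3 / 2 * (A * (b ^ 2 * y₂))) +
        α₅ * (α₄ * (b ^ 2 * y₂ - e ^ 2 * z₂) - 1 / 2 * (A * (b ^ 2 * y₂))) =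
      (G - (y₂ * b ^ 2 + z₂ * e ^ 2)) + α₃ * (a ^ 2 * x₂) +
        (1 - A - α₃ / 2 + 3 / 2 * (A * α₃) + α₅ * α₄ - α₅ * A / 2) * (b ^ 2 * y₂) +
        (1 - α₃ / 2 - α₅ * α₄) * (e ^ 2 * z₂) := by ring
  rw [e1]
  linarith

/-! ### The potential in one vertex chart: smoothness and convexity along the fibre. -/

/-! ### The potential in logarithmic coordinates -/

/-- Bump functions and thresholds with the numerical properties that make the interpolated
potential smooth and convex. Here `ε` is the value of `XYZ`; the function `a₆` is considered as a
function of `log (Y / X)`. -/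
structure Profile where
  (a₃ a₄ a₅ a₆ : ℝ → ℝ)
  (κ ε δ δ' t₁ t₂ r₁ r₂ : ℝ)
  smooth₃ : ContDiff ℝ ∞ a₃
  smooth₄ : ContDiff ℝ ∞ a₄
  smooth₅ : ContDiff ℝ ∞ a₅
  smooth₆ : ContDiff ℝ ∞ a₆
  mem₃ : ∀ d, 2 / 3 ≤ a₃ d ∧ a₃ d ≤ 1
  inner₃ : ∀ d ≤ δ, a₃ d = 2 / 3
  outer₃ : ∀ d ≥ δ', a₃ d = 1
  mem₅ : ∀ d, 0 ≤ a₅ d ∧ a₅ d ≤ 1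
  inner₅ : ∀ d ≤ δ, a₅ d = 0
  outer₅ : ∀ d ≥ δ', a₅ d = 1
  odd₄ : ∀ θ, a₄ (-θ) = -a₄ θ
  mem₄ : ∀ θ ≥ 0, 0 ≤ a₄ θ ∧ a₄ θ ≤ 1 / 2
  inner₄ : ∀ θ, |θ| ≤ t₁ → a₄ θ = 0
  outer₄ : ∀ θ ≥ t₂, a₄ θ = 1 / 2
  mem₆ : ∀ r, 0 ≤ a₆ r ∧ a₆ r ≤ 1
  inner₆ : ∀ r, Real.exp r ≤ r₁ → a₆ r = 0
  outer₆ : ∀ r, r₂ ≤ Real.exp r → a₆ r = 1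
  slow₃ : LogSlow a₃ κ
  slow₄ : LogSlow a₄ κ
  slow₅ : LogSlow a₅ κ
  slow₆ : ∀ r, |deriv a₆ r| ≤ κ ∧ |deriv (deriv a₆) r| ≤ κ
  κ_eq : κ = 1 / 10 ^ 6
  δ_pos : 0 < δ
  t₁_nonneg : 0 ≤ t₁
  r₁_pos : 0 < r₁
  r₁_lt : r₁ < 1
  r₂_lt : r₂ < κ
  δ_le : δ ≤ δ'
  δ'_lt : 8 * δ' < κ
  ε_le : ε ≤ κ ^ 3
  -- The first two of the last three inequalities keep the transition of `a₄` away from where `a₆`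
  -- is nonzero outside the vertex region. The third makes $\theta$ comparable to $Y$ where `a₄`
  -- varies.
  ε_le_radial : 128 * ε ≤ r₁ ^ 2 * δ ^ 3
  t₂_lt : 16 * t₂ < r₁ * δ
  ε_le_angular : ε ≤ δ * t₁ ^ 2

/-- `φ_x` as a function of `log |Tx|²`, `log |Ty|²`, `log |Tz|²`. -/
noncomputable def logPhi (u v w : ℝ) : ℝ := softplus u - softplus (v + w)

/-- `g_xy` as a function of `log |Tx|²`, `log |Ty|²`. -/
noncomputable def logTile (u v : ℝ) : ℝ := softplus u + softplus v + softplus (u + v)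

namespace Profile

variable (c : Profile)

/-- The radial variable `d`. -/
noncomputable def radial (p : ℝ × ℝ × ℝ) : ℝ :=
  logPhi p.1 p.2.1 p.2.2 - 1 / 2 * (logPhi p.2.1 p.1 p.2.2 + logPhi p.2.2 p.1 p.2.1) +
    3 / 2 * (c.a₆ (p.2.1 - p.1) * logPhi p.2.1 p.1 p.2.2)

/-- The angular variable `θ`. -/
noncomputable def _root_.BananaMirror.angular (p : ℝ × ℝ × ℝ) : ℝ :=
  logPhi p.2.1 p.1 p.2.2 - logPhi p.2.2 p.1 p.2.1

/-- The interpolated potential where `x` is the largest and `z` the smallest coordinate. -/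
noncomputable def chamber (p : ℝ × ℝ × ℝ) : ℝ :=
  logTile p.2.1 p.2.2 - c.a₆ (p.2.1 - p.1) * logPhi p.2.1 p.1 p.2.2 +
    c.a₃ (c.radial p) * c.radial p +
    c.a₅ (c.radial p) * (c.a₄ (angular p) * angular p -
      1 / 2 * (c.a₆ (p.2.1 - p.1) * logPhi p.2.1 p.1 p.2.2))

/-- The points with `1 ≥ |Tx| ≥ |Ty| ≥ |Tz|` on the fibre. -/
def InChamber (p : ℝ × ℝ × ℝ) : Prop :=
  p.1 ≤ 0 ∧ p.2.1 ≤ p.1 ∧ p.2.2 ≤ p.2.1 ∧ Real.exp (p.1 + p.2.1 + p.2.2) = c.ε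

theorem contDiff_radial : ContDiff ℝ ∞ c.radial := by
  have h := contDiff_softplus
  have h6 := c.smooth₆
  unfold radial logPhi
  fun_prop

theorem _root_.BananaMirror.contDiff_angular : ContDiff ℝ ∞ angular := by
  have h := contDiff_softplus
  unfold angular logPhi
  fun_prop

theorem contDiff_chamber : ContDiff ℝ ∞ c.chamber := by
  have h := contDiff_softplus
  have h1 := c.contDiff_radial
  have h2 := contDiff_angular
  have h3 := c.smooth₃
  have h4 := c.smooth₄
  have h5 := c.smooth₅
  have h6 := c.smooth₆
  unfold chamber logPhi logTile
  fun_prop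

theorem contDiff_tile : ContDiff ℝ ∞ (fun p : ℝ × ℝ × ℝ => logTile p.1 p.2.1) := by
  have h := contDiff_softplus
  unfold logTile
  fun_prop

/-! ### Sizes -/

variable {c}

theorem logPhi_le (u v w : ℝ) : logPhi u v w ≤ Real.exp u := by
  have := softplus_le u
  have := softplus_pos (v + w)
  unfold logPhi
  linarith

theorem neg_le_logPhi (u v w : ℝ) : -(Real.exp v * Real.exp w) ≤ logPhi u v w := by
  have := softplus_le (v + w)
  have := softplus_pos u
  rw [Real.exp_add] at *
  unfold logPhi
  linarith

theorem le_logPhi (u v w : ℝ) :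
    Real.exp u / (1 + Real.exp u) - Real.exp v * Real.exp w ≤ logPhi u v w := by
  have := softplus_le (v + w)
  have := le_softplus u
  rw [Real.exp_add] at *
  unfold logPhi
  linarith

/-- The basic inequalities between the three norms at a point of the chamber. -/
theorem InChamber.sizes {p : ℝ × ℝ × ℝ} (h : c.InChamber p) :
    Real.exp p.1 ≤ 1 ∧ Real.exp p.2.1 ≤ Real.exp p.1 ∧ Real.exp p.2.2 ≤ Real.exp p.2.1 ∧
      Real.exp p.1 * Real.exp p.2.1 * Real.exp p.2.2 = c.ε ∧ Real.exp p.2.2 ≤ c.κ := by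
  obtain ⟨h1, h2, h3, h4⟩ := h
  rw [Real.exp_add, Real.exp_add] at h4
  have k2 := Real.exp_le_exp.2 h2
  have k3 := Real.exp_le_exp.2 h3
  refine ⟨Real.exp_le_one_iff.2 h1, k2, k3, h4, ?_⟩
  have k4 : Real.exp p.2.2 ^ 3 ≤ c.κ ^ 3 := by
    refine le_trans ?_ (h4.le.trans c.ε_le)
    have := Real.exp_pos p.2.2
    calc Real.exp p.2.2 ^ 3 = Real.exp p.2.2 * Real.exp p.2.2 * Real.exp p.2.2 := by ring
      _ ≤ _ := by gcongr; linarith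
  exact le_of_pow_le_pow_left₀ (by norm_num) (by rw [c.κ_eq]; norm_num) k4

/-- With `le_radial` this makes $d$ comparable to $X$; it turns the threshold $d\ge\delta$ into
$X\ge\delta/4$. -/
theorem radial_le {p : ℝ × ℝ × ℝ} (h : c.InChamber p) : c.radial p ≤ 4 * Real.exp p.1 := by
  obtain ⟨h1, h2, h3, -, -⟩ := h.sizes
  have := Real.exp_pos p.1
  have := Real.exp_pos p.2.1
  have := Real.exp_pos p.2.2
  have k1 := logPhi_le p.1 p.2.1 p.2.2
  have k2 := logPhi_le p.2.1 p.1 p.2.2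
  have k3 := neg_le_logPhi p.2.1 p.1 p.2.2
  have k4 := neg_le_logPhi p.2.2 p.1 p.2.1
  have k5 : Real.exp p.1 * Real.exp p.2.2 ≤ Real.exp p.1 := by nlinarith
  have k6 : Real.exp p.1 * Real.exp p.2.1 ≤ Real.exp p.1 := by nlinarith
  obtain ⟨m1, m2⟩ := c.mem₆ (p.2.1 - p.1)
  have k7 : c.a₆ (p.2.1 - p.1) * logPhi p.2.1 p.1 p.2.2 ≤ Real.exp p.2.1 := by
    refine (mul_le_mul_of_nonneg_left k2 m1).trans ?_
    nlinarith
  unfold radial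
  linarith

/-- Unless `α₆` is locally equal to `1`, the norm of `y` is much smaller than the norm of `x`. -/
theorem small_or_outer₆ (p : ℝ × ℝ × ℝ) :
    Real.exp p.2.1 ≤ c.κ * Real.exp p.1 ∨ ∀ᶠ r in 𝓝 (p.2.1 - p.1), c.a₆ r = 1 := by
  rcases le_or_gt (Real.exp (p.2.1 - p.1)) c.r₂ with h | h
  · left
    rw [Real.exp_sub, div_le_iff₀ (Real.exp_pos _)] at h
    exact h.trans (mul_le_mul_of_nonneg_right c.r₂_lt.le (Real.exp_pos _).le)
  · right
    filter_upwards [Real.continuous_exp.continuousAt.eventually_const_lt h] with r hr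
      using c.outer₆ r hr.le

/-- The only dangerous term is $-\frac12\varphi_y$. Either $Y\le\kappa X$ and it is negligible, or
$\alpha_6=1$ and the correction $\frac32\alpha_6\varphi_y$ makes the total coefficient of
$\varphi_y$ equal to $1$. -/
theorem le_radial {p : ℝ × ℝ × ℝ} (h : c.InChamber p) : Real.exp p.1 ≤ 8 * c.radial p := by
  obtain ⟨h1, h2, h3, -, h5⟩ := h.sizes
  have hX := Real.exp_pos p.1
  have hY := Real.exp_pos p.2.1
  have hZ := Real.exp_pos p.2.2
  rw [c.κ_eq] at h5
  have k1 := le_logPhi p.1 p.2.1 p.2.2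
  have k4 := logPhi_le p.2.2 p.1 p.2.1
  have k5 : Real.exp p.1 / 2 ≤ Real.exp p.1 / (1 + Real.exp p.1) := by gcongr; linarith
  have k7 : Real.exp p.1 * Real.exp p.2.2 ≤ Real.exp p.1 * (1 / 10 ^ 6) := by gcongr
  have k8 : Real.exp p.2.1 * Real.exp p.2.2 ≤ Real.exp p.2.1 * (1 / 10 ^ 6) := by gcongr
  obtain ⟨m1, m2⟩ := c.mem₆ (p.2.1 - p.1)
  unfold radial
  rcases c.small_or_outer₆ p with h6 | h6
  · rw [c.κ_eq] at h6
    have k2 := logPhi_le p.2.1 p.1 p.2.2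
    have k3 := neg_le_logPhi p.2.1 p.1 p.2.2
    have k9 : -Real.exp p.1 * (1 / 10 ^ 6) ≤ c.a₆ (p.2.1 - p.1) * logPhi p.2.1 p.1 p.2.2 := by
      have := mul_le_mul_of_nonneg_left k3 m1
      have k10 : 0 < Real.exp p.1 * Real.exp p.2.2 := by positivity
      nlinarith
    linarith
  · rw [h6.self_of_nhds]
    have k3 := le_logPhi p.2.1 p.1 p.2.2
    have k6 : Real.exp p.2.1 / 2 ≤ Real.exp p.2.1 / (1 + Real.exp p.2.1) := by gcongr; linarith
    linarith

theorem angular_eq (p : ℝ × ℝ × ℝ) : angular p =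
    (softplus p.2.1 - softplus p.2.2) + (softplus (p.1 + p.2.1) - softplus (p.1 + p.2.2)) := by
  unfold angular logPhi
  ring

theorem softplus_mono : Monotone softplus := fun r s h => by
  have := le_softplus_sub r s
  have h1 : 0 ≤ (Real.exp s - Real.exp r) / (1 + Real.exp s) :=
    div_nonneg (sub_nonneg.2 (Real.exp_le_exp.2 h)) (by positivity)
  linarith

theorem softplus_sub_le {r s : ℝ} (h : r ≤ s) :
    softplus s - softplus r ≤ Real.exp s - Real.exp r := by
  have h1 := le_softplus_sub s r
  have h2 : 0 ≤ Real.exp s - Real.exp r := sub_nonneg.2 (Real.exp_le_exp.2 h)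
  have h3 : (Real.exp s - Real.exp r) / (1 + Real.exp r) ≤ Real.exp s - Real.exp r :=
    div_le_self h2 (by linarith [Real.exp_pos r])
  have h4 : (Real.exp r - Real.exp s) / (1 + Real.exp r) =
    -((Real.exp s - Real.exp r) / (1 + Real.exp r)) := by ring
  linarith

theorem angular_nonneg {p : ℝ × ℝ × ℝ} (h : p.2.2 ≤ p.2.1) : 0 ≤ angular p := by
  rw [angular_eq]
  have h1 := softplus_mono h
  have h2 := softplus_mono (show p.1 + p.2.2 ≤ p.1 + p.2.1 by linarith)
  linarith

theorem angular_le {p : ℝ × ℝ × ℝ} (h : c.InChamber p) :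
    angular p ≤ 2 * (Real.exp p.2.1 - Real.exp p.2.2) := by
  obtain ⟨h1, h2, h3, -, -⟩ := h.sizes
  rw [angular_eq]
  have k1 := softplus_sub_le h.2.2.1
  have k2 := softplus_sub_le (show p.1 + p.2.2 ≤ p.1 + p.2.1 by linarith [h.2.2.1])
  rw [Real.exp_add, Real.exp_add] at k2
  nlinarith [Real.exp_pos p.1]

theorem le_angular {p : ℝ × ℝ × ℝ} (h : c.InChamber p) :
    Real.exp p.2.1 - Real.exp p.2.2 ≤ 2 * angular p := by
  obtain ⟨h1, h2, h3, -, -⟩ := h.sizes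
  rw [angular_eq]
  have k1 := le_softplus_sub p.2.2 p.2.1
  have k2 := softplus_mono (show p.1 + p.2.2 ≤ p.1 + p.2.1 by linarith [h.2.2.1])
  have k3 : (Real.exp p.2.1 - Real.exp p.2.2) / 2 ≤
      (Real.exp p.2.1 - Real.exp p.2.2) / (1 + Real.exp p.2.1) := by
    apply div_le_div_of_nonneg_left (by linarith) (by positivity) (by linarith)
  linarith

/-- Away from the vertex, `α₆` vanishes or `α₄ = 1/2`. -/
theorem inner₆_or_outer₄ {p : ℝ × ℝ × ℝ} (h : c.InChamber p) (hd : c.δ ≤ c.radial p) :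
    Real.exp (p.2.1 - p.1) < c.r₁ ∨ (c.t₂ < angular p ∧ p.2.2 < p.2.1) := by
  rcases lt_or_ge (Real.exp (p.2.1 - p.1)) c.r₁ with h6 | h6
  · exact Or.inl h6
  right
  obtain ⟨h1, h2, h3, h4, -⟩ := h.sizes
  have hr := c.r₁_pos
  have hδ := c.δ_pos
  rw [Real.exp_sub, le_div_iff₀ (Real.exp_pos _)] at h6
  have k1 := radial_le h
  have hX := Real.exp_pos p.1
  have hY := Real.exp_pos p.2.1
  have k2 : c.δ / 4 ≤ Real.exp p.1 := by linarith
  -- If $Y\ge r_1X$ and $Z>r_1X/2$, then $XYZ>r_1^2X^3/2\ge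
  -- r_1^2(\delta/4)^3/2=r_1^2\delta^3/128\ge\varepsilon$, contradicting $XYZ=\varepsilon$. So $Z\le
  -- Y/2$, whence $\theta\ge Y/4\ge r_1\delta/16>t_2$.
  have k3 : 2 * Real.exp p.2.2 ≤ Real.exp p.2.1 := by
    by_contra! hlt
    have e1 : c.r₁ * Real.exp p.1 / 2 < Real.exp p.2.2 := by linarith
    have e2 : Real.exp p.1 * (c.r₁ * Real.exp p.1) * (c.r₁ * Real.exp p.1 / 2) < c.ε := by
      rw [← h4]
      have : Real.exp p.1 * (c.r₁ * Real.exp p.1) ≤ Real.exp p.1 * Real.exp p.2.1 := by gcongr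
      have h0 : 0 < c.r₁ * Real.exp p.1 / 2 := by positivity
      calc _ ≤ Real.exp p.1 * Real.exp p.2.1 * (c.r₁ * Real.exp p.1 / 2) := by gcongr
        _ < _ := by gcongr
    have e3 : (c.δ / 4) ^ 3 ≤ Real.exp p.1 ^ 3 := by gcongr
    have e4 := c.ε_le_radial
    have e5 := mul_le_mul_of_nonneg_left e3 (sq_nonneg c.r₁)
    nlinarith
  have k4 := le_angular h
  refine ⟨?_, Real.exp_lt_exp.1 (by linarith [Real.exp_pos p.2.2])⟩
  have k5 : c.r₁ * (c.δ / 4) ≤ c.r₁ * Real.exp p.1 := by gcongr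
  linarith [c.t₂_lt]

/-- Where `α₄` varies, the angular variable is comparable to `Y`. -/
theorem le_angular_of_le {p : ℝ × ℝ × ℝ} (h : c.InChamber p) (hd : c.δ ≤ c.radial p)
    (ht : c.t₁ ≤ angular p) : Real.exp p.2.1 ≤ 10 * angular p := by
  obtain ⟨h1, h2, h3, h4, -⟩ := h.sizes
  have k1 := radial_le h
  have k2 := le_angular h
  have k3 := angular_le h
  have hX := Real.exp_pos p.1
  have hY := Real.exp_pos p.2.1
  have hZ := Real.exp_pos p.2.2
  have ht1 := c.t₁_nonneg
  have hδ := c.δ_pos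
  -- From $X\ge\delta/4$ and $XYZ=\varepsilon$ one gets $YZ\le4t_1^2\le4\theta^2$. But $Y>10\theta$
  -- would give $Z\ge Y-2\theta\ge\frac45Y$, hence $YZ>80\theta^2$ or a contradiction at $\theta=0$.
  have e1 : Real.exp p.2.1 * Real.exp p.2.2 ≤ 4 * angular p ^ 2 := by
    have e2 : c.δ / 4 * (Real.exp p.2.1 * Real.exp p.2.2) ≤ c.δ * angular p ^ 2 := by
      calc _ ≤ Real.exp p.1 * (Real.exp p.2.1 * Real.exp p.2.2) := by gcongr; linarith
        _ = c.ε := by rw [← h4]; ring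
        _ ≤ c.δ * c.t₁ ^ 2 := c.ε_le_angular
        _ ≤ _ := by gcongr
    by_contra! hlt
    nlinarith [mul_lt_mul_of_pos_left hlt hδ]
  by_contra! hlt
  have h0 : 0 ≤ angular p := by linarith
  have e3 : Real.exp p.2.1 * (8 / 10 * Real.exp p.2.1) ≤ Real.exp p.2.1 * Real.exp p.2.2 := by
    gcongr; linarith
  nlinarith

/-- Where $X$ is not small, only the formulas with $\alpha_3=\alpha_5=1$ occur. This includes all
chart boundaries. -/
theorem δ'_lt_radial {p : ℝ × ℝ × ℝ} (h : c.InChamber p) (hX : c.κ ≤ Real.exp p.1) :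
    c.δ' < c.radial p := by
  linarith [le_radial h, c.δ'_lt]

end Profile

/-! ### Positivity of the second derivative -/

/-- The factor in the first derivative of `φ_x`. -/
noncomputable def phiOne (u s : ℝ) : ℝ :=
  Real.exp u / (1 + Real.exp u) + Real.exp s / (1 + Real.exp s)

/-- The factor in the second derivative of `φ_x`. -/
noncomputable def phiTwo (u s : ℝ) : ℝ :=
  Real.exp u / (1 + Real.exp u) ^ 2 - Real.exp s / (1 + Real.exp s) ^ 2

theorem hasJet_softplus_affine (u a : ℝ) :
    HasJet (fun t => softplus (u + t * a)) (softplus u) (Real.exp u / (1 + Real.exp u) * a)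
      (Real.exp u / (1 + Real.exp u) ^ 2 * a ^ 2) := by
  simpa using (HasJet.affine u a).softplus

theorem hasJet_softplus_affine_add (u v a b : ℝ) :
    HasJet (fun t => softplus ((u + t * a) + (v + t * b))) (softplus (u + v))
      (Real.exp (u + v) / (1 + Real.exp (u + v)) * (a + b))
      (Real.exp (u + v) / (1 + Real.exp (u + v)) ^ 2 * (a + b) ^ 2) := by
  simpa using ((HasJet.affine u a).add (HasJet.affine v b)).softplus

/-- Along the fibre $b+e=-a$, so both derivatives of $\varphi_x$ involve $a$ alone. This makes the
frozen second derivatives of $d$ and $\theta$ diagonal in $a^2,b^2,e^2$. -/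
theorem hasJet_logPhi (u v w : ℝ) {a b e : ℝ} (h : a + b + e = 0) :
    HasJet (fun t => logPhi (u + t * a) (v + t * b) (w + t * e)) (logPhi u v w)
      (a * phiOne u (v + w)) (a ^ 2 * phiTwo u (v + w)) := by
  have h1 := (hasJet_softplus_affine u a).sub (hasJet_softplus_affine_add v w b e)
  have hbe : b + e = -a := by linarith
  rw [hbe] at h1
  unfold logPhi phiOne phiTwo
  convert h1 using 1 <;> ring

theorem hasJet_logTile (u v a b : ℝ) :
    HasJet (fun t => logTile (u + t * a) (v + t * b)) (logTile u v)
      (Real.exp u / (1 + Real.exp u) * a + Real.exp v / (1 + Real.exp v) * b +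
        Real.exp (u + v) / (1 + Real.exp (u + v)) * (a + b))
      (Real.exp u / (1 + Real.exp u) ^ 2 * a ^ 2 + Real.exp v / (1 + Real.exp v) ^ 2 * b ^ 2 +
        Real.exp (u + v) / (1 + Real.exp (u + v)) ^ 2 * (a + b) ^ 2) :=
  ((hasJet_softplus_affine u a).add (hasJet_softplus_affine v b)).add
    (hasJet_softplus_affine_add u v a b)

theorem logistic_nonneg (u : ℝ) : 0 ≤ Real.exp u / (1 + Real.exp u) := by positivity

theorem logistic_le (u : ℝ) : Real.exp u / (1 + Real.exp u) ≤ Real.exp u :=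
  div_le_self (Real.exp_pos u).le (by linarith [Real.exp_pos u])

theorem logistic_deriv_le (u : ℝ) : Real.exp u / (1 + Real.exp u) ^ 2 ≤ Real.exp u :=
  div_le_self (Real.exp_pos u).le (by nlinarith [Real.exp_pos u])

theorem le_logistic_deriv (u : ℝ) :
    Real.exp u * (1 - 2 * Real.exp u) ≤ Real.exp u / (1 + Real.exp u) ^ 2 := by
  have h := Real.exp_pos u
  rw [le_div_iff₀ (by positivity), mul_assoc]
  refine mul_le_of_le_one_right h.le ?_
  nlinarith [pow_pos h 2, pow_pos h 3]

theorem phiOne_nonneg (u s : ℝ) : 0 ≤ phiOne u s :=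
  add_nonneg (logistic_nonneg u) (logistic_nonneg s)

theorem phiOne_le (u s : ℝ) : phiOne u s ≤ Real.exp u + Real.exp s :=
  add_le_add (logistic_le u) (logistic_le s)

theorem phiTwo_le (u s : ℝ) : phiTwo u s ≤ Real.exp u := by
  have := logistic_deriv_le u
  have : 0 ≤ Real.exp s / (1 + Real.exp s) ^ 2 := by positivity
  unfold phiTwo
  linarith

theorem le_phiTwo (u s : ℝ) :
    Real.exp u / (1 + Real.exp u) ^ 2 - Real.exp s ≤ phiTwo u s := by
  have := logistic_deriv_le s
  unfold phiTwo
  linarith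

theorem neg_le_phiTwo (u s : ℝ) : -Real.exp s ≤ phiTwo u s := by
  have := le_phiTwo u s
  have : 0 ≤ Real.exp u / (1 + Real.exp u) ^ 2 := by positivity
  linarith

namespace Profile

variable {c : Profile}

theorem deriv_eq_zero_of_eventually {α : ℝ → ℝ} {x k : ℝ} (h : ∀ᶠ y in 𝓝 x, α y = k) :
    deriv α x = 0 ∧ deriv (deriv α) x = 0 := by
  have h1 : α =ᶠ[𝓝 x] fun _ => k := h
  have h2 : deriv α =ᶠ[𝓝 x] fun _ => 0 := by simpa using h1.deriv
  exact ⟨h2.self_of_nhds, by simpa using h2.deriv.self_of_nhds⟩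

/-- At every point of the chamber where `α₅` does not vanish nearby, `α₄` is locally constant or
the angular variable is comparable to `Y`. -/
theorem angular_dichotomy {p : ℝ × ℝ × ℝ} (h : c.InChamber p) (hd : c.δ ≤ c.radial p) :
    (deriv c.a₄ (angular p) = 0 ∧ deriv (deriv c.a₄) (angular p) = 0) ∨
      Real.exp p.2.1 ≤ 10 * angular p := by
  rcases lt_or_ge (angular p) c.t₁ with ht | ht
  · left
    apply deriv_eq_zero_of_eventually (k := 0)
    have h1 : |angular p| < c.t₁ := by rwa [abs_of_nonneg (angular_nonneg h.2.2.1)]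
    filter_upwards [continuous_abs.continuousAt.eventually_lt_const h1] with θ hθ
      using c.inner₄ θ hθ.le
  · exact Or.inr (le_angular_of_le h hd ht)

theorem hasJet_angular (p : ℝ × ℝ × ℝ) {a b e : ℝ} (h : a + b + e = 0) :
    HasJet (fun t => angular (p + t • (a, b, e))) (angular p)
      (b * phiOne p.2.1 (p.1 + p.2.2) - e * phiOne p.2.2 (p.1 + p.2.1))
      (b ^ 2 * phiTwo p.2.1 (p.1 + p.2.2) - e ^ 2 * phiTwo p.2.2 (p.1 + p.2.1)) :=
  (hasJet_logPhi p.2.1 p.1 p.2.2 (show b + a + e = 0 by linarith)).sub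
    (hasJet_logPhi p.2.2 p.1 p.2.1 (show e + a + b = 0 by linarith))

/-- The derivatives of the angular variable are of the size of `Y`. -/
theorem angular_jet_le {p : ℝ × ℝ × ℝ} (h : c.InChamber p) {a b e : ℝ} (he : a + b + e = 0) :
    |b * phiOne p.2.1 (p.1 + p.2.2) - e * phiOne p.2.2 (p.1 + p.2.1)| ≤
        4 * Real.exp p.2.1 * (|a| + |b|) ∧
      |b ^ 2 * phiTwo p.2.1 (p.1 + p.2.2) - e ^ 2 * phiTwo p.2.2 (p.1 + p.2.1)| ≤
        4 * Real.exp p.2.1 * (|a| + |b|) ^ 2 := by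
  obtain ⟨h1, h2, h3, -, -⟩ := h.sizes
  have hX := Real.exp_pos p.1
  have hY := Real.exp_pos p.2.1
  have hZ := Real.exp_pos p.2.2
  have ebs : |e| ≤ |a| + |b| := by
    rw [show e = -(a + b) by linarith, abs_neg]
    exact abs_add_le a b
  have bs : |b| ≤ |a| + |b| := by linarith [abs_nonneg a]
  have f1 : Real.exp (p.1 + p.2.2) ≤ Real.exp p.2.1 := by rw [Real.exp_add]; nlinarith
  have f2 : Real.exp (p.1 + p.2.1) ≤ Real.exp p.2.1 := by rw [Real.exp_add]; nlinarith
  have y1 := phiOne_le p.2.1 (p.1 + p.2.2)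
  have z1 := phiOne_le p.2.2 (p.1 + p.2.1)
  have y1' := phiOne_nonneg p.2.1 (p.1 + p.2.2)
  have z1' := phiOne_nonneg p.2.2 (p.1 + p.2.1)
  have y2 : |phiTwo p.2.1 (p.1 + p.2.2)| ≤ Real.exp p.2.1 := abs_le.2
    ⟨by linarith [neg_le_phiTwo p.2.1 (p.1 + p.2.2)], phiTwo_le _ _⟩
  have z2 : |phiTwo p.2.2 (p.1 + p.2.1)| ≤ Real.exp p.2.1 := abs_le.2
    ⟨by linarith [neg_le_phiTwo p.2.2 (p.1 + p.2.1)], (phiTwo_le _ _).trans h3⟩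
  constructor
  · refine (abs_sub _ _).trans ?_
    rw [abs_mul, abs_mul, abs_of_nonneg y1', abs_of_nonneg z1']
    have m1 : |b| * phiOne p.2.1 (p.1 + p.2.2) ≤ (|a| + |b|) * (2 * Real.exp p.2.1) := by
      gcongr; linarith
    have m2 : |e| * phiOne p.2.2 (p.1 + p.2.1) ≤ (|a| + |b|) * (2 * Real.exp p.2.1) := by
      gcongr; linarith
    linarith
  · refine (abs_sub _ _).trans ?_
    rw [abs_mul, abs_mul, abs_pow, abs_pow]
    have m1 : |b| ^ 2 * |phiTwo p.2.1 (p.1 + p.2.2)| ≤ (|a| + |b|) ^ 2 * Real.exp p.2.1 := by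
      gcongr
    have m2 : |e| ^ 2 * |phiTwo p.2.2 (p.1 + p.2.1)| ≤ (|a| + |b|) ^ 2 * Real.exp p.2.1 := by
      gcongr
    have : 0 ≤ (|a| + |b|) ^ 2 * Real.exp p.2.1 := by positivity
    linarith

/-- The sum of squares to which second derivatives are compared. -/
theorem sq_sum_pos {X Y a b : ℝ} (hX : 0 < X) (hY : 0 < Y) (hab : (a, b) ≠ 0) :
    0 < X * a ^ 2 + Y * b ^ 2 := by
  by_cases ha : a = 0
  · have hb : b ≠ 0 := fun hb => hab (by rw [ha, hb]; rfl)
    have := sq_pos_of_ne_zero hb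
    positivity
  · have := sq_pos_of_ne_zero ha
    positivity

/-- The second derivative is grouped so that every term containing a derivative of a bump function
is literally the left side of one of `cutoff_error`, `radial_error`, `mixed_error`, `angular_error`,
and the rest is the expression in `toric_main`. -/
theorem hasJet_chamber {p : ℝ × ℝ × ℝ} {a b e A₁ A₂ f₁ f₂ x₁ x₂ z₁ z₂ θ₁ θ₂ d₁ d₂ : ℝ}
    (jx : HasJet (fun t => logPhi (p.1 + t * a) (p.2.1 + t * b) (p.2.2 + t * e))
      (logPhi p.1 p.2.1 p.2.2) x₁ x₂)
    (jy : HasJet (fun t => logPhi (p.2.1 + t * b) (p.1 + t * a) (p.2.2 + t * e))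
      (logPhi p.2.1 p.1 p.2.2) f₁ f₂)
    (jz : HasJet (fun t => logPhi (p.2.2 + t * e) (p.1 + t * a) (p.2.1 + t * b))
      (logPhi p.2.2 p.1 p.2.1) z₁ z₂)
    (jA : HasJet (fun t => c.a₆ (p.2.1 + t * b - (p.1 + t * a))) (c.a₆ (p.2.1 - p.1)) A₁ A₂)
    (hθ₁ : θ₁ = f₁ - z₁) (hθ₂ : θ₂ = f₂ - z₂)
    (hd₁ : d₁ = x₁ - 1 / 2 * (f₁ + z₁) +
      3 / 2 * (A₁ * logPhi p.2.1 p.1 p.2.2 + c.a₆ (p.2.1 - p.1) * f₁))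
    (hd₂ : d₂ = x₂ - 1 / 2 * (f₂ + z₂) +
      3 / 2 * (A₂ * logPhi p.2.1 p.1 p.2.2 + 2 * (A₁ * f₁) + c.a₆ (p.2.1 - p.1) * f₂)) :
    ∃ h₁, HasJet (fun t => c.chamber (p + t • (a, b, e))) (c.chamber p) h₁
      (Real.exp p.2.1 / (1 + Real.exp p.2.1) ^ 2 * b ^ 2 +
          Real.exp p.2.2 / (1 + Real.exp p.2.2) ^ 2 * e ^ 2 +
          Real.exp (p.2.1 + p.2.2) / (1 + Real.exp (p.2.1 + p.2.2)) ^ 2 * (b + e) ^ 2 -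
        (A₂ * logPhi p.2.1 p.1 p.2.2 + 2 * (A₁ * f₁) + c.a₆ (p.2.1 - p.1) * f₂) +
        (((deriv (deriv c.a₃) (c.radial p) * d₁ ^ 2 + deriv c.a₃ (c.radial p) * d₂) * c.radial p +
          2 * (deriv c.a₃ (c.radial p) * d₁ * d₁)) + c.a₃ (c.radial p) * d₂) +
        (((deriv (deriv c.a₅) (c.radial p) * d₁ ^ 2 + deriv c.a₅ (c.radial p) * d₂) *
            (c.a₄ (angular p) * angular p -
              1 / 2 * (c.a₆ (p.2.1 - p.1) * logPhi p.2.1 p.1 p.2.2)) +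
          2 * (deriv c.a₅ (c.radial p) * d₁ *
            (deriv c.a₄ (angular p) * θ₁ * angular p + c.a₄ (angular p) * θ₁ -
              1 / 2 * (A₁ * logPhi p.2.1 p.1 p.2.2 + c.a₆ (p.2.1 - p.1) * f₁)))) +
          c.a₅ (c.radial p) *
            (((deriv (deriv c.a₄) (angular p) * θ₁ ^ 2 + deriv c.a₄ (angular p) * θ₂) * angular p +
                2 * (deriv c.a₄ (angular p) * θ₁ * θ₁)) + c.a₄ (angular p) * θ₂ -
              1 / 2 * (A₂ * logPhi p.2.1 p.1 p.2.2 + 2 * (A₁ * f₁) +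
                c.a₆ (p.2.1 - p.1) * f₂)))) := by
  subst hθ₁ hθ₂ hd₁ hd₂
  have jAy := jA.mul jy
  have jd : HasJet (fun t => c.radial (p + t • (a, b, e))) (c.radial p) _ _ :=
    (jx.sub ((jy.add jz).const_mul (1 / 2))).add (jAy.const_mul (3 / 2))
  have jθ : HasJet (fun t => angular (p + t • (a, b, e))) (angular p) _ _ := jy.sub jz
  exact ⟨_, (((hasJet_logTile p.2.1 p.2.2 b e).sub jAy).add ((jd.comp c.smooth₃).mul jd)).add
      ((jd.comp c.smooth₅).mul (((jθ.comp c.smooth₄).mul jθ).sub (jAy.const_mul (1 / 2))))⟩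

theorem abs_radial_one_le {X Y a b x y z f g : ℝ} (hY : 0 ≤ Y) (hYX : Y ≤ X)
    (hx : |x| ≤ 2 * (X * |a|)) (hy : |y| ≤ 2 * (Y * |b|)) (hz : |z| ≤ 2 * (Y * (|a| + |b|)))
    (hf : |f| ≤ 1 / 100 * (Y * (|a| + |b|))) (hg : |g| ≤ 2 * (Y * |b|)) :
    |x - 1 / 2 * (y + z) + 3 / 2 * (f + g)| ≤ 6 * (X * |a| + Y * |b|) := by
  have h1 : Y * |a| ≤ X * |a| := by gcongr
  have h2 : 0 ≤ Y * |b| := by positivity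
  have h3 : 0 ≤ Y * |a| := by positivity
  rw [mul_add] at hz hf
  rw [abs_le] at *
  constructor <;> linarith

theorem abs_radial_two_le {A B x y z C g : ℝ} (hA : 0 ≤ A) (hB : 0 ≤ B) (hx : |x| ≤ A)
    (hy : |y| ≤ B) (hz : |z| ≤ 2 * (A + B)) (hC : |C| ≤ A + B) (hg : |g| ≤ B) :
    |x - 1 / 2 * (y + z) + 3 / 2 * (C + g)| ≤ 8 * (A + B) := by
  rw [abs_le] at *
  constructor <;> linarith

theorem abs_mixed_le {Y α θ A f : ℝ} (hα : 0 ≤ α) (hα' : α ≤ 1 / 2) (hθ : 0 ≤ θ)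
    (hθ' : θ ≤ 2 * Y) (hA : 0 ≤ A) (hA' : A ≤ 1) (hf : |f| ≤ Y) :
    |α * θ - 1 / 2 * (A * f)| ≤ 2 * Y := by
  have k1 : α * θ ≤ 1 / 2 * (2 * Y) := by gcongr
  have k2 : 0 ≤ α * θ := by positivity
  have k3 : |A * f| ≤ Y := by
    rw [abs_mul, abs_of_nonneg hA]
    exact (mul_le_of_le_one_left (abs_nonneg _) hA').trans hf
  rw [abs_le] at k3 ⊢
  constructor <;> linarith

theorem abs_mixed_one_le {Y s α α' θ θ₁ f g : ℝ} (hα : 0 ≤ α) (hα' : α ≤ 1 / 2)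
    (hslow : |θ * α'| ≤ 1 / 10 ^ 6) (hθ₁ : |θ₁| ≤ 4 * Y * s) (hf : |f| ≤ 1 / 100 * (Y * s))
    (hg : |g| ≤ 2 * (Y * s)) (hY : 0 ≤ Y) (hs : 0 ≤ s) :
    |α' * θ₁ * θ + α * θ₁ - 1 / 2 * (f + g)| ≤ 4 * Y * s := by
  have k1 : |α' * θ₁ * θ| ≤ 1 / 10 ^ 6 * (4 * Y * s) := by
    rw [mul_right_comm, abs_mul, mul_comm α']
    gcongr
  have k2 : |α * θ₁| ≤ 1 / 2 * (4 * Y * s) := by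
    rw [abs_mul, abs_of_nonneg hα]
    gcongr
  have : 0 ≤ Y * s := by positivity
  rw [abs_le] at *
  constructor <;> linarith

/-- The cutoff term enters with total weight at most $1+\frac32+\frac12$, so all losses add up to
$(4+30+2000+12000+1000)\kappa Q$, about $0.015\,Q$, against a gain of $Q/10$. -/
theorem positive_of_errors {κ Q G A y α₃ α₅ D d₂ C E₃ E₅ E₄ α₄ θ₂ : ℝ} (hκ : κ = 1 / 10 ^ 6)
    (hQ : 0 < Q)
    (hmain : (1 / 10 - 4 * κ) * Q ≤ G - A * y + α₃ * (D + 3 / 2 * (A * y)) +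
      α₅ * (α₄ * θ₂ - 1 / 2 * (A * y)))
    (hd₂ : d₂ = D + 3 / 2 * (C + A * y)) (h₃ : 0 ≤ α₃) (h₃' : α₃ ≤ 1) (h₅ : 0 ≤ α₅)
    (h₅' : α₅ ≤ 1) (hC : |C| ≤ 10 * κ * Q) (hE₃ : |E₃| ≤ 2000 * κ * Q)
    (hE₅ : |E₅| ≤ 12000 * κ * Q) (hE₄ : |α₅ * E₄| ≤ 1000 * κ * Q) :
    0 < G - (C + A * y) + (E₃ + α₃ * d₂) +
      (E₅ + α₅ * (E₄ + α₄ * θ₂ - 1 / 2 * (C + A * y))) := by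
  have C3 : |α₃ * C| ≤ 10 * κ * Q := by
    rw [abs_mul, abs_of_nonneg h₃]
    exact (mul_le_of_le_one_left (abs_nonneg _) h₃').trans hC
  have C5 : |α₅ * C| ≤ 10 * κ * Q := by
    rw [abs_mul, abs_of_nonneg h₅]
    exact (mul_le_of_le_one_left (abs_nonneg _) h₅').trans hC
  subst hκ hd₂
  rw [abs_le] at *
  linarith

set_option maxHeartbeats 800000 in
/-- Positivity where all coordinates are small. -/
theorem chamber_pos_of_small {p : ℝ × ℝ × ℝ} (h : c.InChamber p) (hκ : Real.exp p.1 ≤ c.κ)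
    {a b e : ℝ} (he : a + b + e = 0) (hab : (a, b) ≠ 0) :
    0 < fderiv ℝ (fderiv ℝ c.chamber) p (a, b, e) (a, b, e) := by
  obtain ⟨h1, h2, h3, -, hZκ⟩ := h.sizes
  have hX := Real.exp_pos p.1
  have hY := Real.exp_pos p.2.1
  have hZ := Real.exp_pos p.2.2
  have hdX := le_radial h
  obtain ⟨θ1, θ2⟩ := angular_jet_le h he
  have hκe := c.κ_eq
  have hκ0 : 0 ≤ c.κ := by rw [hκe]; norm_num
  have ebs : |e| ≤ |a| + |b| := by
    rw [show e = -(a + b) by linarith, abs_neg]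
    exact abs_add_le a b
  have hN := mul_sq_add_abs_le (a := a) (b := b) hY.le h2
  have hQ := sq_sum_pos hX hY hab
  have hs : 0 ≤ |a| + |b| := by positivity
  obtain ⟨m61, m62⟩ := c.mem₆ (p.2.1 - p.1)
  obtain ⟨m31, m32⟩ := c.mem₃ (c.radial p)
  obtain ⟨m51, m52⟩ := c.mem₅ (c.radial p)
  obtain ⟨m41, m42⟩ := c.mem₄ (angular p) (angular_nonneg h.2.2.1)
  -- products of two norms
  have exz : Real.exp (p.1 + p.2.2) ≤ c.κ * Real.exp p.2.1 := by
    rw [Real.exp_add]; gcongr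
  have exy : Real.exp (p.1 + p.2.1) ≤ c.κ * Real.exp p.2.1 := by
    rw [Real.exp_add]; gcongr
  have eyz : Real.exp (p.2.1 + p.2.2) ≤ c.κ * Real.exp p.1 := by
    rw [Real.exp_add, mul_comm]; gcongr
  have κY : c.κ * Real.exp p.2.1 ≤ 1 / 100 * Real.exp p.2.1 := by
    rw [hκe]; gcongr; norm_num
  have κX : c.κ * Real.exp p.1 ≤ 1 / 100 * Real.exp p.1 := by
    rw [hκe]; gcongr; norm_num
  have f0 : |logPhi p.2.1 p.1 p.2.2| ≤ Real.exp p.2.1 := by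
    refine abs_le.2 ⟨?_, logPhi_le _ _ _⟩
    have := neg_le_logPhi p.2.1 p.1 p.2.2
    rw [← Real.exp_add] at this
    linarith
  have jx := hasJet_logPhi p.1 p.2.1 p.2.2 he
  have jy := hasJet_logPhi p.2.1 p.1 p.2.2 (show b + a + e = 0 by linarith)
  have jz := hasJet_logPhi p.2.2 p.1 p.2.1 (show e + a + b = 0 by linarith)
  have x1 := phiOne_le p.1 (p.2.1 + p.2.2)
  have y1 := phiOne_le p.2.1 (p.1 + p.2.2)
  have z1 := phiOne_le p.2.2 (p.1 + p.2.1)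
  have x1' := phiOne_nonneg p.1 (p.2.1 + p.2.2)
  have y1' := phiOne_nonneg p.2.1 (p.1 + p.2.2)
  have z1' := phiOne_nonneg p.2.2 (p.1 + p.2.1)
  have x2 := phiTwo_le p.1 (p.2.1 + p.2.2)
  have y2 := phiTwo_le p.2.1 (p.1 + p.2.2)
  have z2 := phiTwo_le p.2.2 (p.1 + p.2.1)
  have z2' := neg_le_phiTwo p.2.2 (p.1 + p.2.1)
  have x2' : 9 / 10 * Real.exp p.1 ≤ phiTwo p.1 (p.2.1 + p.2.2) := by
    have k1 := le_phiTwo p.1 (p.2.1 + p.2.2)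
    have k2 := le_logistic_deriv p.1
    have k3 : Real.exp p.1 * Real.exp p.1 ≤ c.κ * Real.exp p.1 := by gcongr
    linarith
  have y2' : 9 / 10 * Real.exp p.2.1 ≤ phiTwo p.2.1 (p.1 + p.2.2) := by
    have k1 := le_phiTwo p.2.1 (p.1 + p.2.2)
    have k2 := le_logistic_deriv p.2.1
    have k3 : Real.exp p.2.1 * Real.exp p.2.1 ≤ c.κ * Real.exp p.2.1 := by
      gcongr; exact h2.trans hκ
    linarith
  have hG : phiTwo p.2.1 (p.1 + p.2.2) * b ^ 2 + phiTwo p.2.2 (p.1 + p.2.1) * e ^ 2 ≤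
      Real.exp p.2.1 / (1 + Real.exp p.2.1) ^ 2 * b ^ 2 +
        Real.exp p.2.2 / (1 + Real.exp p.2.2) ^ 2 * e ^ 2 +
        Real.exp (p.2.1 + p.2.2) / (1 + Real.exp (p.2.1 + p.2.2)) ^ 2 * (b + e) ^ 2 := by
    unfold phiTwo
    have k1 : 0 ≤ Real.exp (p.1 + p.2.2) / (1 + Real.exp (p.1 + p.2.2)) ^ 2 * b ^ 2 := by
      positivity
    have k2 : 0 ≤ Real.exp (p.1 + p.2.1) / (1 + Real.exp (p.1 + p.2.1)) ^ 2 * e ^ 2 := by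
      positivity
    have k3 : 0 ≤ Real.exp (p.2.1 + p.2.2) / (1 + Real.exp (p.2.1 + p.2.2)) ^ 2 *
      (b + e) ^ 2 := by positivity
    linarith
  have hmain := toric_main (A := c.a₆ (p.2.1 - p.1)) (α₃ := c.a₃ (c.radial p))
    (α₄ := c.a₄ (angular p)) (α₅ := c.a₅ (c.radial p)) hY h2 hκ0 (show e = -(a + b) by linarith)
    x2' y2' (by linarith) hG m61 m62 m31 m32 m41 m42 m51 m52
  obtain ⟨A₁, A₂, hA₁, hA₂, jA⟩ : ∃ A₁ A₂, |A₁| ≤ c.κ * (|a| + |b|) ∧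
      |A₂| ≤ c.κ * (|a| + |b|) ^ 2 ∧
      HasJet (fun t => c.a₆ (p.2.1 + t * b - (p.1 + t * a))) (c.a₆ (p.2.1 - p.1)) A₁ A₂ := by
    refine ⟨_, _, ?_, ?_, ((HasJet.affine p.2.1 b).sub (HasJet.affine p.1 a)).comp c.smooth₆⟩
    · rw [abs_mul]
      have := abs_sub b a
      exact mul_le_mul (c.slow₆ _).1 (by linarith) (abs_nonneg _) hκ0
    · rw [sub_zero, mul_zero, add_zero, abs_mul, abs_pow]
      have := abs_sub b a
      refine mul_le_mul (c.slow₆ _).2 ?_ (by positivity) hκ0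
      gcongr
      linarith
  have hC := cutoff_error hY.le h2 hκ0 hA₁ hA₂ f0
    (f₁ := b * phiOne p.2.1 (p.1 + p.2.2)) (by
      rw [abs_mul, abs_of_nonneg y1', mul_comm]
      have : |b| ≤ |a| + |b| := le_add_of_nonneg_left (abs_nonneg a)
      gcongr
      linarith)
  obtain ⟨d₁, hd₁⟩ : ∃ d, d = a * phiOne p.1 (p.2.1 + p.2.2) -
      1 / 2 * (b * phiOne p.2.1 (p.1 + p.2.2) + e * phiOne p.2.2 (p.1 + p.2.1)) +
      3 / 2 * (A₁ * logPhi p.2.1 p.1 p.2.2 +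
        c.a₆ (p.2.1 - p.1) * (b * phiOne p.2.1 (p.1 + p.2.2))) := ⟨_, rfl⟩
  obtain ⟨d₂, hd₂⟩ : ∃ d, d = a ^ 2 * phiTwo p.1 (p.2.1 + p.2.2) -
      1 / 2 * (b ^ 2 * phiTwo p.2.1 (p.1 + p.2.2) + e ^ 2 * phiTwo p.2.2 (p.1 + p.2.1)) +
      3 / 2 * (A₂ * logPhi p.2.1 p.1 p.2.2 + 2 * (A₁ * (b * phiOne p.2.1 (p.1 + p.2.2))) +
        c.a₆ (p.2.1 - p.1) * (b ^ 2 * phiTwo p.2.1 (p.1 + p.2.2))) := ⟨_, rfl⟩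
  obtain ⟨_, jh⟩ := hasJet_chamber jx jy jz jA rfl rfl hd₁ hd₂
  rw [jh.fderiv_fderiv (c.contDiff_chamber.contDiffAt.of_le (by norm_cast))]
  clear jh jx jy jz jA
  -- sizes of first derivatives
  have bax : |a * phiOne p.1 (p.2.1 + p.2.2)| ≤ 2 * (Real.exp p.1 * |a|) := by
    rw [abs_mul, abs_of_nonneg x1']
    have : |a| * phiOne p.1 (p.2.1 + p.2.2) ≤ |a| * (2 * Real.exp p.1) := by
      gcongr; linarith only [x1, eyz, κX, hX]
    linarith only [this]
  have bby : |b * phiOne p.2.1 (p.1 + p.2.2)| ≤ 2 * (Real.exp p.2.1 * |b|) := by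
    rw [abs_mul, abs_of_nonneg y1']
    have : |b| * phiOne p.2.1 (p.1 + p.2.2) ≤ |b| * (2 * Real.exp p.2.1) := by
      gcongr; linarith only [y1, exz, κY, hY]
    linarith only [this]
  have bez : |e * phiOne p.2.2 (p.1 + p.2.1)| ≤ 2 * (Real.exp p.2.1 * (|a| + |b|)) := by
    rw [abs_mul, abs_of_nonneg z1']
    have : |e| * phiOne p.2.2 (p.1 + p.2.1) ≤ (|a| + |b|) * (2 * Real.exp p.2.1) := by
      gcongr; linarith only [z1, exy, κY, hY, h3]
    linarith only [this]
  have bAf : |A₁ * logPhi p.2.1 p.1 p.2.2| ≤ 1 / 100 * (Real.exp p.2.1 * (|a| + |b|)) := by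
    rw [abs_mul]
    calc _ ≤ c.κ * (|a| + |b|) * Real.exp p.2.1 := by gcongr
      _ = c.κ * Real.exp p.2.1 * (|a| + |b|) := by ring
      _ ≤ 1 / 100 * Real.exp p.2.1 * (|a| + |b|) := by gcongr
      _ = _ := by ring
  have bAb : |c.a₆ (p.2.1 - p.1) * (b * phiOne p.2.1 (p.1 + p.2.2))| ≤
      2 * (Real.exp p.2.1 * |b|) := by
    rw [abs_mul, abs_of_nonneg m61]
    exact (mul_le_of_le_one_left (abs_nonneg _) m62).trans bby
  have bd1 : |d₁| ≤ 6 * (Real.exp p.1 * |a| + Real.exp p.2.1 * |b|) :=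
    hd₁ ▸ abs_radial_one_le hY.le h2 bax bby bez bAf bAb
  have X2 : |a ^ 2 * phiTwo p.1 (p.2.1 + p.2.2)| ≤ Real.exp p.1 * a ^ 2 := by
    rw [abs_of_nonneg (mul_nonneg (sq_nonneg a) (by linarith only [x2', hX])), mul_comm]
    gcongr
  have Y2 : |b ^ 2 * phiTwo p.2.1 (p.1 + p.2.2)| ≤ Real.exp p.2.1 * b ^ 2 := by
    rw [abs_of_nonneg (mul_nonneg (sq_nonneg b) (by linarith only [y2', hY])), mul_comm]
    gcongr
  have Z2 : |e ^ 2 * phiTwo p.2.2 (p.1 + p.2.1)| ≤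
      2 * (Real.exp p.1 * a ^ 2 + Real.exp p.2.1 * b ^ 2) := by
    refine le_trans ?_ hN
    rw [abs_mul, abs_pow, mul_comm]
    have : |phiTwo p.2.2 (p.1 + p.2.1)| ≤ Real.exp p.2.1 := abs_le.2
      ⟨by linarith only [z2', exy, κY, hY], by linarith only [z2, h3]⟩
    gcongr
  have AY2 : |c.a₆ (p.2.1 - p.1) * (b ^ 2 * phiTwo p.2.1 (p.1 + p.2.2))| ≤
      Real.exp p.2.1 * b ^ 2 := by
    rw [abs_mul, abs_of_nonneg m61]
    exact (mul_le_of_le_one_left (abs_nonneg _) m62).trans Y2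
  have Xa2 : 0 ≤ Real.exp p.1 * a ^ 2 := by positivity
  have Yb2 : 0 ≤ Real.exp p.2.1 * b ^ 2 := by positivity
  have hC1 : 10 * c.κ * (Real.exp p.1 * a ^ 2 + Real.exp p.2.1 * b ^ 2) ≤
      Real.exp p.1 * a ^ 2 + Real.exp p.2.1 * b ^ 2 :=
    mul_le_of_le_one_left (add_nonneg Xa2 Yb2) (by rw [hκe]; norm_num)
  have bd2 : |d₂| ≤ 8 * (Real.exp p.1 * a ^ 2 + Real.exp p.2.1 * b ^ 2) :=
    hd₂ ▸ abs_radial_two_le Xa2 Yb2 X2 Y2 Z2 (hC.trans hC1) AY2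
  have hθY : angular p ≤ 2 * Real.exp p.2.1 := by linarith only [angular_le h, hZ]
  have bB := abs_mixed_le m41 m42 (angular_nonneg h.2.2.1) hθY m61 m62 f0
  have bB1 := abs_mixed_one_le m41 m42 (hκe ▸ (c.slow₄ (angular p)).1) θ1 bAf (bAb.trans (by
    have : |b| ≤ |a| + |b| := le_add_of_nonneg_left (abs_nonneg a)
    gcongr)) hY.le hs
  have E3 := radial_error hY h2 hκ0 c.slow₃ hdX bd1 bd2
  have E5 := mixed_error hY h2 hκ0 c.slow₅ hdX bd1 bd2 bB bB1
  obtain ⟨E4v, hE4v⟩ : ∃ E, E = (deriv (deriv c.a₄) (angular p) *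
      (b * phiOne p.2.1 (p.1 + p.2.2) - e * phiOne p.2.2 (p.1 + p.2.1)) ^ 2 +
      deriv c.a₄ (angular p) *
      (b ^ 2 * phiTwo p.2.1 (p.1 + p.2.2) - e ^ 2 * phiTwo p.2.2 (p.1 + p.2.1))) * angular p +
      2 * (deriv c.a₄ (angular p) *
        (b * phiOne p.2.1 (p.1 + p.2.2) - e * phiOne p.2.2 (p.1 + p.2.1)) *
        (b * phiOne p.2.1 (p.1 + p.2.2) - e * phiOne p.2.2 (p.1 + p.2.1))) := ⟨_, rfl⟩
  have E4 : |c.a₅ (c.radial p) * E4v| ≤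
      1000 * c.κ * (Real.exp p.1 * a ^ 2 + Real.exp p.2.1 * b ^ 2) := by
    -- Near the vertex $\theta$ need not be comparable to $Y$, but there $\alpha_5=0$ switches the
    -- angular term off.
    rcases lt_or_ge (c.radial p) c.δ with hd | hd
    · rw [c.inner₅ _ hd.le, zero_mul, abs_zero]
      positivity
    · rw [abs_mul, abs_of_nonneg m51, hE4v]
      exact (mul_le_of_le_one_left (abs_nonneg _) m52).trans
        (angular_error hY h2 hκ0 c.slow₄ (angular_dichotomy h hd) θ1 θ2)
  rw [← hE4v]
  exact positive_of_errors hκe hQ hmain hd₂ (by linarith only [m31]) m32 m51 m52 hC E3 E5 E4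

end Profile

/-- The second derivative of the composition with a linear map. -/
theorem fderiv_fderiv_comp_clm {E F : Type*} [NormedAddCommGroup E] [NormedSpace ℝ E]
    [NormedAddCommGroup F] [NormedSpace ℝ F] {g : F → ℝ} (L : E →L[ℝ] F) {p : E}
    (hg : ContDiffAt ℝ 2 g (L p)) (u w : E) :
    fderiv ℝ (fderiv ℝ fun x => g (L x)) p u w = fderiv ℝ (fderiv ℝ g) (L p) (L u) (L w) := by
  have hd : ∀ᶠ x in 𝓝 p, DifferentiableAt ℝ g (L x) := by
    refine L.continuous.continuousAt.eventually ?_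
    filter_upwards [hg.eventually (by simp)] with x hx using hx.differentiableAt (by simp)
  have e : (fderiv ℝ fun x => g (L x)) =ᶠ[𝓝 p] fun x => (fderiv ℝ g (L x)).comp L := by
    filter_upwards [hd] with x hx
    exact (hx.hasFDerivAt.comp x L.hasFDerivAt).fderiv
  rw [e.fderiv_eq]
  have h2 : HasFDerivAt (fderiv ℝ g) (fderiv ℝ (fderiv ℝ g) (L p)) (L p) :=
    ((hg.fderiv_right (m := 1) (by norm_num)).differentiableAt (by simp)).hasFDerivAt
  have h3 : HasFDerivAt (fun x => (fderiv ℝ g (L x)).comp L) _ p :=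
    (h2.comp p L.hasFDerivAt).clm_comp (hasFDerivAt_const L p)
  rw [h3.fderiv]
  simp

namespace Profile

variable {c : Profile}

/-! ### Simpler formulas for the potential in parts of the chamber -/

theorem eventually_eq_of_lt {α : ℝ → ℝ} {k x₀ : ℝ} {f : ℝ × ℝ × ℝ → ℝ} {p : ℝ × ℝ × ℝ}
    (hf : ContinuousAt f p) (hx : f p < x₀) (h : ∀ x ≤ x₀, α x = k) :
    ∀ᶠ q in 𝓝 p, α (f q) = k := by
  filter_upwards [hf.eventually_lt_const hx] with q hq using h _ hq.le

theorem eventually_eq_of_gt {α : ℝ → ℝ} {k x₀ : ℝ} {f : ℝ × ℝ × ℝ → ℝ} {p : ℝ × ℝ × ℝ}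
    (hf : ContinuousAt f p) (hx : x₀ < f p) (h : ∀ x ≥ x₀, α x = k) :
    ∀ᶠ q in 𝓝 p, α (f q) = k := by
  filter_upwards [hf.eventually_const_lt hx] with q hq using h _ hq.le

theorem eventually_inner₆ {p : ℝ × ℝ × ℝ} (h : Real.exp (p.2.1 - p.1) < c.r₁) :
    ∀ᶠ q : ℝ × ℝ × ℝ in 𝓝 p, c.a₆ (q.2.1 - q.1) = 0 := by
  have hf : ContinuousAt (fun q : ℝ × ℝ × ℝ => Real.exp (q.2.1 - q.1)) p := by fun_prop
  filter_upwards [hf.eventually_lt_const h] with q hq using c.inner₆ _ hq.le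

theorem eventually_outer₆ {p : ℝ × ℝ × ℝ} (h : p.1 = p.2.1) :
    ∀ᶠ q : ℝ × ℝ × ℝ in 𝓝 p, c.a₆ (q.2.1 - q.1) = 1 := by
  have hf : ContinuousAt (fun q : ℝ × ℝ × ℝ => Real.exp (q.2.1 - q.1)) p := by fun_prop
  have h1 : c.r₂ < Real.exp (p.2.1 - p.1) := by
    rw [h, sub_self, Real.exp_zero]
    refine c.r₂_lt.trans ?_
    rw [c.κ_eq]
    norm_num
  filter_upwards [hf.eventually_const_lt h1] with q hq using c.outer₆ _ hq.le

/-- The symmetric potential around the vertex. -/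
noncomputable def _root_.BananaMirror.vertexSym (p : ℝ × ℝ × ℝ) : ℝ :=
  2 / 3 * (softplus p.1 + softplus p.2.1 + softplus p.2.2) +
    1 / 3 * (softplus (p.1 + p.2.1) + softplus (p.1 + p.2.2) + softplus (p.2.1 + p.2.2))

theorem chamber_eventuallyEq_vertex {p : ℝ × ℝ × ℝ} (h : c.radial p < c.δ) :
    c.chamber =ᶠ[𝓝 p] vertexSym := by
  have hc := c.contDiff_radial.continuous.continuousAt (x := p)
  filter_upwards [eventually_eq_of_lt hc h c.inner₃, eventually_eq_of_lt hc h c.inner₅]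
    with q h3 h5
  unfold chamber
  rw [h3, h5]
  unfold radial vertexSym logPhi logTile
  ring

/-- The potential where `α₆ = 0`. -/
noncomputable def innerPot (c : Profile) (p : ℝ × ℝ × ℝ) : ℝ :=
  logTile p.2.1 p.2.2 +
    c.a₃ (logPhi p.1 p.2.1 p.2.2 - 1 / 2 * (logPhi p.2.1 p.1 p.2.2 + logPhi p.2.2 p.1 p.2.1)) *
      (logPhi p.1 p.2.1 p.2.2 - 1 / 2 * (logPhi p.2.1 p.1 p.2.2 + logPhi p.2.2 p.1 p.2.1)) +
    c.a₅ (logPhi p.1 p.2.1 p.2.2 - 1 / 2 * (logPhi p.2.1 p.1 p.2.2 + logPhi p.2.2 p.1 p.2.1)) *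
      (c.a₄ (angular p) * angular p)

theorem chamber_eventuallyEq_inner {p : ℝ × ℝ × ℝ} (h : Real.exp (p.2.1 - p.1) < c.r₁) :
    c.chamber =ᶠ[𝓝 p] c.innerPot := by
  filter_upwards [eventually_inner₆ h] with q hq
  unfold chamber radial innerPot
  rw [hq]
  simp only [zero_mul, mul_zero, sub_zero, add_zero]

theorem angular_swap (p : ℝ × ℝ × ℝ) : angular (p.1, p.2.2, p.2.1) = -angular p := by
  unfold angular
  ring

/-- Both $\theta$ and $\alpha_4(\theta)$ change sign under $y\leftrightarrow z$, so their product
does not. This gives smoothness across the wall $Y=Z$. -/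
theorem innerPot_swap (p : ℝ × ℝ × ℝ) : c.innerPot (p.1, p.2.2, p.2.1) = c.innerPot p := by
  unfold innerPot
  rw [angular_swap, c.odd₄]
  have e1 : logTile p.2.2 p.2.1 = logTile p.2.1 p.2.2 := by
    unfold logTile
    rw [add_comm p.2.2]
    ring
  have e2 : logPhi p.1 p.2.2 p.2.1 = logPhi p.1 p.2.1 p.2.2 := by
    unfold logPhi
    rw [add_comm p.2.2]
  simp only [e1, e2, add_comm (logPhi p.2.2 p.1 p.2.1)]
  ring

/-- The potential where `α₆ = 1` and `α₄ = 1/2`. -/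
noncomputable def outerPot (c : Profile) (p : ℝ × ℝ × ℝ) : ℝ :=
  softplus p.2.2 + softplus (p.2.1 + p.2.2) + softplus (p.1 + p.2.2) +
    c.a₃ (logPhi p.1 p.2.1 p.2.2 + logPhi p.2.1 p.1 p.2.2 - 1 / 2 * logPhi p.2.2 p.1 p.2.1) *
      (logPhi p.1 p.2.1 p.2.2 + logPhi p.2.1 p.1 p.2.2 - 1 / 2 * logPhi p.2.2 p.1 p.2.1) -
    c.a₅ (logPhi p.1 p.2.1 p.2.2 + logPhi p.2.1 p.1 p.2.2 - 1 / 2 * logPhi p.2.2 p.1 p.2.1) *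
      (1 / 2 * logPhi p.2.2 p.1 p.2.1)

theorem eventually_outer₄ {p : ℝ × ℝ × ℝ} (h : c.t₂ < angular p) :
    ∀ᶠ q in 𝓝 p, c.a₄ (angular q) = 1 / 2 :=
  eventually_eq_of_gt contDiff_angular.continuous.continuousAt h c.outer₄

theorem chamber_eventuallyEq_outer {p : ℝ × ℝ × ℝ} (h : p.1 = p.2.1) (ht : c.t₂ < angular p) :
    c.chamber =ᶠ[𝓝 p] c.outerPot := by
  filter_upwards [eventually_outer₆ h, eventually_outer₄ ht] with q h6 h4
  have e : c.radial q = logPhi q.1 q.2.1 q.2.2 + logPhi q.2.1 q.1 q.2.2 -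
      1 / 2 * logPhi q.2.2 q.1 q.2.1 := by
    unfold radial
    rw [h6]
    ring
  unfold chamber outerPot
  rw [h6, h4, e]
  have e3 : logTile q.2.1 q.2.2 - 1 * logPhi q.2.1 q.1 q.2.2 =
      softplus q.2.2 + softplus (q.2.1 + q.2.2) + softplus (q.1 + q.2.2) := by
    unfold logTile logPhi
    ring
  rw [e3]
  unfold angular
  ring

/-- With $\alpha_6=1$ the radial variable becomes $\varphi_x+\varphi_y-\frac12\varphi_z$, symmetric
in $x,y$. This gives smoothness across the wall $X=Y$. -/
theorem outerPot_swap (p : ℝ × ℝ × ℝ) : c.outerPot (p.2.1, p.1, p.2.2) = c.outerPot p := by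
  unfold outerPot
  have e2 : logPhi p.2.2 p.2.1 p.1 = logPhi p.2.2 p.1 p.2.1 := by
    unfold logPhi
    rw [add_comm p.2.1]
  simp only [e2, add_comm (logPhi p.2.1 p.1 p.2.2)]
  ring

/-- The potential along the axis, where `α₃ = α₅ = 1` and `α₆ = 0`. -/
noncomputable def axisPot (c : Profile) (p : ℝ × ℝ × ℝ) : ℝ :=
  1 / 2 * (logTile p.1 p.2.1 + logTile p.1 p.2.2) + c.a₄ (angular p) * angular p

theorem chamber_eventuallyEq_axis {p : ℝ × ℝ × ℝ} (hd : c.δ' < c.radial p)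
    (h : Real.exp (p.2.1 - p.1) < c.r₁) : c.chamber =ᶠ[𝓝 p] c.axisPot := by
  have hc := c.contDiff_radial.continuous.continuousAt (x := p)
  filter_upwards [eventually_inner₆ h, eventually_eq_of_gt hc hd c.outer₃,
    eventually_eq_of_gt hc hd c.outer₅] with q h6 h3 h5
  unfold chamber
  rw [h3, h5]
  unfold radial
  rw [h6]
  unfold axisPot logTile logPhi
  ring

theorem chamber_eventuallyEq_tile {p : ℝ × ℝ × ℝ} (hd : c.δ' < c.radial p)
    (h : c.t₂ < angular p) : c.chamber =ᶠ[𝓝 p] fun q => logTile q.1 q.2.1 := by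
  have hc := c.contDiff_radial.continuous.continuousAt (x := p)
  filter_upwards [eventually_outer₄ h, eventually_eq_of_gt hc hd c.outer₃,
    eventually_eq_of_gt hc hd c.outer₅] with q h4 h3 h5
  unfold chamber
  rw [h3, h5, h4]
  unfold radial angular logTile logPhi
  ring

theorem tile_jet_ge {p : ℝ × ℝ × ℝ} (h : c.InChamber p) (a b : ℝ) :
    1 / 4 * (Real.exp p.1 * a ^ 2 + Real.exp p.2.1 * b ^ 2) ≤
      Real.exp p.1 / (1 + Real.exp p.1) ^ 2 * a ^ 2 +
        Real.exp p.2.1 / (1 + Real.exp p.2.1) ^ 2 * b ^ 2 +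
        Real.exp (p.1 + p.2.1) / (1 + Real.exp (p.1 + p.2.1)) ^ 2 * (a + b) ^ 2 := by
  obtain ⟨h1, h2, -, -, -⟩ := h.sizes
  have key : ∀ r, Real.exp r ≤ 1 → 1 / 4 * Real.exp r ≤ Real.exp r / (1 + Real.exp r) ^ 2 := by
    intro r hr
    have := Real.exp_pos r
    rw [le_div_iff₀ (by positivity)]
    have : (1 + Real.exp r) ^ 2 ≤ 4 := by nlinarith
    nlinarith
  have k1 := mul_le_mul_of_nonneg_right (key p.1 h1) (sq_nonneg a)
  have k2 := mul_le_mul_of_nonneg_right (key p.2.1 (h2.trans h1)) (sq_nonneg b)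
  have k3 : 0 ≤ Real.exp (p.1 + p.2.1) / (1 + Real.exp (p.1 + p.2.1)) ^ 2 * (a + b) ^ 2 := by
    positivity
  linarith

theorem fderiv_fderiv_congr {f g : ℝ × ℝ × ℝ → ℝ} {p : ℝ × ℝ × ℝ} (h : f =ᶠ[𝓝 p] g) :
    fderiv ℝ (fderiv ℝ f) p = fderiv ℝ (fderiv ℝ g) p :=
  h.fderiv.fderiv_eq

/-- Positivity where the largest coordinate is not small. -/
theorem chamber_pos_of_large {p : ℝ × ℝ × ℝ} (h : c.InChamber p) (hκ : c.κ ≤ Real.exp p.1)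
    {a b e : ℝ} (he : a + b + e = 0) (hab : (a, b) ≠ 0) :
    0 < fderiv ℝ (fderiv ℝ c.chamber) p (a, b, e) (a, b, e) := by
  have hd := δ'_lt_radial h hκ
  have hX := Real.exp_pos p.1
  have hY := Real.exp_pos p.2.1
  have hQ := sq_sum_pos hX hY hab
  have hT := tile_jet_ge h a b
  rcases inner₆_or_outer₄ h (c.δ_le.trans hd.le) with h6 | ⟨h4, -⟩
  · have hev := chamber_eventuallyEq_axis hd h6
    have hcd : ContDiffAt ℝ 2 c.axisPot p :=
      ((c.contDiff_chamber.contDiffAt (x := p)).congr_of_eventuallyEq hev.symm).of_le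
        (by norm_cast)
    have jθ := hasJet_angular p he
    have jh : HasJet (fun t => c.axisPot (p + t • (a, b, e))) _ _ _ :=
      (((hasJet_logTile p.1 p.2.1 a b).add (hasJet_logTile p.1 p.2.2 a e)).const_mul (1 / 2)).add
        ((jθ.comp c.smooth₄).mul jθ)
    rw [fderiv_fderiv_congr hev, jh.fderiv_fderiv hcd]
    clear jh jθ
    obtain ⟨θ1, θ2⟩ := angular_jet_le h he
    obtain ⟨m41, m42⟩ := c.mem₄ (angular p) (angular_nonneg h.2.2.1)
    have hκ0 : 0 ≤ c.κ := by rw [c.κ_eq]; norm_num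
    have E4 := angular_error hY h.sizes.2.1 hκ0 c.slow₄
      (angular_dichotomy h (c.δ_le.trans hd.le)) θ1 θ2
    have E4' := (abs_le.1 E4).1
    have κQ : c.κ * (Real.exp p.1 * a ^ 2 + Real.exp p.2.1 * b ^ 2) =
      1 / 10 ^ 6 * (Real.exp p.1 * a ^ 2 + Real.exp p.2.1 * b ^ 2) := by rw [c.κ_eq]
    have hU : 0 ≤ Real.exp p.1 / (1 + Real.exp p.1) ^ 2 * a ^ 2 +
        Real.exp p.2.2 / (1 + Real.exp p.2.2) ^ 2 * e ^ 2 +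
        Real.exp (p.1 + p.2.2) / (1 + Real.exp (p.1 + p.2.2)) ^ 2 * (a + e) ^ 2 := by positivity
    -- The variable $\theta$ is the difference $g_{xy}-g_{xz}$, so up to derivatives of $\alpha_4$
    -- the Hessian is $(\frac12+\alpha_4)G+(\frac12-\alpha_4)U$, with $G,U\ge0$ the Hessians of the
    -- two tile potentials. Already $\frac12G\ge\frac18Q$ dominates the error $1000\kappa Q$.
    have eθ : b ^ 2 * phiTwo p.2.1 (p.1 + p.2.2) - e ^ 2 * phiTwo p.2.2 (p.1 + p.2.1) =
        (Real.exp p.1 / (1 + Real.exp p.1) ^ 2 * a ^ 2 +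
        Real.exp p.2.1 / (1 + Real.exp p.2.1) ^ 2 * b ^ 2 +
        Real.exp (p.1 + p.2.1) / (1 + Real.exp (p.1 + p.2.1)) ^ 2 * (a + b) ^ 2) -
        (Real.exp p.1 / (1 + Real.exp p.1) ^ 2 * a ^ 2 +
        Real.exp p.2.2 / (1 + Real.exp p.2.2) ^ 2 * e ^ 2 +
        Real.exp (p.1 + p.2.2) / (1 + Real.exp (p.1 + p.2.2)) ^ 2 * (a + e) ^ 2) := by
      rw [show a + b = -e by linarith, show a + e = -b by linarith]
      unfold phiTwo
      ring
    rw [eθ] at E4' ⊢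
    generalize Real.exp p.1 / (1 + Real.exp p.1) ^ 2 * a ^ 2 +
        Real.exp p.2.1 / (1 + Real.exp p.2.1) ^ 2 * b ^ 2 +
        Real.exp (p.1 + p.2.1) / (1 + Real.exp (p.1 + p.2.1)) ^ 2 * (a + b) ^ 2 = G at *
    generalize Real.exp p.1 / (1 + Real.exp p.1) ^ 2 * a ^ 2 +
        Real.exp p.2.2 / (1 + Real.exp p.2.2) ^ 2 * e ^ 2 +
        Real.exp (p.1 + p.2.2) / (1 + Real.exp (p.1 + p.2.2)) ^ 2 * (a + e) ^ 2 = U at *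
    have m1 := mul_nonneg m41 (show 0 ≤ G by linarith)
    have m2 := mul_nonneg (sub_nonneg.2 m42) hU
    linarith
  · have hev := chamber_eventuallyEq_tile hd h4
    have jh : HasJet (fun t => (fun q : ℝ × ℝ × ℝ => logTile q.1 q.2.1) (p + t • (a, b, e))) _ _ _ :=
      hasJet_logTile p.1 p.2.1 a b
    rw [fderiv_fderiv_congr hev,
      jh.fderiv_fderiv (contDiff_tile.contDiffAt.of_le (by norm_cast))]
    linarith

theorem chamber_pos {p : ℝ × ℝ × ℝ} (h : c.InChamber p) {w : ℝ × ℝ × ℝ}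
    (hw : w.1 + w.2.1 + w.2.2 = 0) (hw0 : w ≠ 0) :
    0 < fderiv ℝ (fderiv ℝ c.chamber) p w w := by
  obtain ⟨a, b, e⟩ := w
  have hab : (a, b) ≠ 0 := by
    rintro hab
    obtain ⟨rfl, rfl⟩ := Prod.mk.inj hab
    apply hw0
    simp only [zero_add] at hw
    rw [hw]
    rfl
  rcases le_total (Real.exp p.1) c.κ with hκ | hκ
  · exact chamber_pos_of_small h hκ hw hab
  · exact chamber_pos_of_large h hκ hw hab

/-! ### The symmetric potential -/

/-- The point with decreasing coordinates in the orbit of `p` under permutations. -/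
def _root_.BananaMirror.sortDesc (p : ℝ × ℝ × ℝ) : ℝ × ℝ × ℝ :=
  (max p.1 (max p.2.1 p.2.2), max (min p.1 p.2.1) (min (max p.1 p.2.1) p.2.2),
    min p.1 (min p.2.1 p.2.2))

theorem continuous_sortDesc : Continuous sortDesc := by
  unfold sortDesc
  fun_prop

theorem sortDesc_of_le {p : ℝ × ℝ × ℝ} (h1 : p.2.1 ≤ p.1) (h2 : p.2.2 ≤ p.2.1) :
    sortDesc p = p := by
  unfold sortDesc
  rw [max_eq_left h2, max_eq_left h1, min_eq_right h2, min_eq_right h1,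
    min_eq_right (h2.trans h1), max_eq_left h2]

theorem sortDesc_swap₁₂ (p : ℝ × ℝ × ℝ) : sortDesc (p.2.1, p.1, p.2.2) = sortDesc p := by
  unfold sortDesc
  simp only [max_left_comm p.2.1, min_left_comm p.2.1, min_comm p.2.1, max_comm p.2.1]

theorem sortDesc_swap₂₃ (p : ℝ × ℝ × ℝ) : sortDesc (p.1, p.2.2, p.2.1) = sortDesc p := by
  unfold sortDesc
  refine Prod.ext ?_ (Prod.ext ?_ ?_)
  · simp only [max_comm p.2.1]
  · simp only [max_def, min_def]
    split_ifs <;> linarith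
  · simp only [min_comm p.2.1]

/-- The potential in the toric coordinates at a vertex. -/
noncomputable def pot (c : Profile) (p : ℝ × ℝ × ℝ) : ℝ := c.chamber (sortDesc p)

theorem pot_swap₁₂ (p : ℝ × ℝ × ℝ) : c.pot (p.2.1, p.1, p.2.2) = c.pot p := by
  unfold pot
  rw [sortDesc_swap₁₂]

theorem pot_swap₂₃ (p : ℝ × ℝ × ℝ) : c.pot (p.1, p.2.2, p.2.1) = c.pot p := by
  unfold pot
  rw [sortDesc_swap₂₃]

theorem vertexSym_sortDesc (p : ℝ × ℝ × ℝ) : vertexSym (sortDesc p) = vertexSym p := by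
  obtain ⟨u, v, w⟩ := p
  unfold sortDesc
  simp only
  rcases le_total u v with h1 | h1 <;> rcases le_total v w with h2 | h2 <;>
    rcases le_total u w with h3 | h3 <;>
    simp only [max_eq_left, max_eq_right, min_eq_left, min_eq_right, h1, h2, h3, vertexSym] <;>
    first
    | ring1
    | simp only [add_comm v u, add_comm w u, add_comm w v]; ring1
    | obtain rfl : u = v := by linarith
      obtain rfl : u = w := by linarith
      ring1

/-- Near a point with ordered coordinates no reordering is needed. -/
theorem pot_eventuallyEq_chamber {p : ℝ × ℝ × ℝ} (h : c.InChamber p) :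
    c.pot =ᶠ[𝓝 p] c.chamber := by
  have hs : sortDesc p = p := sortDesc_of_le h.2.1 h.2.2.1
  have hc : Tendsto sortDesc (𝓝 p) (𝓝 p) := by
    simpa only [hs] using continuous_sortDesc.tendsto p
  -- It suffices to find a local formula for the chamber potential that is unchanged by sorting
  -- nearby points. Away from the vertex, only one wall is relevant at a time.
  have key : ∀ {g : ℝ × ℝ × ℝ → ℝ}, c.chamber =ᶠ[𝓝 p] g →
      (∀ᶠ q in 𝓝 p, g (sortDesc q) = g q) → c.pot =ᶠ[𝓝 p] c.chamber := by
    intro g hg hgs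
    filter_upwards [hc.eventually hg, hg, hgs] with q h1 h2 h3
    unfold pot
    rw [h1, h2, h3]
  rcases lt_or_ge (c.radial p) c.δ with hd | hd
  · exact key (chamber_eventuallyEq_vertex hd) (Eventually.of_forall vertexSym_sortDesc)
  rcases inner₆_or_outer₄ h hd with h6 | ⟨h4, hlt⟩
  · have huv : p.2.1 < p.1 := by
      have := h6.trans c.r₁_lt
      rw [Real.exp_lt_one_iff] at this
      linarith
    have e1 : ∀ᶠ q : ℝ × ℝ × ℝ in 𝓝 p, q.2.1 < q.1 :=
      ContinuousAt.eventually_lt (by fun_prop) (by fun_prop) huv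
    have e2 : ∀ᶠ q : ℝ × ℝ × ℝ in 𝓝 p, q.2.2 < q.1 :=
      ContinuousAt.eventually_lt (by fun_prop) (by fun_prop) (h.2.2.1.trans_lt huv)
    refine key (chamber_eventuallyEq_inner h6) ?_
    filter_upwards [e1, e2] with q h1 h2
    rcases le_total q.2.2 q.2.1 with h3 | h3
    · rw [sortDesc_of_le h1.le h3]
    · rw [← sortDesc_swap₂₃, sortDesc_of_le h2.le h3, innerPot_swap]
  · have e1 : ∀ᶠ q : ℝ × ℝ × ℝ in 𝓝 p, q.2.2 < q.2.1 :=
      ContinuousAt.eventually_lt (by fun_prop) (by fun_prop) hlt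
    have e2 : ∀ᶠ q : ℝ × ℝ × ℝ in 𝓝 p, q.2.2 < q.1 :=
      ContinuousAt.eventually_lt (by fun_prop) (by fun_prop) (hlt.trans_le h.2.1)
    -- Here $Z<Y$ strictly, so only the wall $X=Y$ can matter; on it $\alpha_6=1$ because
    -- $Y/X=1>r_2$.
    rcases h.2.1.eq_or_lt with huv | huv
    · refine key (chamber_eventuallyEq_outer huv.symm h4) ?_
      filter_upwards [e1, e2] with q h1 h2
      rcases le_total q.2.1 q.1 with h3 | h3
      · rw [sortDesc_of_le h3 h1.le]
      · rw [← sortDesc_swap₁₂, sortDesc_of_le h3 h2.le, outerPot_swap]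
    · refine key (EventuallyEq.refl _ _) ?_
      have e3 : ∀ᶠ q : ℝ × ℝ × ℝ in 𝓝 p, q.2.1 < q.1 :=
        ContinuousAt.eventually_lt (by fun_prop) (by fun_prop) huv
      filter_upwards [e1, e3] with q h1 h2
      rw [sortDesc_of_le h2.le h1.le]

end Profile

namespace Profile

variable {c : Profile}

/-- The points with `|Tx|, |Ty|, |Tz| ≤ 1` on the fibre. -/
def InSimplex (c : Profile) (p : ℝ × ℝ × ℝ) : Prop :=
  p.1 ≤ 0 ∧ p.2.1 ≤ 0 ∧ p.2.2 ≤ 0 ∧ Real.exp (p.1 + p.2.1 + p.2.2) = c.ε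

/-- Smoothness of the potential, and positivity of its second derivative along the fibre. -/
def Convex (c : Profile) (p : ℝ × ℝ × ℝ) : Prop :=
  ContDiffAt ℝ ∞ c.pot p ∧ ∀ w : ℝ × ℝ × ℝ, w.1 + w.2.1 + w.2.2 = 0 → w ≠ 0 →
    0 < fderiv ℝ (fderiv ℝ c.pot) p w w

theorem InChamber.convex {p : ℝ × ℝ × ℝ} (h : c.InChamber p) : c.Convex p := by
  have e := pot_eventuallyEq_chamber h
  refine ⟨c.contDiff_chamber.contDiffAt.congr_of_eventuallyEq e, fun w hw hw0 => ?_⟩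
  rw [fderiv_fderiv_congr e]
  exact chamber_pos h hw hw0

/-- Convexity is preserved by symmetries of the potential. -/
theorem Convex.of_symm {p : ℝ × ℝ × ℝ} (L : (ℝ × ℝ × ℝ) →L[ℝ] ℝ × ℝ × ℝ)
    (hL : ∀ q, c.pot (L q) = c.pot q) (hw : ∀ w : ℝ × ℝ × ℝ, w.1 + w.2.1 + w.2.2 = 0 →
      w ≠ 0 → (L w).1 + (L w).2.1 + (L w).2.2 = 0 ∧ L w ≠ 0) (h : c.Convex (L p)) :
    c.Convex p := by
  have e : c.pot = fun q => c.pot (L q) := funext fun q => (hL q).symm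
  refine ⟨?_, fun w hw1 hw0 => ?_⟩
  · rw [e]
    exact h.1.comp p L.contDiff.contDiffAt
  · rw [e, fderiv_fderiv_comp_clm L (h.1.of_le (by norm_cast))]
    exact h.2 _ (hw w hw1 hw0).1 (hw w hw1 hw0).2

theorem Convex.swap₁₂ {p : ℝ × ℝ × ℝ} (h : c.Convex (p.2.1, p.1, p.2.2)) : c.Convex p := by
  let π₁ := ContinuousLinearMap.fst ℝ ℝ (ℝ × ℝ)
  let π₂ := ContinuousLinearMap.snd ℝ ℝ (ℝ × ℝ)
  refine Convex.of_symm (((ContinuousLinearMap.fst ℝ ℝ ℝ).comp π₂).prod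
    (π₁.prod ((ContinuousLinearMap.snd ℝ ℝ ℝ).comp π₂))) pot_swap₁₂ ?_ h
  rintro ⟨u, v, w⟩ h0 h1
  refine ⟨show v + u + w = 0 from by rw [← h0]; ring, fun h2 => h1 ?_⟩
  simp only [ContinuousLinearMap.prod_apply, ContinuousLinearMap.comp_apply,
    ContinuousLinearMap.coe_fst', ContinuousLinearMap.coe_snd', Prod.mk_eq_zero, π₁, π₂] at h2 ⊢
  tauto

theorem Convex.swap₂₃ {p : ℝ × ℝ × ℝ} (h : c.Convex (p.1, p.2.2, p.2.1)) : c.Convex p := by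
  let π₁ := ContinuousLinearMap.fst ℝ ℝ (ℝ × ℝ)
  let π₂ := ContinuousLinearMap.snd ℝ ℝ (ℝ × ℝ)
  refine Convex.of_symm (π₁.prod (((ContinuousLinearMap.snd ℝ ℝ ℝ).comp π₂).prod
    ((ContinuousLinearMap.fst ℝ ℝ ℝ).comp π₂))) pot_swap₂₃ ?_ h
  rintro ⟨u, v, w⟩ h0 h1
  refine ⟨show u + w + v = 0 from by rw [← h0]; ring, fun h2 => h1 ?_⟩
  simp only [ContinuousLinearMap.prod_apply, ContinuousLinearMap.comp_apply,
    ContinuousLinearMap.coe_fst', ContinuousLinearMap.coe_snd', Prod.mk_eq_zero, π₁, π₂] at h2 ⊢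
  tauto

theorem InSimplex.convex {p : ℝ × ℝ × ℝ} (h : c.InSimplex p) : c.Convex p := by
  obtain ⟨u, v, w⟩ := p
  obtain ⟨hu, hv, hw, hs⟩ := h
  simp only at hu hv hw hs
  have key : ∀ x y z : ℝ, x ≤ 0 → y ≤ x → z ≤ y → x + y + z = u + v + w → c.Convex (x, y, z) :=
    fun x y z h1 h2 h3 h4 => InChamber.convex ⟨h1, h2, h3, by simp only; rw [h4, hs]⟩
  rcases le_total u v with h1 | h1 <;> rcases le_total v w with h2 | h2 <;>
    rcases le_total u w with h3 | h3
  · exact .swap₂₃ (.swap₁₂ (.swap₂₃ (key w v u hw h2 h1 (by ring))))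
  · exact .swap₂₃ (.swap₁₂ (.swap₂₃ (key w v u hw h2 h1 (by ring))))
  · exact .swap₁₂ (.swap₂₃ (key v w u hv h2 h3 (by ring)))
  · exact .swap₁₂ (key v u w hv h1 h3 (by ring))
  · exact .swap₂₃ (.swap₁₂ (key w u v hw h3 h1 (by ring)))
  · exact .swap₂₃ (key u w v hu h3 h2 (by ring))
  · exact key u v w hu h1 h2 rfl
  · exact key u v w hu h1 h2 rfl

/-! ### Gluing the vertex charts to one quasi-periodic potential. -/

/-! ### Behaviour at the boundary of a vertex chart -/

/-- The reflection at `|Tx| = 1`. -/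
def _root_.BananaMirror.mirror (p : ℝ × ℝ × ℝ) : ℝ × ℝ × ℝ := (-p.1, p.1 + p.2.1, p.1 + p.2.2)

/-- The reflection inverts the factor variable of $1+|Tx|^2$ and exchanges the factors $1+|Ty|^2$
and $1+|T^2xy|^2$. -/
theorem logTile_mirror (u v : ℝ) : logTile (-u) (u + v) = logTile u v - u := by
  unfold logTile
  rw [softplus_neg, neg_add_cancel_left]
  ring

theorem angular_mirror (p : ℝ × ℝ × ℝ) : angular (mirror p) = angular p := by
  unfold angular mirror logPhi
  simp only [neg_add_cancel_left]
  ring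

theorem outer_of_fst_eq_zero {p : ℝ × ℝ × ℝ} (h : c.InChamber p) (h0 : p.1 = 0) :
    c.δ' < c.radial p := by
  refine δ'_lt_radial h ?_
  rw [h0, Real.exp_zero, c.κ_eq]
  norm_num

/-- The reflection fixes such a point. By `outer_of_fst_eq_zero` only the axis and tile formulas are
possible, and both change by $-u$: $\theta$ is invariant and the tile potentials obey
`logTile_mirror`. -/
theorem pot_mirror_of_inChamber {p : ℝ × ℝ × ℝ} (h : c.InChamber p) (h0 : p.1 = 0) :
    ∀ᶠ q in 𝓝 p, c.pot (mirror q) = c.pot q - q.1 := by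
  have hd := outer_of_fst_eq_zero h h0
  have hm : mirror p = p := by
    unfold mirror
    rw [h0, neg_zero, zero_add, zero_add, ← h0]
  have hc : Tendsto mirror (𝓝 p) (𝓝 p) := by
    have : Continuous mirror := by unfold mirror; fun_prop
    simpa only [hm] using this.tendsto p
  have e := pot_eventuallyEq_chamber h
  have key : ∀ {g : ℝ × ℝ × ℝ → ℝ}, c.chamber =ᶠ[𝓝 p] g → (∀ q, g (mirror q) = g q - q.1) →
      ∀ᶠ q in 𝓝 p, c.pot (mirror q) = c.pot q - q.1 := by
    intro g hg hgm
    filter_upwards [hc.eventually (e.trans hg), e.trans hg] with q h1 h2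
    rw [h1, h2, hgm]
  rcases inner₆_or_outer₄ h (c.δ_le.trans hd.le) with h6 | ⟨h4, -⟩
  · refine key (chamber_eventuallyEq_axis hd h6) fun q => ?_
    unfold axisPot
    rw [angular_mirror]
    unfold mirror
    simp only [logTile_mirror]
    ring
  · exact key (chamber_eventuallyEq_tile hd h4) fun q => logTile_mirror q.1 q.2.1

theorem pot_mirror {p : ℝ × ℝ × ℝ} (h : c.InSimplex p) (h0 : p.1 = 0) :
    ∀ᶠ q in 𝓝 p, c.pot (mirror q) = c.pot q - q.1 := by
  obtain ⟨hu, hv, hw, hs⟩ := h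
  rcases le_total p.2.2 p.2.1 with h1 | h1
  · exact pot_mirror_of_inChamber ⟨hu, by rwa [h0], h1, hs⟩ h0
  · have hin : c.InChamber (p.1, p.2.2, p.2.1) :=
      ⟨hu, by simpa only [h0] using hw, h1, by simp only; rw [← hs]; ring_nf⟩
    have hc : Tendsto (fun q : ℝ × ℝ × ℝ => (q.1, q.2.2, q.2.1)) (𝓝 p) (𝓝 (p.1, p.2.2, p.2.1)) :=
      Continuous.tendsto (by fun_prop) p
    filter_upwards [hc.eventually (pot_mirror_of_inChamber hin h0)] with q hq
    rw [pot_swap₂₃] at hq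
    rw [← hq, ← pot_swap₂₃]
    rfl

/-- At such a corner $Y/X=1\ge r_1$, which rules out the axis region. Six triangles meet there, and
in each the potential is a tile potential up to a linear term. -/
theorem pot_corner {p : ℝ × ℝ × ℝ} (hu : p.1 = 0) (hv : p.2.1 = 0) (hw : Real.exp p.2.2 = c.ε) :
    c.pot =ᶠ[𝓝 p] fun q => logTile q.1 q.2.1 := by
  have hε : c.ε < 1 := by
    refine c.ε_le.trans_lt ?_
    rw [c.κ_eq]
    norm_num
  have hw0 : p.2.2 ≤ 0 := by
    rw [← hw, Real.exp_lt_one_iff] at hε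
    exact hε.le
  have h : c.InChamber p := ⟨hu.le, by rw [hu, hv], by rwa [hv], by rw [hu, hv, ← hw]; simp⟩
  have hd := outer_of_fst_eq_zero h hu
  refine (pot_eventuallyEq_chamber h).trans (chamber_eventuallyEq_tile hd ?_)
  rcases inner₆_or_outer₄ h (c.δ_le.trans hd.le) with h6 | ⟨h4, -⟩
  · have := h6.trans c.r₁_lt
    rw [hu, hv, sub_zero, Real.exp_zero] at this
    exact absurd this (lt_irrefl 1)
  · exact h4

/-! ### The global potential

From here on points are given by `(log |Tx|², log |Ty|², log |T³v₀|²)`. -/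

/-- The potential near the base vertex. -/
noncomputable def base (c : Profile) (R : ℝ × ℝ × ℝ) : ℝ := c.pot (R.1, R.2.1, R.2.2 - R.1 - R.2.1)

/-- The linear change of the potential under the deck transformation with indices `i, j`. -/
def _root_.BananaMirror.deckTerm (i j : ℤ) (R : ℝ × ℝ × ℝ) : ℝ :=
  -(2 * i + j) * R.1 - (i + 2 * j) * R.2.1 + (i ^ 2 + i * j + j ^ 2 + i + j) * R.2.2

/-- The potential continued from the triangle with indices `i, j` containing the vertex itself. -/
noncomputable def cellLow (c : Profile) (i j : ℤ) (R : ℝ × ℝ × ℝ) : ℝ :=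
  c.base (R.1 - i * R.2.2, R.2.1 - j * R.2.2, R.2.2) + deckTerm i j R

/-- The potential continued from the triangle with indices `i, j` containing the vertex at the other
end of the `z`-axis. -/
noncomputable def cellHigh (c : Profile) (i j : ℤ) (R : ℝ × ℝ × ℝ) : ℝ :=
  c.base (R.2.2 - (R.1 - i * R.2.2), R.2.2 - (R.2.1 - j * R.2.2), R.2.2) +
    (deckTerm i j R + (R.2.2 - R.1 - R.2.1 + (i + j) * R.2.2))

/-- The point lies in the triangle containing the vertex itself. -/
def _root_.BananaMirror.IsLow (R : ℝ × ℝ × ℝ) : Prop :=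
  Int.fract (R.1 / R.2.2) + Int.fract (R.2.1 / R.2.2) ≤ 1

open Classical in
/-- The continuation to everywhere of the potential near the vertex of the triangle of `R₀`. -/
noncomputable def cell (c : Profile) (R₀ : ℝ × ℝ × ℝ) (R : ℝ × ℝ × ℝ) : ℝ :=
  if IsLow R₀ then c.cellLow ⌊R₀.1 / R₀.2.2⌋ ⌊R₀.2.1 / R₀.2.2⌋ R
  else c.cellHigh ⌊R₀.1 / R₀.2.2⌋ ⌊R₀.2.1 / R₀.2.2⌋ R

/-- The global potential. -/
noncomputable def glob (c : Profile) (R : ℝ × ℝ × ℝ) : ℝ := c.cell R R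

/-- The deck transformation with indices `i, j`. -/
def _root_.BananaMirror.deckLog (i j : ℤ) (R : ℝ × ℝ × ℝ) : ℝ × ℝ × ℝ :=
  (R.1 + i * R.2.2, R.2.1 + j * R.2.2, R.2.2)

/-- The change of the global potential under a deck transformation. -/
def _root_.BananaMirror.deckShift (i j : ℤ) (R : ℝ × ℝ × ℝ) : ℝ :=
  -(2 * i + j) * R.1 - (i + 2 * j) * R.2.1 + (i + j - (i ^ 2 + i * j + j ^ 2)) * R.2.2

/-- The argument of `base` is unchanged; the linear terms satisfy a cocycle relation with
`deckShift`. -/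
theorem cellLow_deckLog (i j i' j' : ℤ) (R : ℝ × ℝ × ℝ) :
    c.cellLow (i' + i) (j' + j) (deckLog i j R) = c.cellLow i' j' R + deckShift i j R := by
  have e1 : R.1 + i * R.2.2 - ((i' + i : ℤ) : ℝ) * R.2.2 = R.1 - i' * R.2.2 := by
    push_cast; ring
  have e2 : R.2.1 + j * R.2.2 - ((j' + j : ℤ) : ℝ) * R.2.2 = R.2.1 - j' * R.2.2 := by
    push_cast; ring
  unfold cellLow deckLog deckShift deckTerm
  simp only [e1, e2]
  push_cast
  ring

theorem cellHigh_deckLog (i j i' j' : ℤ) (R : ℝ × ℝ × ℝ) :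
    c.cellHigh (i' + i) (j' + j) (deckLog i j R) = c.cellHigh i' j' R + deckShift i j R := by
  have e1 : R.1 + i * R.2.2 - ((i' + i : ℤ) : ℝ) * R.2.2 = R.1 - i' * R.2.2 := by
    push_cast; ring
  have e2 : R.2.1 + j * R.2.2 - ((j' + j : ℤ) : ℝ) * R.2.2 = R.2.1 - j' * R.2.2 := by
    push_cast; ring
  unfold cellHigh deckLog deckShift deckTerm
  simp only [e1, e2]
  push_cast
  ring

theorem cell_deckLog (i j : ℤ) {R₀ : ℝ × ℝ × ℝ} (h : R₀.2.2 ≠ 0) (R : ℝ × ℝ × ℝ) :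
    c.cell (deckLog i j R₀) (deckLog i j R) = c.cell R₀ R + deckShift i j R := by
  have e1 : (deckLog i j R₀).1 / (deckLog i j R₀).2.2 = R₀.1 / R₀.2.2 + i := by
    unfold deckLog; field_simp
  have e2 : (deckLog i j R₀).2.1 / (deckLog i j R₀).2.2 = R₀.2.1 / R₀.2.2 + j := by
    unfold deckLog; field_simp
  unfold cell IsLow
  rw [e1, e2, Int.fract_add_intCast, Int.fract_add_intCast, Int.floor_add_intCast,
    Int.floor_add_intCast, cellLow_deckLog, cellHigh_deckLog]
  split_ifs <;> rfl

theorem glob_deckLog (i j : ℤ) {R : ℝ × ℝ × ℝ} (h : R.2.2 ≠ 0) :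
    c.glob (deckLog i j R) = c.glob R + deckShift i j R :=
  cell_deckLog i j h R

/-! ### Consistency of the potentials of adjacent triangles -/

theorem log_ε_neg {S : ℝ} (h : Real.exp S = c.ε) : S < 0 := by
  rw [← Real.exp_lt_one_iff, h]
  refine c.ε_le.trans_lt ?_
  rw [c.κ_eq]
  norm_num

/-- The triple of logarithms of all three norms. -/
def _root_.BananaMirror.triple (R : ℝ × ℝ × ℝ) : ℝ × ℝ × ℝ := (R.1, R.2.1, R.2.2 - R.1 - R.2.1)

theorem continuous_triple : Continuous triple := by unfold triple; fun_prop

theorem cellLow_zero (R : ℝ × ℝ × ℝ) : c.cellLow 0 0 R = c.pot (triple R) := by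
  unfold cellLow base deckTerm triple
  simp

/-- The two triangles share the edge $|Tz|=1$. Once $z$ is permuted to the first slot, the passage
to the other vertex is the reflection in `pot_mirror`. The two lemmas after this treat the edges
$|Tx|=1$ and $|Ty|=1$ in the same way. -/
theorem cellHigh_zero_eq {R₀ : ℝ × ℝ × ℝ} (hε : Real.exp R₀.2.2 = c.ε) (h1 : R₀.1 ≤ 0)
    (h2 : R₀.2.1 ≤ 0) (h3 : R₀.2.2 - R₀.1 - R₀.2.1 = 0) :
    ∀ᶠ R in 𝓝 R₀, c.cellHigh 0 0 R = c.cellLow 0 0 R := by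
  have hin : c.InSimplex (R₀.2.2 - R₀.1 - R₀.2.1, R₀.2.1, R₀.1) :=
    ⟨h3.le, h2, h1, by simp only; rw [← hε]; congr 1; ring⟩
  have hc : Tendsto (fun R : ℝ × ℝ × ℝ => (R.2.2 - R.1 - R.2.1, R.2.1, R.1)) (𝓝 R₀)
    (𝓝 (R₀.2.2 - R₀.1 - R₀.2.1, R₀.2.1, R₀.1)) := Continuous.tendsto (by fun_prop) R₀
  filter_upwards [hc.eventually (pot_mirror hin h3)] with R hR
  rw [cellLow_zero, triple, ← pot_swap₁₂, ← pot_swap₂₃, ← pot_swap₁₂]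
  have e : c.pot (mirror (R.2.2 - R.1 - R.2.1, R.2.1, R.1)) =
      c.base (R.2.2 - (R.1 - (0 : ℤ) * R.2.2), R.2.2 - (R.2.1 - (0 : ℤ) * R.2.2), R.2.2) := by
    rw [← pot_swap₁₂, ← pot_swap₂₃]
    unfold base mirror
    congr 1
    refine Prod.ext ?_ (Prod.ext ?_ ?_) <;> simp <;> ring
  unfold cellHigh
  rw [← e, hR]
  simp only [deckTerm]
  push_cast
  ring

theorem cellHigh_neg_one_zero_eq {R₀ : ℝ × ℝ × ℝ} (hε : Real.exp R₀.2.2 = c.ε) (h1 : R₀.1 = 0)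
    (h2 : R₀.2.1 ≤ 0) (h3 : R₀.2.2 - R₀.1 - R₀.2.1 ≤ 0) :
    ∀ᶠ R in 𝓝 R₀, c.cellHigh (-1) 0 R = c.cellLow 0 0 R := by
  have hin : c.InSimplex (triple R₀) :=
    ⟨h1.le, h2, h3, by simp only [triple]; rw [← hε]; congr 1; ring⟩
  filter_upwards [continuous_triple.continuousAt.eventually (pot_mirror hin h1)] with R hR
  have e : c.pot (mirror (triple R)) =
      c.base (R.2.2 - (R.1 - (-1 : ℤ) * R.2.2), R.2.2 - (R.2.1 - (0 : ℤ) * R.2.2), R.2.2) := by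
    rw [← pot_swap₂₃]
    unfold base mirror triple
    congr 1
    refine Prod.ext ?_ (Prod.ext ?_ ?_) <;> simp
    ring
  unfold cellHigh
  rw [cellLow_zero, ← e, hR]
  simp only [deckTerm, triple]
  push_cast
  ring

theorem cellHigh_zero_neg_one_eq {R₀ : ℝ × ℝ × ℝ} (hε : Real.exp R₀.2.2 = c.ε) (h1 : R₀.1 ≤ 0)
    (h2 : R₀.2.1 = 0) (h3 : R₀.2.2 - R₀.1 - R₀.2.1 ≤ 0) :
    ∀ᶠ R in 𝓝 R₀, c.cellHigh 0 (-1) R = c.cellLow 0 0 R := by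
  have hin : c.InSimplex (R₀.2.1, R₀.1, R₀.2.2 - R₀.1 - R₀.2.1) :=
    ⟨h2.le, h1, h3, by simp only; rw [← hε]; congr 1; ring⟩
  have hc : Tendsto (fun R : ℝ × ℝ × ℝ => (R.2.1, R.1, R.2.2 - R.1 - R.2.1)) (𝓝 R₀)
    (𝓝 (R₀.2.1, R₀.1, R₀.2.2 - R₀.1 - R₀.2.1)) := Continuous.tendsto (by fun_prop) R₀
  filter_upwards [hc.eventually (pot_mirror hin h2)] with R hR
  rw [cellLow_zero, triple, ← pot_swap₁₂]
  have e : c.pot (mirror (R.2.1, R.1, R.2.2 - R.1 - R.2.1)) =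
      c.base (R.2.2 - (R.1 - (0 : ℤ) * R.2.2), R.2.2 - (R.2.1 - (-1 : ℤ) * R.2.2), R.2.2) := by
    rw [← pot_swap₂₃, ← pot_swap₁₂]
    unfold base mirror
    congr 1
    refine Prod.ext ?_ (Prod.ext ?_ ?_) <;> simp <;> ring
  unfold cellHigh
  rw [← e, hR]
  simp only [deckTerm]
  push_cast
  ring

end Profile

namespace Profile

variable {c : Profile}

theorem cell_eq_cellLow {R₀ : ℝ × ℝ × ℝ} {i j : ℤ} (hi : i ≤ R₀.1 / R₀.2.2)
    (hi' : R₀.1 / R₀.2.2 < i + 1) (hj : j ≤ R₀.2.1 / R₀.2.2) (hj' : R₀.2.1 / R₀.2.2 < j + 1)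
    (h : R₀.1 / R₀.2.2 + R₀.2.1 / R₀.2.2 ≤ i + j + 1) : c.cell R₀ = c.cellLow i j := by
  have e1 : ⌊R₀.1 / R₀.2.2⌋ = i := Int.floor_eq_iff.2 ⟨hi, hi'⟩
  have e2 : ⌊R₀.2.1 / R₀.2.2⌋ = j := Int.floor_eq_iff.2 ⟨hj, hj'⟩
  funext R
  unfold cell IsLow Int.fract
  rw [e1, e2, if_pos (by linarith)]

theorem cell_eq_cellHigh {R₀ : ℝ × ℝ × ℝ} {i j : ℤ} (hi : i ≤ R₀.1 / R₀.2.2)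
    (hi' : R₀.1 / R₀.2.2 < i + 1) (hj : j ≤ R₀.2.1 / R₀.2.2) (hj' : R₀.2.1 / R₀.2.2 < j + 1)
    (h : i + j + 1 < R₀.1 / R₀.2.2 + R₀.2.1 / R₀.2.2) : c.cell R₀ = c.cellHigh i j := by
  have e1 : ⌊R₀.1 / R₀.2.2⌋ = i := Int.floor_eq_iff.2 ⟨hi, hi'⟩
  have e2 : ⌊R₀.2.1 / R₀.2.2⌋ = j := Int.floor_eq_iff.2 ⟨hj, hj'⟩
  funext R
  unfold cell IsLow Int.fract
  rw [e1, e2, if_neg (by linarith)]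

/-- At the centre of a tile the edge identities do not reach all six triangles from the base one.
This lemma and its three successors compare four of them with the same tile potential; the other two
share an edge with the base triangle. -/
theorem cellLow_zero_corner {R₀ : ℝ × ℝ × ℝ} (hε : Real.exp R₀.2.2 = c.ε)
    (h1 : R₀.1 = 0) (h2 : R₀.2.1 = 0) : ∀ᶠ R in 𝓝 R₀, c.cellLow 0 0 R = logTile R.1 R.2.1 := by
  filter_upwards [continuous_triple.continuousAt.eventually (pot_corner (c := c)
    (p := triple R₀) h1 h2 (by simp [triple, h1, h2, hε]))] with R hR
  rw [cellLow_zero, hR]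
  rfl

theorem cellLow_neg_one_zero_corner {R₀ : ℝ × ℝ × ℝ} (hε : Real.exp R₀.2.2 = c.ε)
    (h1 : R₀.1 = 0) (h2 : R₀.2.1 = 0) :
    ∀ᶠ R in 𝓝 R₀, c.cellLow (-1) 0 R = logTile R.1 R.2.1 := by
  have hc : Tendsto (fun R : ℝ × ℝ × ℝ => (R.2.1, -R.1 - R.2.1, R.1 + R.2.2)) (𝓝 R₀)
    (𝓝 (R₀.2.1, -R₀.1 - R₀.2.1, R₀.1 + R₀.2.2)) := Continuous.tendsto (by fun_prop) R₀
  filter_upwards [hc.eventually (pot_corner (c := c) h2 (by simp [h1, h2]) (by simp [h1, hε]))]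
    with R hR
  have e : c.base (R.1 - (-1 : ℤ) * R.2.2, R.2.1 - (0 : ℤ) * R.2.2, R.2.2) =
      c.pot (R.2.1, -R.1 - R.2.1, R.1 + R.2.2) := by
    unfold base
    rw [← pot_swap₁₂, ← pot_swap₂₃]
    congr 1
    refine Prod.ext ?_ (Prod.ext ?_ ?_) <;> simp
  unfold cellLow
  rw [e, hR]
  simp only [logTile, deckTerm]
  rw [show R.2.1 + (-R.1 - R.2.1) = -R.1 by ring, show -R.1 - R.2.1 = -(R.1 + R.2.1) by ring,
    softplus_neg, softplus_neg]
  push_cast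
  ring

theorem cellLow_zero_neg_one_corner {R₀ : ℝ × ℝ × ℝ} (hε : Real.exp R₀.2.2 = c.ε)
    (h1 : R₀.1 = 0) (h2 : R₀.2.1 = 0) :
    ∀ᶠ R in 𝓝 R₀, c.cellLow 0 (-1) R = logTile R.1 R.2.1 := by
  have hc : Tendsto (fun R : ℝ × ℝ × ℝ => (R.1, -R.1 - R.2.1, R.2.1 + R.2.2)) (𝓝 R₀)
    (𝓝 (R₀.1, -R₀.1 - R₀.2.1, R₀.2.1 + R₀.2.2)) := Continuous.tendsto (by fun_prop) R₀
  filter_upwards [hc.eventually (pot_corner (c := c) h1 (by simp [h1, h2]) (by simp [h2, hε]))]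
    with R hR
  have e : c.base (R.1 - (0 : ℤ) * R.2.2, R.2.1 - (-1 : ℤ) * R.2.2, R.2.2) =
      c.pot (R.1, -R.1 - R.2.1, R.2.1 + R.2.2) := by
    unfold base
    rw [← pot_swap₂₃]
    congr 1
    refine Prod.ext ?_ (Prod.ext ?_ ?_) <;> simp
    ring
  unfold cellLow
  rw [e, hR]
  simp only [logTile, deckTerm]
  rw [show R.1 + (-R.1 - R.2.1) = -R.2.1 by ring, show -R.1 - R.2.1 = -(R.1 + R.2.1) by ring,
    softplus_neg, softplus_neg]
  push_cast
  ring

theorem cellHigh_neg_one_neg_one_corner {R₀ : ℝ × ℝ × ℝ} (hε : Real.exp R₀.2.2 = c.ε)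
    (h1 : R₀.1 = 0) (h2 : R₀.2.1 = 0) :
    ∀ᶠ R in 𝓝 R₀, c.cellHigh (-1) (-1) R = logTile R.1 R.2.1 := by
  have hc : Tendsto (fun R : ℝ × ℝ × ℝ => (-R.1, -R.2.1, R.2.2 + R.1 + R.2.1)) (𝓝 R₀)
    (𝓝 (-R₀.1, -R₀.2.1, R₀.2.2 + R₀.1 + R₀.2.1)) := Continuous.tendsto (by fun_prop) R₀
  filter_upwards [hc.eventually (pot_corner (c := c) (by simp [h1]) (by simp [h2])
    (by simp [h1, h2, hε]))] with R hR
  have e : c.base (R.2.2 - (R.1 - (-1 : ℤ) * R.2.2), R.2.2 - (R.2.1 - (-1 : ℤ) * R.2.2), R.2.2) =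
      c.pot (-R.1, -R.2.1, R.2.2 + R.1 + R.2.1) := by
    unfold base
    congr 1
    refine Prod.ext ?_ (Prod.ext ?_ ?_) <;> simp
  unfold cellHigh
  rw [e, hR]
  simp only [logTile, deckTerm]
  rw [show -R.1 + -R.2.1 = -(R.1 + R.2.1) by ring, softplus_neg, softplus_neg, softplus_neg]
  push_cast
  ring

/-- The triangle used by `glob` jumps with the floors, so it must be shown that all triangles
touching the point give the same germ. Since $S<0$, nonnegative quotients mean $u,v\le0$. The cases
are the corner, the two coordinate edges, the diagonal edge, and the two interiors. -/
theorem glob_eventuallyEq_of_mem_Ico {R₀ : ℝ × ℝ × ℝ} (hε : Real.exp R₀.2.2 = c.ε)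
    (ha : 0 ≤ R₀.1 / R₀.2.2) (ha' : R₀.1 / R₀.2.2 < 1)
    (hb : 0 ≤ R₀.2.1 / R₀.2.2) (hb' : R₀.2.1 / R₀.2.2 < 1) :
    c.glob =ᶠ[𝓝 R₀] c.cell R₀ := by
  have hS := log_ε_neg hε
  have ca : ContinuousAt (fun R : ℝ × ℝ × ℝ => R.1 / R.2.2) R₀ :=
    ContinuousAt.div (by fun_prop) (by fun_prop) hS.ne
  have cb : ContinuousAt (fun R : ℝ × ℝ × ℝ => R.2.1 / R.2.2) R₀ :=
    ContinuousAt.div (by fun_prop) (by fun_prop) hS.ne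
  have cs : ContinuousAt (fun R : ℝ × ℝ × ℝ => R.1 / R.2.2 + R.2.1 / R.2.2) R₀ := ca.add cb
  have u1 : R₀.1 ≤ 0 := by
    by_contra! h
    exact absurd (div_neg_of_pos_of_neg h hS) (not_lt.2 ha)
  have u2 : R₀.2.1 ≤ 0 := by
    by_contra! h
    exact absurd (div_neg_of_pos_of_neg h hS) (not_lt.2 hb)
  have u3 : R₀.1 / R₀.2.2 + R₀.2.1 / R₀.2.2 ≤ 1 → R₀.2.2 - R₀.1 - R₀.2.1 ≤ 0 := by
    intro h
    rw [← add_div, div_le_iff_of_neg hS] at h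
    linarith
  have n1 := ca.eventually_lt_const ha'
  have n2 := cb.eventually_lt_const hb'
  rcases ha.eq_or_lt with ha0 | ha0 <;> rcases hb.eq_or_lt with hb0 | hb0
  · have z1 : R₀.1 = 0 := by simpa [hS.ne] using ha0.symm
    have z2 : R₀.2.1 = 0 := by simpa [hS.ne] using hb0.symm
    rw [cell_eq_cellLow (i := 0) (j := 0) (by simp [z1]) (by simp [z1]) (by simp [z2])
      (by simp [z2]) (by simp [z1, z2])]
    have z3 := u3 (by simp [z1, z2])
    filter_upwards [cellLow_zero_corner hε z1 z2, cellLow_neg_one_zero_corner hε z1 z2,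
      cellLow_zero_neg_one_corner hε z1 z2, cellHigh_neg_one_neg_one_corner hε z1 z2,
      cellHigh_neg_one_zero_eq hε z1 z2.le z3, cellHigh_zero_neg_one_eq hε z1.le z2 z3,
      ca.eventually_lt_const (u := 1 / 2) (by simp [z1]),
      ca.eventually_const_lt (u := -1 / 2) (by norm_num [z1]),
      cb.eventually_lt_const (u := 1 / 2) (by simp [z2]),
      cb.eventually_const_lt (u := -1 / 2) (by norm_num [z2])] with R e1 e2 e3 e4 e5 e6 m1 m2 m3 m4
    unfold glob
    rcases lt_or_ge (R.1 / R.2.2) 0 with p1 | p1 <;> rcases lt_or_ge (R.2.1 / R.2.2) 0 with p2 | p2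
    · rw [cell_eq_cellHigh (R₀ := R) (i := -1) (j := -1), e4, e1] <;> push_cast <;> linarith
    · rcases le_or_gt (R.1 / R.2.2 + R.2.1 / R.2.2) 0 with p3 | p3
      · rw [cell_eq_cellLow (R₀ := R) (i := -1) (j := 0), e2, e1] <;> push_cast <;> linarith
      · rw [cell_eq_cellHigh (R₀ := R) (i := -1) (j := 0), e5] <;> push_cast <;> linarith
    · rcases le_or_gt (R.1 / R.2.2 + R.2.1 / R.2.2) 0 with p3 | p3
      · rw [cell_eq_cellLow (R₀ := R) (i := 0) (j := -1), e3, e1] <;> push_cast <;> linarith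
      · rw [cell_eq_cellHigh (R₀ := R) (i := 0) (j := -1), e6] <;> push_cast <;> linarith
    · rw [cell_eq_cellLow (R₀ := R) (i := 0) (j := 0)] <;> push_cast <;> linarith
  · have z1 : R₀.1 = 0 := by simpa [hS.ne] using ha0.symm
    rw [cell_eq_cellLow (i := 0) (j := 0) (by simp [z1]) (by simp [z1]) (by simpa using hb)
      (by simpa using hb') (by simpa [z1] using hb'.le)]
    filter_upwards [cellHigh_neg_one_zero_eq hε z1 u2 (u3 (by rw [← ha0]; linarith)), n2,
      ca.eventually_const_lt (u := -1) (by simp [z1]), cb.eventually_const_lt hb0, n1,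
      cs.eventually_lt_const (u := 1) (by simpa [z1] using hb'),
      cs.eventually_const_lt (u := 0) (by simpa [z1] using hb0)] with R e1 m1 m2 m3 m4 m5 m6
    unfold glob
    rcases lt_or_ge (R.1 / R.2.2) 0 with p1 | p1
    · rw [cell_eq_cellHigh (R₀ := R) (i := -1) (j := 0), e1] <;> push_cast <;> linarith
    · rw [cell_eq_cellLow (R₀ := R) (i := 0) (j := 0)] <;> push_cast <;> linarith
  · have z2 : R₀.2.1 = 0 := by simpa [hS.ne] using hb0.symm
    rw [cell_eq_cellLow (i := 0) (j := 0) (by simpa using ha) (by simpa using ha') (by simp [z2])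
      (by simp [z2]) (by simpa [z2] using ha'.le)]
    filter_upwards [cellHigh_zero_neg_one_eq hε u1 z2 (u3 (by rw [← hb0]; linarith)), n1,
      cb.eventually_const_lt (u := -1) (by simp [z2]), ca.eventually_const_lt ha0, n2,
      cs.eventually_lt_const (u := 1) (by simpa [z2] using ha'),
      cs.eventually_const_lt (u := 0) (by simpa [z2] using ha0)] with R e1 m1 m2 m3 m4 m5 m6
    unfold glob
    rcases lt_or_ge (R.2.1 / R.2.2) 0 with p1 | p1
    · rw [cell_eq_cellHigh (R₀ := R) (i := 0) (j := -1), e1] <;> push_cast <;> linarith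
    · rw [cell_eq_cellLow (R₀ := R) (i := 0) (j := 0)] <;> push_cast <;> linarith
  · have n3 := ca.eventually_const_lt ha0
    have n4 := cb.eventually_const_lt hb0
    rcases lt_trichotomy (R₀.1 / R₀.2.2 + R₀.2.1 / R₀.2.2) 1 with h | h | h
    · rw [cell_eq_cellLow (i := 0) (j := 0) (by simpa using ha) (by simpa using ha')
        (by simpa using hb) (by simpa using hb') (by simpa using h.le)]
      filter_upwards [n1, n2, n3, n4, cs.eventually_lt_const h] with R m1 m2 m3 m4 m5
      unfold glob
      rw [cell_eq_cellLow (R₀ := R) (i := 0) (j := 0)] <;> push_cast <;> linarith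
    · rw [cell_eq_cellLow (i := 0) (j := 0) (by simpa using ha) (by simpa using ha')
        (by simpa using hb) (by simpa using hb') (by simpa using h.le)]
      have h3 : R₀.2.2 - R₀.1 - R₀.2.1 = 0 := by
        rw [← add_div, div_eq_iff hS.ne] at h
        linarith
      filter_upwards [n1, n2, n3, n4, cellHigh_zero_eq hε u1 u2 h3] with R m1 m2 m3 m4 e1
      unfold glob
      rcases le_or_gt (R.1 / R.2.2 + R.2.1 / R.2.2) 1 with p | p
      · rw [cell_eq_cellLow (R₀ := R) (i := 0) (j := 0)] <;> push_cast <;> linarith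
      · rw [cell_eq_cellHigh (R₀ := R) (i := 0) (j := 0), e1] <;> push_cast <;> linarith
    · rw [cell_eq_cellHigh (i := 0) (j := 0) (by simpa using ha) (by simpa using ha')
        (by simpa using hb) (by simpa using hb') (by simpa using h)]
      filter_upwards [n1, n2, n3, n4, cs.eventually_const_lt h] with R m1 m2 m3 m4 m5
      unfold glob
      rw [cell_eq_cellHigh (R₀ := R) (i := 0) (j := 0)] <;> push_cast <;> linarith

theorem deckLog_neg (i j : ℤ) (R : ℝ × ℝ × ℝ) : deckLog i j (deckLog (-i) (-j) R) = R := by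
  unfold deckLog
  refine Prod.ext ?_ (Prod.ext ?_ rfl) <;> simp

theorem continuous_deckLog (i j : ℤ) : Continuous (deckLog i j) := by
  unfold deckLog
  fun_prop

/-- The global potential agrees near every point with the potential of its triangle. -/
theorem glob_eventuallyEq_cell {R₀ : ℝ × ℝ × ℝ} (hε : Real.exp R₀.2.2 = c.ε) :
    c.glob =ᶠ[𝓝 R₀] c.cell R₀ := by
  have hS := log_ε_neg hε
  set i := ⌊R₀.1 / R₀.2.2⌋
  set j := ⌊R₀.2.1 / R₀.2.2⌋
  have e1 : (deckLog (-i) (-j) R₀).1 / (deckLog (-i) (-j) R₀).2.2 = Int.fract (R₀.1 / R₀.2.2) := by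
    have := hS.ne
    unfold deckLog Int.fract
    simp only
    push_cast
    field_simp
    ring
  have e2 : (deckLog (-i) (-j) R₀).2.1 / (deckLog (-i) (-j) R₀).2.2 =
      Int.fract (R₀.2.1 / R₀.2.2) := by
    have := hS.ne
    unfold deckLog Int.fract
    simp only
    push_cast
    field_simp
    ring
  -- The deck transformation by the floors moves the point into the fundamental square; `cell` and
  -- `glob` change by the same shift.
  have key := glob_eventuallyEq_of_mem_Ico (c := c) (R₀ := deckLog (-i) (-j) R₀) hε
    (by rw [e1]; exact Int.fract_nonneg _) (by rw [e1]; exact Int.fract_lt_one _)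
    (by rw [e2]; exact Int.fract_nonneg _) (by rw [e2]; exact Int.fract_lt_one _)
  have hne : ∀ᶠ R : ℝ × ℝ × ℝ in 𝓝 R₀, R.2.2 ≠ 0 :=
    ContinuousAt.eventually_ne (by fun_prop) hS.ne
  filter_upwards [(continuous_deckLog (-i) (-j)).continuousAt.eventually key, hne] with R h1 h2
  conv_lhs => rw [← deckLog_neg i j R]
  rw [glob_deckLog i j (R := deckLog (-i) (-j) R) h2, h1, ← cell_deckLog i j (R₀ := deckLog (-i) (-j) R₀) hS.ne, deckLog_neg,
    deckLog_neg]

end Profile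

/-! ### Second derivatives of sums -/

theorem fderiv_fderiv_add {E : Type*} [NormedAddCommGroup E] [NormedSpace ℝ E] {f g : E → ℝ}
    {p : E} (hf : ContDiffAt ℝ 2 f p) (hg : ContDiffAt ℝ 2 g p) :
    fderiv ℝ (fderiv ℝ fun x => f x + g x) p =
      fderiv ℝ (fderiv ℝ f) p + fderiv ℝ (fderiv ℝ g) p := by
  have e : (fderiv ℝ fun x => f x + g x) =ᶠ[𝓝 p] fun x => fderiv ℝ f x + fderiv ℝ g x := by
    filter_upwards [hf.eventually (by simp), hg.eventually (by simp)] with x h1 h2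
    exact fderiv_fun_add (h1.differentiableAt (by simp)) (h2.differentiableAt (by simp))
  rw [e.fderiv_eq]
  exact fderiv_fun_add ((hf.fderiv_right (m := 1) (by norm_num)).differentiableAt (by simp))
    ((hg.fderiv_right (m := 1) (by norm_num)).differentiableAt (by simp))

theorem fderiv_fderiv_clm {E : Type*} [NormedAddCommGroup E] [NormedSpace ℝ E] (ℓ : E →L[ℝ] ℝ)
    (p : E) : fderiv ℝ (fderiv ℝ fun x => ℓ x) p = 0 := by
  have e : (fderiv ℝ fun x => ℓ x) = fun _ => ℓ := funext fun x => ℓ.fderiv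
  rw [e]
  exact fderiv_const_apply ℓ

namespace Profile

variable {c : Profile}

/-- The first coordinate. -/
noncomputable abbrev _root_.BananaMirror.coordU : (ℝ × ℝ × ℝ) →L[ℝ] ℝ :=
  ContinuousLinearMap.fst ℝ ℝ (ℝ × ℝ)

/-- The second coordinate. -/
noncomputable abbrev _root_.BananaMirror.coordV : (ℝ × ℝ × ℝ) →L[ℝ] ℝ :=
  (ContinuousLinearMap.fst ℝ ℝ ℝ).comp (ContinuousLinearMap.snd ℝ ℝ (ℝ × ℝ))

/-- The third coordinate. -/
noncomputable abbrev _root_.BananaMirror.coordS : (ℝ × ℝ × ℝ) →L[ℝ] ℝ :=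
  (ContinuousLinearMap.snd ℝ ℝ ℝ).comp (ContinuousLinearMap.snd ℝ ℝ (ℝ × ℝ))

open Classical in
/-- The logarithms of the three norms in the vertex chart chosen at `R₀`, as a function of
`(log |Tx|², log |Ty|², log |T³v₀|²)`. -/
noncomputable def _root_.BananaMirror.chartLog (R₀ R : ℝ × ℝ × ℝ) : ℝ × ℝ × ℝ :=
  if IsLow R₀ then
    triple (R.1 - ⌊R₀.1 / R₀.2.2⌋ * R.2.2, R.2.1 - ⌊R₀.2.1 / R₀.2.2⌋ * R.2.2, R.2.2)
  else
    triple (R.2.2 - (R.1 - ⌊R₀.1 / R₀.2.2⌋ * R.2.2),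
      R.2.2 - (R.2.1 - ⌊R₀.2.1 / R₀.2.2⌋ * R.2.2), R.2.2)

/-- `chartLog` is linear, maps the base point into the closed simplex, and is injective along the
fibre. -/
theorem exists_chartLog_eq {R₀ : ℝ × ℝ × ℝ} (hε : Real.exp R₀.2.2 = c.ε) :
    ∃ (L : (ℝ × ℝ × ℝ) →L[ℝ] ℝ × ℝ × ℝ) (ℓ : (ℝ × ℝ × ℝ) →L[ℝ] ℝ),
      (∀ R, L R = chartLog R₀ R) ∧ (∀ R, c.cell R₀ R = c.pot (L R) + ℓ R) ∧
      c.InSimplex (L R₀) ∧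
      ∀ w : ℝ × ℝ × ℝ, w.2.2 = 0 → w ≠ 0 → (L w).1 + (L w).2.1 + (L w).2.2 = 0 ∧ L w ≠ 0 := by
  have hS := log_ε_neg hε
  set i := ⌊R₀.1 / R₀.2.2⌋ with hi
  set j := ⌊R₀.2.1 / R₀.2.2⌋ with hj
  have k1 : R₀.1 - i * R₀.2.2 = Int.fract (R₀.1 / R₀.2.2) * R₀.2.2 := by
    rw [Int.fract, sub_mul, div_mul_cancel₀ _ hS.ne, hi]
  have k2 : R₀.2.1 - j * R₀.2.2 = Int.fract (R₀.2.1 / R₀.2.2) * R₀.2.2 := by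
    rw [Int.fract, sub_mul, div_mul_cancel₀ _ hS.ne, hj]
  have f1 := Int.fract_nonneg (R₀.1 / R₀.2.2)
  have f1' := Int.fract_lt_one (R₀.1 / R₀.2.2)
  have f2 := Int.fract_nonneg (R₀.2.1 / R₀.2.2)
  have f2' := Int.fract_lt_one (R₀.2.1 / R₀.2.2)
  let x : (ℝ × ℝ × ℝ) →L[ℝ] ℝ := coordU - (i : ℝ) • coordS
  let y : (ℝ × ℝ × ℝ) →L[ℝ] ℝ := coordV - (j : ℝ) • coordS
  let ℓ : (ℝ × ℝ × ℝ) →L[ℝ] ℝ := (-(2 * i + j) : ℝ) • coordU - (i + 2 * j : ℝ) • coordV +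
    (i ^ 2 + i * j + j ^ 2 + i + j : ℝ) • coordS
  have hx : ∀ R, x R = R.1 - i * R.2.2 := fun R => rfl
  have hy : ∀ R, y R = R.2.1 - j * R.2.2 := fun R => rfl
  have hℓ : ∀ R, ℓ R = deckTerm i j R := fun R => rfl
  by_cases hlow : IsLow R₀
  · refine ⟨x.prod (y.prod (coordS - x - y)), ℓ, fun R => ?_, fun R => ?_, ?_, ?_⟩
    · unfold chartLog
      rw [if_pos hlow]
      rfl
    · unfold cell
      rw [if_pos hlow]
      rfl
    · have hl : Int.fract (R₀.1 / R₀.2.2) + Int.fract (R₀.2.1 / R₀.2.2) ≤ 1 := hlow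
      refine ⟨show x R₀ ≤ 0 from ?_, show y R₀ ≤ 0 from ?_, show R₀.2.2 - x R₀ - y R₀ ≤ 0 from ?_,
        show Real.exp (x R₀ + y R₀ + (R₀.2.2 - x R₀ - y R₀)) = c.ε from ?_⟩
      · rw [hx, k1]; nlinarith
      · rw [hy, k2]; nlinarith
      · rw [hx, hy, k1, k2]; nlinarith
      · rw [← hε]; congr 1; ring
    · rintro ⟨a, b, s⟩ hs hw
      obtain rfl : s = 0 := hs
      have ex : x (a, b, 0) = a := by rw [hx]; simp
      have ey : y (a, b, 0) = b := by rw [hy]; simp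
      have eL : x.prod (y.prod (coordS - x - y)) (a, b, 0) = (a, b, 0 - a - b) := by
        rw [← ex, ← ey]
        simp only [ex, ey]
        show (x _, y _, 0 - x _ - y _) = _
        rw [ex, ey]
      rw [eL]
      refine ⟨by ring, fun h => hw ?_⟩
      simp only [Prod.mk_eq_zero] at h ⊢
      exact ⟨h.1, h.2.1, trivial⟩
  · refine ⟨(coordS - x).prod ((coordS - y).prod (coordS - (coordS - x) - (coordS - y))),
      ℓ + (coordS - coordU - coordV + (i + j : ℝ) • coordS), fun R => ?_, fun R => ?_, ?_, ?_⟩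
    · unfold chartLog
      rw [if_neg hlow]
      rfl
    · unfold cell
      rw [if_neg hlow]
      rfl
    · have hl : 1 < Int.fract (R₀.1 / R₀.2.2) + Int.fract (R₀.2.1 / R₀.2.2) := not_le.1 hlow
      refine ⟨show R₀.2.2 - x R₀ ≤ 0 from ?_, show R₀.2.2 - y R₀ ≤ 0 from ?_,
        show R₀.2.2 - (R₀.2.2 - x R₀) - (R₀.2.2 - y R₀) ≤ 0 from ?_,
        show Real.exp (R₀.2.2 - x R₀ + (R₀.2.2 - y R₀) +
          (R₀.2.2 - (R₀.2.2 - x R₀) - (R₀.2.2 - y R₀))) = c.ε from ?_⟩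
      · rw [hx, k1]; nlinarith
      · rw [hy, k2]; nlinarith
      · rw [hx, hy, k1, k2]; nlinarith
      · rw [← hε]; congr 1; ring
    · rintro ⟨a, b, s⟩ hs hw
      obtain rfl : s = 0 := hs
      have ex : x (a, b, 0) = a := by rw [hx]; simp
      have ey : y (a, b, 0) = b := by rw [hy]; simp
      have eL : (coordS - x).prod ((coordS - y).prod (coordS - (coordS - x) - (coordS - y)))
          (a, b, 0) = (-a, -b, a + b) := by
        show (0 - x _, 0 - y _, 0 - (0 - x _) - (0 - y _)) = _
        rw [ex, ey]
        simp
      rw [eL]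
      refine ⟨by ring, fun h => hw ?_⟩
      simp only [Prod.mk_eq_zero, neg_eq_zero] at h ⊢
      exact ⟨h.1, h.2.1, trivial⟩

/-- The global potential with the pull-back of a multiple of `|v₀|²`. -/
noncomputable def total (c : Profile) (K : ℝ) (R : ℝ × ℝ × ℝ) : ℝ := c.glob R + K * Real.exp R.2.2

theorem contDiff_base_term (K : ℝ) :
    ContDiff ℝ ∞ fun R : ℝ × ℝ × ℝ => K * Real.exp (coordS R) := by
  fun_prop

theorem contDiffAt_glob {R₀ : ℝ × ℝ × ℝ} (hε : Real.exp R₀.2.2 = c.ε) :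
    ContDiffAt ℝ ∞ c.glob R₀ := by
  obtain ⟨L, ℓ, -, hcell, hsimp, -⟩ := exists_chartLog_eq hε
  refine ContDiffAt.congr_of_eventuallyEq ?_ (glob_eventuallyEq_cell hε)
  rw [funext hcell]
  exact (hsimp.convex.1.comp R₀ L.contDiff.contDiffAt).add ℓ.contDiff.contDiffAt

theorem contDiffAt_total (K : ℝ) {R₀ : ℝ × ℝ × ℝ} (hε : Real.exp R₀.2.2 = c.ε) :
    ContDiffAt ℝ ∞ (c.total K) R₀ :=
  (contDiffAt_glob hε).add (contDiff_base_term K).contDiffAt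

/-- The base term depends on $S$ only and is constant on the fibre, which is why $K$ may be any real
number. -/
theorem total_pos (K : ℝ) {R₀ : ℝ × ℝ × ℝ} (hε : Real.exp R₀.2.2 = c.ε) {w : ℝ × ℝ × ℝ}
    (hw : w.2.2 = 0) (hw0 : w ≠ 0) : 0 < fderiv ℝ (fderiv ℝ (c.total K)) R₀ w w := by
  obtain ⟨L, ℓ, -, hcell, hsimp, hL⟩ := exists_chartLog_eq hε
  have h1 : ContDiffAt ℝ 2 (fun R => c.pot (L R)) R₀ :=
    (hsimp.convex.1.comp R₀ L.contDiff.contDiffAt).of_le (by norm_cast)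
  have e : c.total K = fun R => c.glob R + K * Real.exp (coordS R) := rfl
  have e2 : fderiv ℝ (fderiv ℝ fun R : ℝ × ℝ × ℝ => K * Real.exp (coordS R)) R₀ w w = 0 := by
    have h2 : ContDiffAt ℝ 2 (fun s : ℝ => K * Real.exp s) (coordS R₀) := by fun_prop
    rw [fderiv_fderiv_comp_clm (g := fun s : ℝ => K * Real.exp s) coordS h2]
    have : coordS w = 0 := hw
    rw [this]
    simp
  rw [e, fderiv_fderiv_add ((contDiffAt_glob hε).of_le (by norm_cast))
    ((contDiff_base_term K).contDiffAt.of_le (by norm_cast)), add_apply, add_apply, e2, add_zero,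
    fderiv_fderiv_congr (glob_eventuallyEq_cell hε), funext hcell,
    fderiv_fderiv_add h1 (ℓ.contDiff.contDiffAt), fderiv_fderiv_clm, add_zero,
    fderiv_fderiv_comp_clm L (hsimp.convex.1.of_le (by norm_cast))]
  exact hsimp.convex.2 _ (hL w hw hw0).1 (hL w hw hw0).2

theorem total_deckLog (K : ℝ) (i j : ℤ) {R : ℝ × ℝ × ℝ} (h : R.2.2 ≠ 0) :
    c.total K (deckLog i j R) = c.total K R + deckShift i j R := by
  unfold total
  rw [glob_deckLog i j h]
  simp only [deckLog]
  ring

/-- The derivative of the global potential at the centre of the tile. -/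
theorem fderiv_total_center (K : ℝ) {S : ℝ} (hε : Real.exp S = c.ε) :
    fderiv ℝ (c.total K) (0, 0, S) (1, 0, 0) = 1 ∧
      fderiv ℝ (c.total K) (0, 0, S) (0, 1, 0) = 1 := by
  have e : c.total K =ᶠ[𝓝 (0, 0, S)] fun R => logTile R.1 R.2.1 + K * Real.exp R.2.2 := by
    have h1 : c.cell (0, 0, S) = c.cellLow 0 0 := cell_eq_cellLow (by simp) (by simp) (by simp)
      (by simp) (by simp)
    filter_upwards [glob_eventuallyEq_cell (c := c) (R₀ := (0, 0, S)) hε,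
      cellLow_zero_corner (c := c) (R₀ := (0, 0, S)) hε rfl rfl] with R h2 h3
    unfold total
    rw [h2, h1, h3]
  have hd : DifferentiableAt ℝ (c.total K) (0, 0, S) :=
    (contDiffAt_total K hε).differentiableAt (by simp)
  have key : ∀ w : ℝ × ℝ × ℝ, w.2.2 = 0 → fderiv ℝ (c.total K) (0, 0, S) w =
      (Real.exp 0 / (1 + Real.exp 0) * w.1 + Real.exp 0 / (1 + Real.exp 0) * w.2.1 +
        Real.exp (0 + 0) / (1 + Real.exp (0 + 0)) * (w.1 + w.2.1)) := by
    intro w hw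
    have hline : HasDerivAt (fun t : ℝ => ((0, 0, S) : ℝ × ℝ × ℝ) + t • w) w 0 := by
      simpa using ((hasDerivAt_id (0 : ℝ)).smul_const w).const_add ((0, 0, S) : ℝ × ℝ × ℝ)
    have h1 : HasDerivAt (fun t : ℝ => c.total K (((0, 0, S) : ℝ × ℝ × ℝ) + t • w))
        (fderiv ℝ (c.total K) (0, 0, S) w) 0 := by
      have h2 : HasFDerivAt (c.total K) (fderiv ℝ (c.total K) (0, 0, S))
        (((0, 0, S) : ℝ × ℝ × ℝ) + (0 : ℝ) • w) := by simpa using hd.hasFDerivAt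
      exact h2.comp_hasDerivAt (0 : ℝ) hline
    obtain ⟨h', hh, -, h1', -⟩ := hasJet_logTile 0 0 w.1 w.2.1
    have h2 := hh.self_of_nhds
    rw [h1'] at h2
    have hc : Tendsto (fun t : ℝ => ((0, 0, S) : ℝ × ℝ × ℝ) + t • w) (𝓝 0) (𝓝 (0, 0, S)) := by
      simpa using hline.continuousAt.tendsto
    refine h1.unique ((h2.add_const (K * Real.exp S)).congr_of_eventuallyEq ?_)
    filter_upwards [hc.eventually e] with t ht
    rw [ht]
    simp [hw]
  constructor
  · rw [key _ rfl]; norm_num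
  · rw [key _ rfl]; norm_num

/-- In the chart chosen at `R₀` the potential is the global potential up to a linear function. -/
theorem exists_chart_eventuallyEq (K : ℝ) {R₀ : ℝ × ℝ × ℝ} (hε : Real.exp R₀.2.2 = c.ε) :
    ∃ ℓ : (ℝ × ℝ × ℝ) →L[ℝ] ℝ, (fun R => c.pot (chartLog R₀ R) + K * Real.exp R.2.2) =ᶠ[𝓝 R₀]
      fun R => c.total K R + ℓ R := by
  obtain ⟨L, ℓ, hL, hcell, -, -⟩ := exists_chartLog_eq hε
  refine ⟨-ℓ, ?_⟩
  filter_upwards [glob_eventuallyEq_cell hε] with R hR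
  unfold total
  rw [hR, hcell, hL, neg_apply]
  ring

end Profile

/-! ### From $\partial\bar\partial$ on $(\mathbb C^*)^3$ to real Hessians in the logarithms of the
norms. -/

/-! ### Logarithmic coordinates on `(ℂ^*)³` -/

/-- `(log |Tx|², log |Ty|², log |T³v₀|²)`. -/
noncomputable def logs (T : ℝ) (q : ℂ × ℂ × ℂ) : ℝ × ℝ × ℝ :=
  (2 * Real.log (T * ‖q.1‖), 2 * Real.log (T * ‖q.2.1‖),
    2 * Real.log (T * ‖q.1‖) + 2 * Real.log (T * ‖q.2.1‖) + 2 * Real.log (T * ‖q.2.2‖))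

/-- The derivative of `logs`. -/
noncomputable def logsDeriv (q u : ℂ × ℂ × ℂ) : ℝ × ℝ × ℝ :=
  (2 * (u.1 / q.1).re, 2 * (u.2.1 / q.2.1).re,
    2 * (u.1 / q.1).re + 2 * (u.2.1 / q.2.1).re + 2 * (u.2.2 / q.2.2).re)

/-- All coordinates of the point are non-zero. -/
def Nonzero (q : ℂ × ℂ × ℂ) : Prop := q.1 ≠ 0 ∧ q.2.1 ≠ 0 ∧ q.2.2 ≠ 0

theorem Nonzero.eventually {q : ℂ × ℂ × ℂ} (h : Nonzero q) : ∀ᶠ q' in 𝓝 q, Nonzero q' := by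
  have h1 : ∀ᶠ q' : ℂ × ℂ × ℂ in 𝓝 q, q'.1 ≠ 0 := ContinuousAt.eventually_ne (by fun_prop) h.1
  have h2 : ∀ᶠ q' : ℂ × ℂ × ℂ in 𝓝 q, q'.2.1 ≠ 0 :=
    ContinuousAt.eventually_ne (by fun_prop) h.2.1
  have h3 : ∀ᶠ q' : ℂ × ℂ × ℂ in 𝓝 q, q'.2.2 ≠ 0 :=
    ContinuousAt.eventually_ne (by fun_prop) h.2.2
  filter_upwards [h1, h2, h3] with q' k1 k2 k3 using ⟨k1, k2, k3⟩

theorem contDiffAt_log_norm {T : ℝ} (hT : 0 < T) {E : Type*} [NormedAddCommGroup E]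
    [NormedSpace ℝ E] {f : E → ℂ} {p : E} (hf : ContDiffAt ℝ ∞ f p) (h : f p ≠ 0) :
    ContDiffAt ℝ ∞ (fun q => 2 * Real.log (T * ‖f q‖)) p :=
  contDiffAt_const.mul ((contDiffAt_const.mul (hf.norm ℝ h)).log
    (mul_pos hT (norm_pos_iff.2 h)).ne')

theorem contDiffAt_logs {T : ℝ} (hT : 0 < T) {q : ℂ × ℂ × ℂ} (h : Nonzero q) :
    ContDiffAt ℝ ∞ (logs T) q := by
  have h1 := contDiffAt_log_norm hT (f := fun q : ℂ × ℂ × ℂ => q.1) (p := q) (by fun_prop) h.1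
  have h2 := contDiffAt_log_norm hT (f := fun q : ℂ × ℂ × ℂ => q.2.1) (p := q) (by fun_prop) h.2.1
  have h3 := contDiffAt_log_norm hT (f := fun q : ℂ × ℂ × ℂ => q.2.2) (p := q) (by fun_prop) h.2.2
  exact h1.prodMk (h2.prodMk ((h1.add h2).add h3))

/-- The derivative of `2 log |T z|` along a curve. -/
theorem hasDerivWithinAt_log_norm {T : ℝ} (hT : 0 < T) {z : ℝ → ℂ} {z' : ℂ} {s : Set ℝ} {t : ℝ}
    (hz : HasDerivWithinAt z z' s t) (h : z t ≠ 0) :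
    HasDerivWithinAt (fun τ => 2 * Real.log (T * ‖z τ‖)) (2 * (z' / z t).re) s t := by
  have h1 : HasDerivWithinAt (fun τ => T ^ 2 * ‖z τ‖ ^ 2) (T ^ 2 * (2 * inner ℝ (z t) z')) s t :=
    hz.norm_sq.const_mul (T ^ 2)
  have h0 : T ^ 2 * ‖z t‖ ^ 2 ≠ 0 := by
    have := norm_pos_iff.2 h
    positivity
  have e : (fun τ => 2 * Real.log (T * ‖z τ‖)) = fun τ => Real.log (T ^ 2 * ‖z τ‖ ^ 2) := by
    funext τ
    rw [← mul_pow, Real.log_pow]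
    norm_num
  rw [e]
  refine (h1.log h0).congr_deriv ?_
  have hn := norm_pos_iff.2 h
  have hns : ‖z t‖ ^ 2 = Complex.normSq (z t) := (Complex.normSq_eq_norm_sq _).symm
  rw [Complex.inner, Complex.div_re, Complex.mul_re, Complex.conj_re, Complex.conj_im, hns]
  rw [hns] at h0
  have hq : Complex.normSq (z t) ≠ 0 := right_ne_zero_of_mul h0
  field_simp
  ring

theorem hasDerivWithinAt_logs {T : ℝ} (hT : 0 < T) {γ : ℝ → ℂ × ℂ × ℂ} {v : ℂ × ℂ × ℂ} {s : Set ℝ}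
    {t : ℝ} (hγ : HasDerivWithinAt γ v s t) (h : Nonzero (γ t)) :
    HasDerivWithinAt (fun τ => logs T (γ τ)) (logsDeriv (γ t) v) s t := by
  have h1 := hasDerivWithinAt_log_norm hT hγ.fst h.1
  have h2 := hasDerivWithinAt_log_norm hT hγ.snd.fst h.2.1
  have h3 := hasDerivWithinAt_log_norm hT hγ.snd.snd h.2.2
  exact h1.prodMk (h2.prodMk ((h1.add h2).add h3))

theorem fderiv_logs {T : ℝ} (hT : 0 < T) {q : ℂ × ℂ × ℂ} (h : Nonzero q) (u : ℂ × ℂ × ℂ) :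
    fderiv ℝ (logs T) q u = logsDeriv q u := by
  have hline : HasDerivAt (fun t : ℝ => q + t • u) u 0 := by
    simpa using ((hasDerivAt_id (0 : ℝ)).smul_const u).const_add q
  have e : q + (0 : ℝ) • u = q := by simp
  have h1 := hasDerivWithinAt_logs hT (hline.hasDerivWithinAt (s := Set.univ)) (by rwa [e])
  rw [e, hasDerivWithinAt_univ] at h1
  have h2 : HasFDerivAt (logs T) (fderiv ℝ (logs T) q) (q + (0 : ℝ) • u) := by
    rw [e]
    exact ((contDiffAt_logs hT h).differentiableAt (by simp)).hasFDerivAt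
  have h3 : HasDerivAt (fun t : ℝ => logs T (q + t • u)) (fderiv ℝ (logs T) q u) 0 := by
    generalize logs T = G at h2 ⊢
    exact h2.comp_hasDerivAt (0 : ℝ) hline
  exact h3.unique h1

theorem hasDerivAt_re_div {x u w : ℂ} (hx : x ≠ 0) :
    HasDerivAt (fun t : ℝ => 2 * (u / (x + t • w)).re) (-2 * (u * w / x ^ 2).re) 0 := by
  have h1 : HasDerivAt (fun t : ℝ => x + t • w) w 0 := by
    simpa using ((hasDerivAt_id (0 : ℝ)).smul_const w).const_add x
  have h2 : HasDerivAt (fun t : ℝ => u / (x + t • w)) (-(u * w / x ^ 2)) 0 := by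
    refine ((hasDerivAt_const (0 : ℝ) u).div h1 (by simpa using hx)).congr_deriv ?_
    simp
    ring
  refine ((Complex.reCLM.hasFDerivAt.comp_hasDerivAt (0 : ℝ) h2).const_mul 2).congr_deriv ?_
  simp

/-- The second derivative of `logs`. -/
noncomputable def logsDerivTwo (q u w : ℂ × ℂ × ℂ) : ℝ × ℝ × ℝ :=
  (-2 * (u.1 * w.1 / q.1 ^ 2).re, -2 * (u.2.1 * w.2.1 / q.2.1 ^ 2).re,
    -2 * (u.1 * w.1 / q.1 ^ 2).re + -2 * (u.2.1 * w.2.1 / q.2.1 ^ 2).re +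
      -2 * (u.2.2 * w.2.2 / q.2.2 ^ 2).re)

theorem hasDerivAt_logsDeriv {q : ℂ × ℂ × ℂ} (h : Nonzero q) (u w : ℂ × ℂ × ℂ) :
    HasDerivAt (fun t : ℝ => logsDeriv (q + t • w) u) (logsDerivTwo q u w) 0 := by
  have h1 := hasDerivAt_re_div (u := u.1) (w := w.1) h.1
  have h2 := hasDerivAt_re_div (u := u.2.1) (w := w.2.1) h.2.1
  have h3 := hasDerivAt_re_div (u := u.2.2) (w := w.2.2) h.2.2
  exact h1.prodMk (h2.prodMk ((h1.add h2).add h3))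

/-- Logarithms of norms are pluriharmonic: locally they are real parts of holomorphic functions, so
their second derivative is the real part of a complex bilinear form. This removes the
first-derivative terms of the potential from `ddbar`. -/
theorem logsDerivTwo_I (q u w : ℂ × ℂ × ℂ) :
    logsDerivTwo q (Complex.I • u) w = logsDerivTwo q u (Complex.I • w) := by
  unfold logsDerivTwo
  simp only [Prod.smul_fst, Prod.smul_snd, smul_eq_mul, mul_left_comm, mul_assoc]

theorem fderiv_fderiv_comp_logs {T : ℝ} (hT : 0 < T) {q : ℂ × ℂ × ℂ} (h : Nonzero q)
    {g : ℝ × ℝ × ℝ → ℝ} (hg : ContDiffAt ℝ 2 g (logs T q)) (u w : ℂ × ℂ × ℂ) :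
    fderiv ℝ (fderiv ℝ fun q' => g (logs T q')) q w u =
      fderiv ℝ (fderiv ℝ g) (logs T q) (logsDeriv q w) (logsDeriv q u) +
        fderiv ℝ g (logs T q) (logsDerivTwo q u w) := by
  have hl := contDiffAt_logs hT h
  have hΦ : ContDiffAt ℝ 2 (fun q' => g (logs T q')) q := hg.comp q (hl.of_le (by norm_cast))
  have hline : HasDerivAt (fun t : ℝ => q + t • w) w 0 := by
    simpa using ((hasDerivAt_id (0 : ℝ)).smul_const w).const_add q
  have hc : Tendsto (fun t : ℝ => q + t • w) (𝓝 0) (𝓝 q) := by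
    simpa using hline.continuousAt.tendsto
  have e0 : q + (0 : ℝ) • w = q := by simp
  have h1 : HasDerivAt (fun t : ℝ => fderiv ℝ (fun q' => g (logs T q')) (q + t • w) u)
      (fderiv ℝ (fderiv ℝ fun q' => g (logs T q')) q w u) 0 := by
    have h2 : HasFDerivAt (fderiv ℝ fun q' => g (logs T q'))
        (fderiv ℝ (fderiv ℝ fun q' => g (logs T q')) q) (q + (0 : ℝ) • w) := by
      rw [e0]
      exact ((hΦ.fderiv_right (m := 1) (by norm_num)).differentiableAt (by simp)).hasFDerivAt
    generalize fderiv ℝ (fun q' => g (logs T q')) = G at h2 ⊢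
    have h2' : HasDerivAt (fun t : ℝ => G (q + t • w)) (fderiv ℝ G q w) 0 :=
      h2.comp_hasDerivAt (0 : ℝ) hline
    simpa using h2'.clm_apply (hasDerivAt_const (0 : ℝ) u)
  have h3 : HasDerivAt (fun t : ℝ => fderiv ℝ g (logs T (q + t • w)) (logsDeriv (q + t • w) u))
      (fderiv ℝ (fderiv ℝ g) (logs T q) (logsDeriv q w) (logsDeriv q u) +
        fderiv ℝ g (logs T q) (logsDerivTwo q u w)) 0 := by
    have h4 := hasDerivWithinAt_logs hT (hline.hasDerivWithinAt (s := Set.univ)) (by rwa [e0])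
    rw [e0, hasDerivWithinAt_univ] at h4
    have h5 : HasFDerivAt (fderiv ℝ g) (fderiv ℝ (fderiv ℝ g) (logs T q))
        (logs T (q + (0 : ℝ) • w)) := by
      rw [e0]
      exact ((hg.fderiv_right (m := 1) (by norm_num)).differentiableAt (by simp)).hasFDerivAt
    generalize fderiv ℝ g = G at h5 ⊢
    have h5' : HasDerivAt (fun t : ℝ => G (logs T (q + t • w)))
        (fderiv ℝ G (logs T q) (logsDeriv q w)) 0 := h5.comp_hasDerivAt (0 : ℝ) h4
    refine (h5'.clm_apply (hasDerivAt_logsDeriv h u w)).congr_deriv ?_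
    simp only [e0]
  refine h1.unique (h3.congr_of_eventuallyEq ?_)
  have hd : ∀ᶠ q' in 𝓝 q, DifferentiableAt ℝ g (logs T q') := by
    refine hl.continuousAt.eventually (p := fun R => DifferentiableAt ℝ g R) ?_
    filter_upwards [hg.eventually (by simp)] with x hx using hx.differentiableAt (by simp)
  filter_upwards [hc.eventually hd, hc.eventually h.eventually] with t k1 k2
  have k3 : HasFDerivAt (fun q' => g (logs T q')) _ (q + t • w) := k1.hasFDerivAt.comp (q + t • w)
    ((contDiffAt_logs hT k2).differentiableAt (by simp)).hasFDerivAt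
  rw [k3.fderiv, ContinuousLinearMap.comp_apply, fderiv_logs hT k2]

/-- The form `(i/2π) ∂∂̄` of a function of the norms. -/
theorem ddbar_comp_logs {T : ℝ} (hT : 0 < T) {q : ℂ × ℂ × ℂ} (h : Nonzero q)
    {g : ℝ × ℝ × ℝ → ℝ} (hg : ContDiffAt ℝ 2 g (logs T q)) (u w : ℂ × ℂ × ℂ) :
    ddbar (fun q' => g (logs T q')) q u w = 1 / (4 * Real.pi) *
      (fderiv ℝ (fderiv ℝ g) (logs T q) (logsDeriv q (Complex.I • u)) (logsDeriv q w) -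
        fderiv ℝ (fderiv ℝ g) (logs T q) (logsDeriv q u) (logsDeriv q (Complex.I • w))) := by
  unfold ddbar
  rw [fderiv_fderiv_comp_logs hT h hg, fderiv_fderiv_comp_logs hT h hg, logsDerivTwo_I]
  have e : logsDerivTwo q (Complex.I • w) u = logsDerivTwo q w (Complex.I • u) := logsDerivTwo_I q w u
  ring

/-! ### The symplectic form in logarithmic coordinates -/

theorem log_scaled_v₀ {T : ℝ} (hT : 0 < T) {q : ℂ × ℂ × ℂ} (h : Nonzero q) :
    2 * Real.log (T ^ 3 * ‖v₀ q‖) = (logs T q).2.2 := by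
  have h1 := norm_pos_iff.2 h.1
  have h2 := norm_pos_iff.2 h.2.1
  have h3 := norm_pos_iff.2 h.2.2
  have e : T ^ 3 * ‖v₀ q‖ = (T * ‖q.1‖) * (T * ‖q.2.1‖) * (T * ‖q.2.2‖) := by
    simp only [v₀, norm_mul]
    ring
  rw [e, Real.log_mul (by positivity) (by positivity), Real.log_mul (by positivity) (by positivity)]
  simp only [logs]
  ring

theorem log_deck_coord {T r : ℝ} (hT : 0 < T) {V z : ℂ} (hV : V ≠ 0) (hz : z ≠ 0) (m : ℤ)
    (hr : 2 * Real.log (T ^ 3 * ‖V‖) = r) :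
    2 * Real.log (T * ‖((T : ℂ) ^ 3 * V) ^ m * z‖) = 2 * Real.log (T * ‖z‖) + m * r := by
  have h1 := norm_pos_iff.2 hV
  have h2 := norm_pos_iff.2 hz
  have e : T * ‖((T : ℂ) ^ 3 * V) ^ m * z‖ = (T ^ 3 * ‖V‖) ^ m * (T * ‖z‖) := by
    rw [norm_mul, norm_zpow, norm_mul, norm_pow, Complex.norm_of_nonneg hT.le]
    ring
  rw [e, Real.log_mul (by positivity) (by positivity), Real.log_zpow, ← hr]
  ring

theorem Nonzero.v₀ {q : ℂ × ℂ × ℂ} (h : Nonzero q) : BananaMirror.v₀ q ≠ 0 :=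
  mul_ne_zero (mul_ne_zero h.1 h.2.1) h.2.2

theorem Nonzero.deck {T : ℝ} (hT : 0 < T) {q : ℂ × ℂ × ℂ} (h : Nonzero q) (m n : ℤ) :
    Nonzero (deck T m n q) := by
  have h0 : (T : ℂ) ^ 3 * BananaMirror.v₀ q ≠ 0 := mul_ne_zero (by simpa using hT.ne') h.v₀
  exact ⟨mul_ne_zero (zpow_ne_zero _ h0) h.1, mul_ne_zero (zpow_ne_zero _ h0) h.2.1,
    mul_ne_zero (zpow_ne_zero _ h0) h.2.2⟩

theorem logs_deck {T : ℝ} (hT : 0 < T) {q : ℂ × ℂ × ℂ} (h : Nonzero q) (m n : ℤ) :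
    logs T (deck T m n q) = ((logs T q).1 + m * (logs T q).2.2,
      (logs T q).2.1 + n * (logs T q).2.2, (logs T q).2.2) := by
  have hr := log_scaled_v₀ hT h
  have h1 := log_deck_coord hT h.v₀ h.1 m hr
  have h2 := log_deck_coord hT h.v₀ h.2.1 n hr
  have h3 := log_deck_coord hT h.v₀ h.2.2 (-(m + n)) hr
  generalize hS : (logs T q).2.2 = S at *
  have hS' : 2 * Real.log (T * ‖q.1‖) + 2 * Real.log (T * ‖q.2.1‖) +
    2 * Real.log (T * ‖q.2.2‖) = S := hS
  simp only [logs, deck, h1, h2, h3, Prod.mk.injEq, true_and]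
  push_cast
  linarith

theorem Nonzero.flipChart {T : ℝ} (hT : 0 < T) {q : ℂ × ℂ × ℂ} (h : Nonzero q) :
    Nonzero (flipChart T q) := by
  have hT' : (T : ℂ) ≠ 0 := by simpa using hT.ne'
  exact ⟨div_ne_zero (mul_ne_zero hT' h.v₀) h.1, div_ne_zero (mul_ne_zero hT' h.v₀) h.2.1,
    inv_ne_zero (mul_ne_zero (pow_ne_zero _ hT') h.2.2)⟩

theorem log_flip_coord {T r : ℝ} (hT : 0 < T) {V z : ℂ} (hV : V ≠ 0) (hz : z ≠ 0)
    (hr : 2 * Real.log (T ^ 3 * ‖V‖) = r) :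
    2 * Real.log (T * ‖(T : ℂ) * V / z‖) = r - 2 * Real.log (T * ‖z‖) := by
  have h1 := norm_pos_iff.2 hV
  have h2 := norm_pos_iff.2 hz
  have e : T * ‖(T : ℂ) * V / z‖ = (T ^ 3 * ‖V‖) / (T * ‖z‖) := by
    rw [norm_div, norm_mul, Complex.norm_of_nonneg hT.le]
    field_simp
  rw [e, Real.log_div (by positivity) (by positivity), ← hr]
  ring

theorem logs_flipChart {T : ℝ} (hT : 0 < T) {q : ℂ × ℂ × ℂ} (h : Nonzero q) :
    logs T (flipChart T q) = ((logs T q).2.2 - (logs T q).1, (logs T q).2.2 - (logs T q).2.1,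
      (logs T q).2.2) := by
  have hr := log_scaled_v₀ hT h
  have h1 := log_flip_coord hT h.v₀ h.1 hr
  have h2 := log_flip_coord hT h.v₀ h.2.1 hr
  have h3 : 2 * Real.log (T * ‖((T : ℂ) ^ 2 * q.2.2)⁻¹‖) = -(2 * Real.log (T * ‖q.2.2‖)) := by
    have h2 := norm_pos_iff.2 h.2.2
    have e : T * ‖((T : ℂ) ^ 2 * q.2.2)⁻¹‖ = (T * ‖q.2.2‖)⁻¹ := by
      rw [norm_inv, norm_mul, norm_pow, Complex.norm_of_nonneg hT.le]
      field_simp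
    rw [e, Real.log_inv]
    ring
  generalize hS : (logs T q).2.2 = S at *
  have hS' : 2 * Real.log (T * ‖q.1‖) + 2 * Real.log (T * ‖q.2.1‖) +
    2 * Real.log (T * ‖q.2.2‖) = S := hS
  simp only [logs, flipChart, h1, h2, h3, Prod.mk.injEq, true_and]
  linarith

/-- The vertex charts in logarithmic coordinates. -/
theorem logs_chartAt {T : ℝ} (hT : 0 < T) {q q' : ℂ × ℂ × ℂ} (h : Nonzero q) (h' : Nonzero q') :
    Nonzero (chartAt T q q') ∧ triple (logs T (chartAt T q q')) = chartLog (logs T q) (logs T q') ∧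
      (logs T (chartAt T q q')).2.2 = (logs T q').2.2 := by
  have ea : Real.log (T * ‖q.1‖) / Real.log (T ^ 3 * ‖v₀ q‖) = (logs T q).1 / (logs T q).2.2 := by
    rw [← log_scaled_v₀ hT h]
    exact (mul_div_mul_left _ _ two_ne_zero).symm
  have ec : Real.log (T * ‖q.2.1‖) / Real.log (T ^ 3 * ‖v₀ q‖) =
      (logs T q).2.1 / (logs T q).2.2 := by
    rw [← log_scaled_v₀ hT h]
    exact (mul_div_mul_left _ _ two_ne_zero).symm
  unfold chartAt chartLog IsLow
  simp only [ea, ec]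
  split_ifs
  · refine ⟨h'.deck hT _ _, ?_, ?_⟩
    · rw [logs_deck hT h']
      simp only [triple, Int.cast_neg, Prod.mk.injEq]
      refine ⟨?_, ?_, ?_⟩ <;> ring
    · rw [logs_deck hT h']
  · refine ⟨(h'.deck hT _ _).flipChart hT, ?_, ?_⟩
    · rw [logs_flipChart hT (h'.deck hT _ _), logs_deck hT h']
      simp only [triple, Int.cast_neg, Prod.mk.injEq]
      refine ⟨?_, ?_, ?_⟩ <;> ring
    · rw [logs_flipChart hT (h'.deck hT _ _), logs_deck hT h']

/-- The profile `c` describes the potential given by the bump functions `b`. -/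
def Matches (b : Bumps) (T : ℝ) (c : Profile) : Prop :=
  ∀ u v w, chamberPot b T (Real.exp u) (Real.exp v) (Real.exp w) = c.chamber (u, v, w)

theorem exp_two_log {T : ℝ} (hT : 0 < T) {z : ℂ} (hz : z ≠ 0) :
    (T * ‖z‖) ^ 2 = Real.exp (2 * Real.log (T * ‖z‖)) := by
  have := norm_pos_iff.2 hz
  rw [two_mul, Real.exp_add, Real.exp_log (by positivity), sq]

/-- The constant becomes $K/T^6$ because $e^S=T^6|v_0|^2$. -/
theorem Matches.vertexPot {b : Bumps} {T : ℝ} {c : Profile} (hb : Matches b T c) (hT : 0 < T)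
    (K : ℝ) {q : ℂ × ℂ × ℂ} (h : Nonzero q) :
    vertexPot b T K q =
      c.pot (triple (logs T q)) + K / T ^ 6 * Real.exp (logs T q).2.2 := by
  have e1 : Real.exp (logs T q).2.2 = T ^ 6 * ‖v₀ q‖ ^ 2 := by
    have h0 := norm_pos_iff.2 h.v₀
    rw [← log_scaled_v₀ hT h, two_mul, Real.exp_add, Real.exp_log (by positivity)]
    ring
  have e2 : K / T ^ 6 * (T ^ 6 * ‖v₀ q‖ ^ 2) = K * ‖v₀ q‖ ^ 2 := by
    field_simp
  have e3 : triple (logs T q) = (2 * Real.log (T * ‖q.1‖), 2 * Real.log (T * ‖q.2.1‖),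
      2 * Real.log (T * ‖q.2.2‖)) := by
    simp only [triple, logs, Prod.mk.injEq, true_and]
    ring
  have m1 := fun x y : ℝ => (Real.exp_monotone.map_max (a := x) (b := y)).symm
  have m2 := fun x y : ℝ => (Real.exp_monotone.map_min (a := x) (b := y)).symm
  rw [e1, e2, e3]
  unfold BananaMirror.vertexPot Profile.pot sortDesc
  simp only [exp_two_log hT h.1, exp_two_log hT h.2.1, exp_two_log hT h.2.2, m1, m2]
  rw [hb]

/-- The form `ω` is `(i/2π) ∂∂̄` of the global potential. -/
theorem Matches.omega {b : Bumps} {T : ℝ} {c : Profile} (hb : Matches b T c) (hT : 0 < T)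
    (K : ℝ) {q : ℂ × ℂ × ℂ} (h : Nonzero q) (hε : Real.exp (logs T q).2.2 = c.ε)
    (u w : ℂ × ℂ × ℂ) :
    omega b T K q u w = 1 / (4 * Real.pi) *
      (fderiv ℝ (fderiv ℝ (c.total (K / T ^ 6))) (logs T q) (logsDeriv q (Complex.I • u))
          (logsDeriv q w) -
        fderiv ℝ (fderiv ℝ (c.total (K / T ^ 6))) (logs T q) (logsDeriv q u)
          (logsDeriv q (Complex.I • w))) := by
  obtain ⟨ℓ, hℓ⟩ := c.exists_chart_eventuallyEq (K / T ^ 6) hε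
  have hc := (Profile.contDiffAt_total (K / T ^ 6) hε).of_le (m := 2) (by norm_cast)
  have e : (fun q' => BananaMirror.vertexPot b T K (chartAt T q q')) =ᶠ[𝓝 q]
      fun q' => (fun R => c.total (K / T ^ 6) R + ℓ R) (logs T q') := by
    -- The chart is frozen at `q` while the argument varies, so discontinuity of the chart choice
    -- plays no role; the linear discrepancy disappears in the second derivative.
    filter_upwards [h.eventually, (contDiffAt_logs hT h).continuousAt.eventually hℓ] with q' h1 h2
    obtain ⟨k1, k2, k3⟩ := logs_chartAt hT h h1
    rw [hb.vertexPot hT K k1, k2, k3, h2]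
  have e2 : BananaMirror.omega b T K q u w =
      ddbar (fun q' => (fun R => c.total (K / T ^ 6) R + ℓ R) (logs T q')) q u w := by
    unfold BananaMirror.omega ddbar
    rw [e.fderiv.fderiv_eq]
  rw [e2, ddbar_comp_logs hT h (hc.add ℓ.contDiff.contDiffAt),
    fderiv_fderiv_add hc ℓ.contDiff.contDiffAt, fderiv_fderiv_clm, add_zero]

/-! ### Duality on the fibre: action coordinates, rotation numbers and the Hamiltonian. -/

/-! ### Quasi-periodic potentials -/

/-- A potential in the coordinates `(log |Tx|², log |Ty|², log |T³v₀|²)` that is smooth and convex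
along the fibre on which the last coordinate is `S`, and quasi-periodic. -/
structure IsPotential (Φ : ℝ × ℝ × ℝ → ℝ) (S : ℝ) : Prop where
  ne_zero : S ≠ 0
  smooth : ∀ R : ℝ × ℝ × ℝ, R.2.2 = S → ContDiffAt ℝ ∞ Φ R
  pos : ∀ R : ℝ × ℝ × ℝ, R.2.2 = S → ∀ w : ℝ × ℝ × ℝ, w.2.2 = 0 → w ≠ 0 →
    0 < fderiv ℝ (fderiv ℝ Φ) R w w
  deck : ∀ (i j : ℤ) (R : ℝ × ℝ × ℝ), R.2.2 ≠ 0 → Φ (deckLog i j R) = Φ R + deckShift i j R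
  center : fderiv ℝ Φ (0, 0, S) (1, 0, 0) = 1 ∧ fderiv ℝ Φ (0, 0, S) (0, 1, 0) = 1

/-- The moment map, that is, the action coordinates. -/
noncomputable def moment (Φ : ℝ × ℝ × ℝ → ℝ) (R : ℝ × ℝ × ℝ) : ℝ × ℝ :=
  (fderiv ℝ Φ R (1, 0, 0) - 1, fderiv ℝ Φ R (0, 1, 0) - 1)

/-- The derivative of the potential transversally to the fibre. -/
noncomputable def height (Φ : ℝ × ℝ × ℝ → ℝ) (R : ℝ × ℝ × ℝ) : ℝ := fderiv ℝ Φ R (0, 0, 1)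

/-- The determinant of the second derivative along the fibre. -/
noncomputable def hessDet (Φ : ℝ × ℝ × ℝ → ℝ) (R : ℝ × ℝ × ℝ) : ℝ :=
  fderiv ℝ (fderiv ℝ Φ) R (1, 0, 0) (1, 0, 0) * fderiv ℝ (fderiv ℝ Φ) R (0, 1, 0) (0, 1, 0) -
    fderiv ℝ (fderiv ℝ Φ) R (0, 1, 0) (1, 0, 0) * fderiv ℝ (fderiv ℝ Φ) R (1, 0, 0) (0, 1, 0)

/-- The numbers `σ` for which `(σ₁, σ₂, 1)` is orthogonal to the fibre with respect to the second
derivative. -/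
noncomputable def twist (Φ : ℝ × ℝ × ℝ → ℝ) (R : ℝ × ℝ × ℝ) : ℝ × ℝ :=
  ((fderiv ℝ (fderiv ℝ Φ) R (0, 0, 1) (0, 1, 0) * fderiv ℝ (fderiv ℝ Φ) R (0, 1, 0) (1, 0, 0) -
      fderiv ℝ (fderiv ℝ Φ) R (0, 0, 1) (1, 0, 0) * fderiv ℝ (fderiv ℝ Φ) R (0, 1, 0) (0, 1, 0)) /
        hessDet Φ R,
    (fderiv ℝ (fderiv ℝ Φ) R (0, 0, 1) (1, 0, 0) * fderiv ℝ (fderiv ℝ Φ) R (1, 0, 0) (0, 1, 0) -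
      fderiv ℝ (fderiv ℝ Φ) R (0, 0, 1) (0, 1, 0) * fderiv ℝ (fderiv ℝ Φ) R (1, 0, 0) (1, 0, 0)) /
        hessDet Φ R)

theorem triple_eq_smul (a b s : ℝ) : ((a, b, s) : ℝ × ℝ × ℝ) =
    a • ((1, 0, 0) : ℝ × ℝ × ℝ) + b • ((0, 1, 0) : ℝ × ℝ × ℝ) + s • ((0, 0, 1) : ℝ × ℝ × ℝ) := by
  simp

theorem clm_triple (ℓ : (ℝ × ℝ × ℝ) →L[ℝ] ℝ) (a b s : ℝ) :
    ℓ (a, b, s) = a * ℓ (1, 0, 0) + b * ℓ (0, 1, 0) + s * ℓ (0, 0, 1) := by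
  rw [triple_eq_smul, map_add, map_add, map_smul, map_smul, map_smul]
  rfl

theorem clm₂_triple (B : (ℝ × ℝ × ℝ) →L[ℝ] (ℝ × ℝ × ℝ) →L[ℝ] ℝ) (a b s : ℝ) (w : ℝ × ℝ × ℝ) :
    B (a, b, s) w = a * B (1, 0, 0) w + b * B (0, 1, 0) w + s * B (0, 0, 1) w := by
  rw [triple_eq_smul, map_add, map_add, map_smul, map_smul, map_smul]
  rfl

theorem clm₂_pair (B : (ℝ × ℝ × ℝ) →L[ℝ] (ℝ × ℝ × ℝ) →L[ℝ] ℝ) (a b : ℝ) :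
    B (a, b, 0) (a, b, 0) = a * (a * B (1, 0, 0) (1, 0, 0) + b * B (1, 0, 0) (0, 1, 0)) +
      b * (a * B (0, 1, 0) (1, 0, 0) + b * B (0, 1, 0) (0, 1, 0)) := by
  rw [clm₂_triple, clm_triple (B (1, 0, 0)), clm_triple (B (0, 1, 0))]
  ring

namespace IsPotential

variable {Φ : ℝ × ℝ × ℝ → ℝ} {S : ℝ}

theorem symm (h : IsPotential Φ S) {R : ℝ × ℝ × ℝ} (hR : R.2.2 = S) (v w : ℝ × ℝ × ℝ) :
    fderiv ℝ (fderiv ℝ Φ) R v w = fderiv ℝ (fderiv ℝ Φ) R w v :=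
  ((h.smooth R hR).isSymmSndFDerivAt (by simp; norm_cast)) v w

theorem hessDet_pos (h : IsPotential Φ S) {R : ℝ × ℝ × ℝ} (hR : R.2.2 = S) : 0 < hessDet Φ R := by
  have h1 := h.pos R hR (1, 0, 0) rfl (by simp)
  have h3 := h.symm hR (0, 1, 0) (1, 0, 0)
  -- On the vector $(-B_{12},B_{11},0)$ the Hessian $B$ takes the value $B_{11}\det$.
  have h2 := h.pos R hR (-fderiv ℝ (fderiv ℝ Φ) R (1, 0, 0) (0, 1, 0),
    fderiv ℝ (fderiv ℝ Φ) R (1, 0, 0) (1, 0, 0), 0) rfl (by simp [h1.ne'])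
  unfold hessDet
  generalize fderiv ℝ (fderiv ℝ Φ) R = B at *
  rw [clm₂_pair, h3] at h2
  rw [h3]
  have : 0 < B (1, 0, 0) (1, 0, 0) * (B (1, 0, 0) (1, 0, 0) * B (0, 1, 0) (0, 1, 0) -
      B (1, 0, 0) (0, 1, 0) * B (1, 0, 0) (0, 1, 0)) := by linarith
  exact pos_of_mul_pos_right this h1.le

/-- A fibre direction orthogonal to the fibre vanishes. -/
theorem eq_zero_of_orthogonal (h : IsPotential Φ S) {R : ℝ × ℝ × ℝ} (hR : R.2.2 = S)
    {w : ℝ × ℝ × ℝ} (hw : w.2.2 = 0)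
    (h0 : ∀ v : ℝ × ℝ × ℝ, v.2.2 = 0 → fderiv ℝ (fderiv ℝ Φ) R w v = 0) : w = 0 := by
  by_contra h1
  exact (h.pos R hR w hw h1).ne' (h0 w hw)

theorem twist_orthogonal (h : IsPotential Φ S) {R : ℝ × ℝ × ℝ} (hR : R.2.2 = S) {w : ℝ × ℝ × ℝ}
    (hw : w.2.2 = 0) :
    fderiv ℝ (fderiv ℝ Φ) R ((twist Φ R).1, (twist Φ R).2, 1) w = 0 := by
  have hd := (h.hessDet_pos hR).ne'
  obtain ⟨a, b, s⟩ := w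
  obtain rfl : s = 0 := hw
  have h3 := h.symm hR (0, 1, 0) (1, 0, 0)
  have e : hessDet Φ R = fderiv ℝ (fderiv ℝ Φ) R (1, 0, 0) (1, 0, 0) *
      fderiv ℝ (fderiv ℝ Φ) R (0, 1, 0) (0, 1, 0) - fderiv ℝ (fderiv ℝ Φ) R (0, 1, 0) (1, 0, 0) *
      fderiv ℝ (fderiv ℝ Φ) R (1, 0, 0) (0, 1, 0) := rfl
  unfold twist
  generalize fderiv ℝ (fderiv ℝ Φ) R = B at *
  generalize hessDet Φ R = D at *
  rw [clm₂_triple B _ _ 1, clm_triple (B (1, 0, 0)) a b 0, clm_triple (B (0, 1, 0)) a b 0,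
    clm_triple (B (0, 0, 1)) a b 0]
  rw [h3] at *
  field_simp
  rw [e]
  ring

/-- Positivity on the fibre makes the orthogonal lift unique. This identifies both the velocity of
horizontal lifts and the behaviour under deck transformations. -/
theorem twist_eq (h : IsPotential Φ S) {R : ℝ × ℝ × ℝ} (hR : R.2.2 = S) {s : ℝ × ℝ}
    (h0 : ∀ v : ℝ × ℝ × ℝ, v.2.2 = 0 → fderiv ℝ (fderiv ℝ Φ) R (s.1, s.2, 1) v = 0) :
    s = twist Φ R := by
  have h1 := h.eq_zero_of_orthogonal hR (w := (s.1, s.2, 1) - ((twist Φ R).1, (twist Φ R).2, 1))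
    (by simp) (fun v hv => by
      rw [map_sub, sub_apply, h0 v hv, h.twist_orthogonal hR hv, sub_zero])
  rw [sub_eq_zero] at h1
  simp only [Prod.mk.injEq] at h1
  exact Prod.ext h1.1 h1.2.1

/-! ### Smoothness -/

theorem contDiffAt_fderiv (h : IsPotential Φ S) {R : ℝ × ℝ × ℝ} (hR : R.2.2 = S)
    (v : ℝ × ℝ × ℝ) : ContDiffAt ℝ ∞ (fun R => fderiv ℝ Φ R v) R :=
  ((h.smooth R hR).fderiv_right (m := ∞) (by simp)).clm_apply contDiffAt_const

theorem contDiffAt_fderiv_fderiv (h : IsPotential Φ S) {R : ℝ × ℝ × ℝ} (hR : R.2.2 = S)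
    (v w : ℝ × ℝ × ℝ) : ContDiffAt ℝ ∞ (fun R => fderiv ℝ (fderiv ℝ Φ) R v w) R :=
  ((((h.smooth R hR).fderiv_right (m := ∞) (by simp)).fderiv_right (m := ∞) (by simp)).clm_apply
    contDiffAt_const).clm_apply contDiffAt_const

theorem contDiffAt_moment (h : IsPotential Φ S) {R : ℝ × ℝ × ℝ} (hR : R.2.2 = S) :
    ContDiffAt ℝ ∞ (moment Φ) R :=
  ((h.contDiffAt_fderiv hR _).sub contDiffAt_const).prodMk
    ((h.contDiffAt_fderiv hR _).sub contDiffAt_const)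

theorem contDiffAt_height (h : IsPotential Φ S) {R : ℝ × ℝ × ℝ} (hR : R.2.2 = S) :
    ContDiffAt ℝ ∞ (height Φ) R :=
  h.contDiffAt_fderiv hR _

theorem contDiffAt_twist (h : IsPotential Φ S) {R : ℝ × ℝ × ℝ} (hR : R.2.2 = S) :
    ContDiffAt ℝ ∞ (twist Φ) R := by
  have k := fun v w => h.contDiffAt_fderiv_fderiv hR v w
  have hd : ContDiffAt ℝ ∞ (hessDet Φ) R := ((k _ _).mul (k _ _)).sub ((k _ _).mul (k _ _))
  exact ((((k _ _).mul (k _ _)).sub ((k _ _).mul (k _ _))).div hd (h.hessDet_pos hR).ne').prodMk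
    ((((k _ _).mul (k _ _)).sub ((k _ _).mul (k _ _))).div hd (h.hessDet_pos hR).ne')

theorem fderiv_fderiv_apply (h : IsPotential Φ S) {R : ℝ × ℝ × ℝ} (hR : R.2.2 = S)
    (v w : ℝ × ℝ × ℝ) :
    fderiv ℝ (fun R => fderiv ℝ Φ R v) R w = fderiv ℝ (fderiv ℝ Φ) R w v := by
  have h1 : DifferentiableAt ℝ (fderiv ℝ Φ) R :=
    ((h.smooth R hR).fderiv_right (m := ∞) (by simp)).differentiableAt (by simp)
  rw [fderiv_clm_apply h1 (differentiableAt_const v)]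
  simp

theorem fderiv_moment (h : IsPotential Φ S) {R : ℝ × ℝ × ℝ} (hR : R.2.2 = S) (w : ℝ × ℝ × ℝ) :
    fderiv ℝ (moment Φ) R w =
      (fderiv ℝ (fderiv ℝ Φ) R w (1, 0, 0), fderiv ℝ (fderiv ℝ Φ) R w (0, 1, 0)) := by
  have k := fun v => (h.contDiffAt_fderiv hR v).differentiableAt (by simp)
  have e := DifferentiableAt.fderiv_prodMk ((k (1, 0, 0)).sub_const 1) ((k (0, 1, 0)).sub_const 1)
  have e2 : fderiv ℝ (moment Φ) R = _ := e
  rw [e2, ContinuousLinearMap.prod_apply, fderiv_sub_const, fderiv_sub_const,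
    h.fderiv_fderiv_apply hR, h.fderiv_fderiv_apply hR]

/-! ### The Hamiltonian -/

/-- The Hamiltonian `⟨ξ, λ ξ⟩ / 2 - ∂Φ/∂S`. -/
noncomputable def _root_.BananaMirror.hamiltonian (Φ : ℝ × ℝ × ℝ → ℝ) (R : ℝ × ℝ × ℝ) : ℝ :=
  1 / 3 * ((moment Φ R).1 ^ 2 - (moment Φ R).1 * (moment Φ R).2 + (moment Φ R).2 ^ 2) - height Φ R

/-- The rotation numbers `-σ - λ ξ` of the flow of the Hamiltonian. -/
noncomputable def _root_.BananaMirror.rotation (Φ : ℝ × ℝ × ℝ → ℝ) (R : ℝ × ℝ × ℝ) : ℝ × ℝ :=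
  -(twist Φ R + lam (moment Φ R))

theorem contDiffAt_hamiltonian (h : IsPotential Φ S) {R : ℝ × ℝ × ℝ} (hR : R.2.2 = S) :
    ContDiffAt ℝ ∞ (hamiltonian Φ) R := by
  have h1 : ContDiffAt ℝ ∞ (fun R => (moment Φ R).1) R := (h.contDiffAt_moment hR).fst
  have h2 : ContDiffAt ℝ ∞ (fun R => (moment Φ R).2) R := (h.contDiffAt_moment hR).snd
  exact (contDiffAt_const.mul (((h1.pow 2).sub (h1.mul h2)).add (h2.pow 2))).sub
    (h.contDiffAt_height hR)

theorem contDiffAt_rotation (h : IsPotential Φ S) {R : ℝ × ℝ × ℝ} (hR : R.2.2 = S) :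
    ContDiffAt ℝ ∞ (rotation Φ) R := by
  have h1 : ContDiffAt ℝ ∞ (fun R => (moment Φ R).1) R := (h.contDiffAt_moment hR).fst
  have h2 : ContDiffAt ℝ ∞ (fun R => (moment Φ R).2) R := (h.contDiffAt_moment hR).snd
  have h3 : ContDiffAt ℝ ∞ (fun R => lam (moment Φ R)) R := by
    unfold lam
    fun_prop
  exact ((h.contDiffAt_twist hR).add h3).neg

/-- Since $(\sigma,1)$ is orthogonal to the fibre, $d\Phi_S=-\langle\sigma,d\xi\rangle$ there; since
$\lambda$ is symmetric, $d\,\frac12\langle\xi,\lambda\xi\rangle=\langle\lambda\xi,d\xi\rangle$.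
Together $dH=\langle\sigma+\lambda\xi,d\xi\rangle$, and $d\xi$ is the Hessian. -/
theorem fderiv_hamiltonian (h : IsPotential Φ S) {R : ℝ × ℝ × ℝ} (hR : R.2.2 = S)
    {w : ℝ × ℝ × ℝ} (hw : w.2.2 = 0) :
    fderiv ℝ (hamiltonian Φ) R w =
      -fderiv ℝ (fderiv ℝ Φ) R ((rotation Φ R).1, (rotation Φ R).2, 0) w := by
  have hm := ((h.contDiffAt_moment hR).differentiableAt (by simp)).hasFDerivAt
  have h1 : HasFDerivAt (fun R => (moment Φ R).1) _ R := hm.fst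
  have h2 : HasFDerivAt (fun R => (moment Φ R).2) _ R := hm.snd
  have h3 := ((h.contDiffAt_height hR).differentiableAt (by simp)).hasFDerivAt
  have h4 : HasFDerivAt (hamiltonian Φ) _ R :=
    ((((h1.pow 2).sub (h1.mul h2)).add (h2.pow 2)).const_mul (1 / 3)).sub h3
  have e3 : fderiv ℝ (height Φ) R w = fderiv ℝ (fderiv ℝ Φ) R w (0, 0, 1) :=
    h.fderiv_fderiv_apply hR _ w
  have e := h.fderiv_moment hR w
  rw [h4.fderiv]
  simp only [sub_apply, add_apply, smul_apply, ContinuousLinearMap.comp_apply,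
    ContinuousLinearMap.coe_fst', ContinuousLinearMap.coe_snd', smul_eq_mul, e, e3]
  have h5 := h.twist_orthogonal hR hw
  rw [clm₂_triple] at h5
  rw [clm₂_triple _ (rotation Φ R).1, h.symm hR w (1, 0, 0), h.symm hR w (0, 1, 0),
    h.symm hR w (0, 0, 1)]
  simp only [rotation, lam, Prod.fst_neg, Prod.snd_neg, Prod.fst_add, Prod.snd_add]
  norm_num
  linarith

/-! ### Deck transformations -/

theorem fderiv_deck (h : IsPotential Φ S) {R : ℝ × ℝ × ℝ} (hR : R.2.2 = S) (i j : ℤ)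
    (w : ℝ × ℝ × ℝ) :
    fderiv ℝ Φ (deckLog i j R) (deckLog i j w) = fderiv ℝ Φ R w + deckShift i j w ∧
    ∀ v, fderiv ℝ (fderiv ℝ Φ) (deckLog i j R) (deckLog i j v) (deckLog i j w) =
      fderiv ℝ (fderiv ℝ Φ) R v w := by
  let L : (ℝ × ℝ × ℝ) →L[ℝ] ℝ × ℝ × ℝ :=
    (coordU + (i : ℝ) • coordS).prod ((coordV + (j : ℝ) • coordS).prod coordS)
  have hL : ∀ v, deckLog i j v = L v := fun v => rfl
  let ℓ : (ℝ × ℝ × ℝ) →L[ℝ] ℝ := (-(2 * i + j) : ℝ) • coordU - (i + 2 * j : ℝ) • coordV +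
    (i + j - (i ^ 2 + i * j + j ^ 2) : ℝ) • coordS
  have s1 := h.smooth R hR
  have s2 : ContDiffAt ℝ ∞ Φ (L R) := h.smooth (deckLog i j R) hR
  have hℓ : ∀ v, deckShift i j v = ℓ v := fun v => rfl
  have e : (fun R => Φ (L R)) =ᶠ[𝓝 R] fun R => Φ R + ℓ R := by
    have h1 : ∀ᶠ R' : ℝ × ℝ × ℝ in 𝓝 R, R'.2.2 ≠ 0 :=
      ContinuousAt.eventually_ne (by fun_prop) (by rw [hR]; exact h.ne_zero)
    filter_upwards [h1] with R' hR'
    rw [← hL, h.deck i j R' hR', hℓ]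
  simp only [hL, hℓ]
  constructor
  · have e1 := e.fderiv_eq (𝕜 := ℝ)
    rw [fderiv_fun_add (s1.differentiableAt (by simp)) ℓ.differentiableAt, ℓ.fderiv] at e1
    have e2 : HasFDerivAt (fun R => Φ (L R)) _ R :=
      ((s2.differentiableAt (by simp)).hasFDerivAt).comp R L.hasFDerivAt
    rw [e2.fderiv] at e1
    exact DFunLike.congr_fun e1 w
  · intro v
    rw [← fderiv_fderiv_comp_clm L (s2.of_le (by norm_cast)), e.fderiv.fderiv_eq,
      fderiv_fderiv_add (s1.of_le (by norm_cast)) ℓ.contDiff.contDiffAt, fderiv_fderiv_clm,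
      add_zero]

/-- The shift is $(i,j)$ multiplied by the inverse of $\lambda$, so $\lambda\xi$ changes by exactly
$-(i,j)$. -/
theorem moment_deck (h : IsPotential Φ S) {R : ℝ × ℝ × ℝ} (hR : R.2.2 = S) (i j : ℤ) :
    moment Φ (deckLog i j R) = moment Φ R - ((2 * i + j : ℝ), (i + 2 * j : ℝ)) := by
  have h1 := (h.fderiv_deck hR i j (1, 0, 0)).1
  have h2 := (h.fderiv_deck hR i j (0, 1, 0)).1
  simp only [deckLog, deckShift, mul_zero, mul_one, add_zero, sub_zero, zero_sub] at h1 h2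
  simp only [moment, deckLog, h1, h2, Prod.mk_sub_mk, Prod.mk.injEq]
  constructor <;> ring

theorem height_deck (h : IsPotential Φ S) {R : ℝ × ℝ × ℝ} (hR : R.2.2 = S) (i j : ℤ) :
    height Φ (deckLog i j R) = height Φ R + (i ^ 2 + i * j + j ^ 2) - i * (moment Φ R).1 -
      j * (moment Φ R).2 := by
  have h0 := h.moment_deck hR i j
  have h3 := (h.fderiv_deck hR i j (0, 0, 1)).1
  -- Deck transformations are shears in $S$, so the transverse derivative mixes with $\xi$; this is
  -- what makes the height quasi-periodic with a quadratic term.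
  have e : deckLog i j (0, 0, 1) = ((i : ℝ), (j : ℝ), (1 : ℝ)) := by simp [deckLog]
  rw [e, clm_triple] at h3
  simp only [deckShift] at h3
  have h1 := congrArg Prod.fst h0
  have h2 := congrArg Prod.snd h0
  simp only [moment, Prod.mk_sub_mk] at h1 h2
  simp only [height, moment]
  have h1' : fderiv ℝ Φ (deckLog i j R) (1, 0, 0) = fderiv ℝ Φ R (1, 0, 0) - (2 * i + j) := by
    linarith
  have h2' : fderiv ℝ Φ (deckLog i j R) (0, 1, 0) = fderiv ℝ Φ R (0, 1, 0) - (i + 2 * j) := by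
    linarith
  rw [h1', h2'] at h3
  linarith

/-- The shear preserves the Hessian and the fibre directions and maps $(\sigma,1)$ to
$(\sigma+(i,j),1)$; uniqueness of the orthogonal lift does the rest. -/
theorem twist_deck (h : IsPotential Φ S) {R : ℝ × ℝ × ℝ} (hR : R.2.2 = S) (i j : ℤ) :
    twist Φ (deckLog i j R) = twist Φ R + ((i : ℝ), (j : ℝ)) := by
  refine (h.twist_eq (R := deckLog i j R) hR ?_).symm
  rintro ⟨a, b, s⟩ hs
  obtain rfl : s = 0 := hs
  have h1 := (h.fderiv_deck hR i j (a, b, 0)).2 ((twist Φ R).1, (twist Φ R).2, 1)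
  rw [h.twist_orthogonal hR rfl] at h1
  simpa [deckLog] using h1

/-- Both $\frac12\langle\xi,\lambda\xi\rangle$ and $\Phi_S$ change by $i^2+ij+j^2-i\xi_1-j\xi_2$. -/
theorem hamiltonian_deck (h : IsPotential Φ S) {R : ℝ × ℝ × ℝ} (hR : R.2.2 = S) (i j : ℤ) :
    hamiltonian Φ (deckLog i j R) = hamiltonian Φ R := by
  unfold hamiltonian
  rw [h.moment_deck hR, h.height_deck hR]
  simp only [Prod.fst_sub, Prod.snd_sub]
  ring

theorem rotation_deck (h : IsPotential Φ S) {R : ℝ × ℝ × ℝ} (hR : R.2.2 = S) (i j : ℤ) :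
    rotation Φ (deckLog i j R) = rotation Φ R := by
  unfold rotation lam
  rw [h.moment_deck hR, h.twist_deck hR]
  ext <;> simp <;> ring

end IsPotential

/-! ### The fibre, its action coordinates and parallel transport in terms of the potential. -/

/-! ### The fibre in logarithmic coordinates -/

theorem isOpen_torusDomain : IsOpen torusDomain :=
  (isOpen_ne_fun continuous_fst continuous_const).inter
    (isOpen_ne_fun continuous_snd continuous_const)

theorem isPreconnected_torusDomain : IsPreconnected torusDomain := by
  have h : IsPreconnected ({0}ᶜ : Set ℂ) :=
    (isConnected_compl_singleton_of_one_lt_rank (by simp) 0).isPreconnected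
  exact h.prod h

/-- `logs` on the fibre on which `log |T³v₀|² = S`. -/
noncomputable def fiberLogs (T S : ℝ) (q : ℂ × ℂ) : ℝ × ℝ × ℝ :=
  (2 * Real.log (T * ‖q.1‖), 2 * Real.log (T * ‖q.2‖), S)

/-- The derivative of `fiberLogs`. -/
noncomputable def fiberLogsDeriv (q u : ℂ × ℂ) : ℝ × ℝ × ℝ :=
  (2 * (u.1 / q.1).re, 2 * (u.2 / q.2).re, 0)

theorem contDiffAt_fiberLogs {T : ℝ} (hT : 0 < T) (S : ℝ) {q : ℂ × ℂ} (h : q ∈ torusDomain) :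
    ContDiffAt ℝ ∞ (fiberLogs T S) q := by
  have h1 := contDiffAt_log_norm hT (f := fun q : ℂ × ℂ => q.1) (p := q) (by fun_prop) h.1
  have h2 := contDiffAt_log_norm hT (f := fun q : ℂ × ℂ => q.2) (p := q) (by fun_prop) h.2
  exact h1.prodMk (h2.prodMk contDiffAt_const)

theorem hasDerivAt_line {E : Type*} [NormedAddCommGroup E] [NormedSpace ℝ E] (q u : E) :
    HasDerivAt (fun t : ℝ => q + t • u) u 0 := by
  simpa using ((hasDerivAt_id (0 : ℝ)).smul_const u).const_add q

theorem fderiv_eq_of_line {E F : Type*} [NormedAddCommGroup E] [NormedSpace ℝ E]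
    [NormedAddCommGroup F] [NormedSpace ℝ F] {f : E → F} {q u : E} {f' : F}
    (h : DifferentiableAt ℝ f q) (hf : HasDerivAt (fun t : ℝ => f (q + t • u)) f' 0) :
    fderiv ℝ f q u = f' := by
  have h2 : HasFDerivAt f (fderiv ℝ f q) (q + (0 : ℝ) • u) := by simpa using h.hasFDerivAt
  have h3 : HasDerivAt (fun t : ℝ => f (q + t • u)) (fderiv ℝ f q u) 0 :=
    h2.comp_hasDerivAt (0 : ℝ) (hasDerivAt_line q u)
  exact h3.unique hf

theorem fderiv_fiberLogs {T : ℝ} (hT : 0 < T) (S : ℝ) {q : ℂ × ℂ} (h : q ∈ torusDomain)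
    (u : ℂ × ℂ) : fderiv ℝ (fiberLogs T S) q u = fiberLogsDeriv q u := by
  refine fderiv_eq_of_line ((contDiffAt_fiberLogs hT S h).differentiableAt (by simp)) ?_
  have h1 := hasDerivWithinAt_log_norm hT
    ((hasDerivAt_line q.1 u.1).hasDerivWithinAt (s := Set.univ)) (by simpa using h.1)
  have h2 := hasDerivWithinAt_log_norm hT
    ((hasDerivAt_line q.2 u.2).hasDerivWithinAt (s := Set.univ)) (by simpa using h.2)
  rw [hasDerivWithinAt_univ] at h1 h2
  simpa [fiberLogs, fiberLogsDeriv] using h1.prodMk (h2.prodMk (hasDerivAt_const (0 : ℝ) S))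

theorem nonzero_fiberIncl {r : ℝ} (hr : 0 < r) {q : ℂ × ℂ} (h : q ∈ torusDomain) :
    Nonzero (fiberIncl r q) :=
  ⟨h.1, h.2, div_ne_zero (by simpa using hr.ne') (mul_ne_zero h.1 h.2)⟩

theorem v₀_fiberIncl (r : ℝ) {q : ℂ × ℂ} (h : q ∈ torusDomain) : v₀ (fiberIncl r q) = r := by
  have h1 := h.1
  have h2 := h.2
  simp only [v₀, fiberIncl]
  field_simp

theorem logs_fiberIncl {T r S : ℝ} (hT : 0 < T) (hr : 0 < r) (hS : 2 * Real.log (T ^ 3 * r) = S)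
    {q : ℂ × ℂ} (h : q ∈ torusDomain) : logs T (fiberIncl r q) = fiberLogs T S q := by
  have h1 := log_scaled_v₀ hT (nonzero_fiberIncl hr h)
  rw [v₀_fiberIncl r h, Complex.norm_of_nonneg hr.le, hS] at h1
  exact Prod.ext rfl (Prod.ext rfl h1.symm)

theorem fderiv_fiberIncl (r : ℝ) {q : ℂ × ℂ} (h : q ∈ torusDomain) (u : ℂ × ℂ) :
    fderiv ℝ (fiberIncl r) q u =
      (u.1, u.2, -(r * (u.1 * q.2 + q.1 * u.2)) / (q.1 * q.2) ^ 2) := by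
  have hx : q.1 * q.2 ≠ 0 := mul_ne_zero h.1 h.2
  have hd : DifferentiableAt ℝ (fiberIncl r) q := by
    have h3 : DifferentiableAt ℝ (fun q : ℂ × ℂ => (r : ℂ) / (q.1 * q.2)) q := by
      simp only [div_eq_mul_inv]
      exact (differentiableAt_const _).mul (DifferentiableAt.inv (by fun_prop) hx)
    exact DifferentiableAt.prodMk (by fun_prop) (DifferentiableAt.prodMk (by fun_prop) h3)
  refine fderiv_eq_of_line hd ?_
  have h1 := hasDerivAt_line q.1 u.1
  have h2 := hasDerivAt_line q.2 u.2
  have h3 := (hasDerivAt_const (0 : ℝ) (r : ℂ)).div (h1.mul h2) (by simpa using hx)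
  refine (h1.prodMk (h2.prodMk h3)).congr_deriv ?_
  simp

theorem logsDeriv_fiberIncl {r : ℝ} (hr : 0 < r) {q : ℂ × ℂ} (h : q ∈ torusDomain) (u : ℂ × ℂ) :
    logsDeriv (fiberIncl r q) (fderiv ℝ (fiberIncl r) q u) = fiberLogsDeriv q u := by
  have h1 := h.1
  have h2 := h.2
  have hr' : (r : ℂ) ≠ 0 := by simpa using hr.ne'
  rw [fderiv_fiberIncl r h]
  simp only [logsDeriv, fiberIncl, fiberLogsDeriv, Prod.mk.injEq, true_and]
  have e : -((r : ℂ) * (u.1 * q.2 + q.1 * u.2)) / (q.1 * q.2) ^ 2 / (r / (q.1 * q.2)) =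
      -(u.1 / q.1 + u.2 / q.2) := by
    field_simp
  rw [e, Complex.neg_re, Complex.add_re]
  ring

theorem logsDeriv_I_fiberIncl {r : ℝ} (hr : 0 < r) {q : ℂ × ℂ} (h : q ∈ torusDomain)
    (u : ℂ × ℂ) : logsDeriv (fiberIncl r q) (Complex.I • fderiv ℝ (fiberIncl r) q u) =
      fiberLogsDeriv q (Complex.I • u) := by
  rw [← logsDeriv_fiberIncl hr h, fderiv_fiberIncl r h, fderiv_fiberIncl r h]
  congr 1
  simp only [Prod.smul_mk, smul_eq_mul, Prod.smul_fst, Prod.smul_snd, Prod.mk.injEq, true_and]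
  ring

/-- The form `ω` near the fibre over `r` is `(i/2π) ∂∂̄` of the quasi-periodic potential `Φ`. -/
structure IsModel (b : Bumps) (T K r : ℝ) (Φ : ℝ × ℝ × ℝ → ℝ) (S : ℝ) : Prop
    extends IsPotential Φ S where
  hT : 0 < T
  hr : 0 < r
  hS : 2 * Real.log (T ^ 3 * r) = S
  omega_eq : ∀ q, Nonzero q → (logs T q).2.2 = S → ∀ u w,
    omega b T K q u w = 1 / (4 * Real.pi) *
      (fderiv ℝ (fderiv ℝ Φ) (logs T q) (logsDeriv q (Complex.I • u)) (logsDeriv q w) -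
        fderiv ℝ (fderiv ℝ Φ) (logs T q) (logsDeriv q u) (logsDeriv q (Complex.I • w)))

namespace IsModel

variable {b : Bumps} {T K r S : ℝ} {Φ : ℝ × ℝ × ℝ → ℝ}

theorem fiberForm_eq (h : IsModel b T K r Φ S) {q : ℂ × ℂ} (hq : q ∈ torusDomain) (u w : ℂ × ℂ) :
    fiberForm b T K r q u w = 1 / (4 * Real.pi) *
      (fderiv ℝ (fderiv ℝ Φ) (fiberLogs T S q) (fiberLogsDeriv q (Complex.I • u))
          (fiberLogsDeriv q w) -
        fderiv ℝ (fderiv ℝ Φ) (fiberLogs T S q) (fiberLogsDeriv q u)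
          (fiberLogsDeriv q (Complex.I • w))) := by
  have e := logs_fiberIncl h.hT h.hr h.hS hq
  unfold fiberForm
  rw [h.omega_eq _ (nonzero_fiberIncl h.hr hq) (by rw [e]; rfl), e, logsDeriv_fiberIncl h.hr hq,
    logsDeriv_fiberIncl h.hr hq, logsDeriv_I_fiberIncl h.hr hq, logsDeriv_I_fiberIncl h.hr hq]

/-- Rotations keep the norms and multiplication by $i$ turns them into radial motions. One of the
two Hessian terms of the form therefore vanishes when a slot is filled with a rotation. -/
theorem _root_.BananaMirror.fiberLogsDeriv_rotation {q : ℂ × ℂ} (hq : q ∈ torusDomain)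
    (s : ℝ × ℝ) :
    fiberLogsDeriv q (2 * Real.pi * Complex.I * s.1 * q.1, 2 * Real.pi * Complex.I * s.2 * q.2) =
        0 ∧
      fiberLogsDeriv q (Complex.I • (2 * Real.pi * Complex.I * s.1 * q.1,
        2 * Real.pi * Complex.I * s.2 * q.2)) = (-(4 * Real.pi)) • (s.1, s.2, 0) := by
  have e1 : ∀ (a : ℝ) (x : ℂ), x ≠ 0 →
      2 * Real.pi * Complex.I * a * x / x = ((2 * Real.pi * a : ℝ) : ℂ) * Complex.I := by
    intro a x hx
    rw [mul_div_cancel_right₀ _ hx]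
    push_cast
    ring
  have e2 : ∀ (a : ℝ) (x : ℂ), x ≠ 0 →
      Complex.I * (2 * Real.pi * Complex.I * a * x) / x = ((-(2 * Real.pi * a) : ℝ) : ℂ) := by
    intro a x hx
    rw [mul_div_assoc, e1 a x hx, mul_left_comm, Complex.I_mul_I]
    push_cast
    ring
  simp only [fiberLogsDeriv, Prod.smul_mk, smul_eq_mul, e1 _ _ hq.1, e1 _ _ hq.2, e2 _ _ hq.1,
    e2 _ _ hq.2, Complex.ofReal_re, Complex.re_ofReal_mul, Complex.I_re]
  constructor
  · simp
  · simp only [Prod.mk.injEq, mul_zero, and_true]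
    constructor <;> ring

/-- Contraction of the form on the fibre with the velocity of a rotation. -/
theorem fiberForm_rotation (h : IsModel b T K r Φ S) {q : ℂ × ℂ} (hq : q ∈ torusDomain)
    (s : ℝ × ℝ) (w : ℂ × ℂ) :
    fiberForm b T K r q (2 * Real.pi * Complex.I * s.1 * q.1, 2 * Real.pi * Complex.I * s.2 * q.2)
        w =
      -fderiv ℝ (fderiv ℝ Φ) (fiberLogs T S q) (s.1, s.2, 0) (fiberLogsDeriv q w) := by
  have hpi := Real.pi_ne_zero
  rw [h.fiberForm_eq hq, (fiberLogsDeriv_rotation hq s).1, (fiberLogsDeriv_rotation hq s).2,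
    map_zero, map_smul, smul_apply, zero_apply, smul_eq_mul]
  field_simp
  ring

theorem fiberForm_rotation_right (h : IsModel b T K r Φ S) {q : ℂ × ℂ} (hq : q ∈ torusDomain)
    (s : ℝ × ℝ) (u : ℂ × ℂ) :
    fiberForm b T K r q u
        (2 * Real.pi * Complex.I * s.1 * q.1, 2 * Real.pi * Complex.I * s.2 * q.2) =
      fderiv ℝ (fderiv ℝ Φ) (fiberLogs T S q) (fiberLogsDeriv q u) (s.1, s.2, 0) := by
  have hpi := Real.pi_ne_zero
  rw [h.fiberForm_eq hq, (fiberLogsDeriv_rotation hq s).1, (fiberLogsDeriv_rotation hq s).2,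
    map_zero, map_smul, smul_eq_mul]
  field_simp
  ring

/-! ### Action coordinates -/

theorem fderiv_comp_fiberLogs (h : IsModel b T K r Φ S) {E : Type*} [NormedAddCommGroup E]
    [NormedSpace ℝ E] {f : ℝ × ℝ × ℝ → E} {q : ℂ × ℂ} (hq : q ∈ torusDomain)
    (hf : DifferentiableAt ℝ f (fiberLogs T S q)) (u : ℂ × ℂ) :
    DifferentiableAt ℝ (fun q => f (fiberLogs T S q)) q ∧
    fderiv ℝ (fun q => f (fiberLogs T S q)) q u =
      fderiv ℝ f (fiberLogs T S q) (fiberLogsDeriv q u) := by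
  have h1 : DifferentiableAt ℝ (fiberLogs T S) q :=
    (contDiffAt_fiberLogs h.hT S hq).differentiableAt (by simp)
  have h2 : HasFDerivAt (fun q => f (fiberLogs T S q)) _ q := hf.hasFDerivAt.comp q h1.hasFDerivAt
  refine ⟨h2.differentiableAt, ?_⟩
  rw [h2.fderiv, ContinuousLinearMap.comp_apply, fderiv_fiberLogs h.hT S hq]

theorem isActionCoord_moment (h : IsModel b T K r Φ S) :
    IsActionCoord b T K r fun q => moment Φ (fiberLogs T S q) := by
  have hm : ∀ q, DifferentiableAt ℝ (moment Φ) (fiberLogs T S q) := fun q =>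
    (h.contDiffAt_moment (R := fiberLogs T S q) rfl).differentiableAt (by simp)
  refine ⟨fun q hq => ⟨(h.fderiv_comp_fiberLogs hq (hm q) 0).1, fun u => ?_⟩, ?_⟩
  · rw [(h.fderiv_comp_fiberLogs hq (hm q) u).2, h.fderiv_moment rfl]
    have h1 := h.fiberForm_rotation_right hq (1, 0) u
    have h2 := h.fiberForm_rotation_right hq (0, 1) u
    simp only [Complex.ofReal_one, Complex.ofReal_zero, mul_one, mul_zero, zero_mul] at h1 h2
    rw [h1, h2]
  · have e : fiberLogs T S ((T : ℂ)⁻¹, (T : ℂ)⁻¹) = (0, 0, S) := by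
      have hT := h.hT
      have : T * ‖((T : ℂ)⁻¹)‖ = 1 := by
        rw [norm_inv, Complex.norm_of_nonneg hT.le, mul_inv_cancel₀ hT.ne']
      simp [fiberLogs, this, -norm_inv, -Complex.norm_real]
    simp only [e, moment, h.center.1, h.center.2, sub_self]
    rfl

/-- Two action coordinates have the same derivative and agree at the centre of the tile; the cover
is connected. -/
theorem eq_moment_of_isActionCoord (h : IsModel b T K r Φ S) {ξ : ℂ × ℂ → ℝ × ℝ}
    (hξ : IsActionCoord b T K r ξ) {q : ℂ × ℂ} (hq : q ∈ torusDomain) :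
    ξ q = moment Φ (fiberLogs T S q) := by
  have h0 := h.isActionCoord_moment
  have hT' : (T : ℂ)⁻¹ ≠ 0 := inv_ne_zero (by simpa using h.hT.ne')
  refine isOpen_torusDomain.eqOn_of_fderiv_eq (𝕜 := ℝ) isPreconnected_torusDomain
    (fun q hq => (hξ.1 q hq).1.differentiableWithinAt)
    (fun q hq => (h0.1 q hq).1.differentiableWithinAt) (fun q hq => ?_)
    (x := ((T : ℂ)⁻¹, (T : ℂ)⁻¹)) ⟨hT', hT'⟩ ?_ hq
  · refine ContinuousLinearMap.ext fun u => ?_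
    rw [(hξ.1 q hq).2 u, (h0.1 q hq).2 u]
  · exact hξ.2.trans h0.2.symm

end IsModel

/-! ### Rotations -/

/-- Rotation by the angles `2π s`. -/
noncomputable def rot (s : ℝ × ℝ) (q : ℂ × ℂ) : ℂ × ℂ :=
  (Complex.exp (2 * Real.pi * Complex.I * s.1) * q.1,
    Complex.exp (2 * Real.pi * Complex.I * s.2) * q.2)

theorem rot_mem (s : ℝ × ℝ) {q : ℂ × ℂ} (h : q ∈ torusDomain) : rot s q ∈ torusDomain :=
  ⟨mul_ne_zero (Complex.exp_ne_zero _) h.1, mul_ne_zero (Complex.exp_ne_zero _) h.2⟩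

theorem norm_exp_rotation (a : ℝ) : ‖Complex.exp (2 * Real.pi * Complex.I * a)‖ = 1 := by
  have e : 2 * Real.pi * Complex.I * a = ((2 * Real.pi * a : ℝ) : ℂ) * Complex.I := by
    push_cast; ring
  rw [e, Complex.norm_exp_ofReal_mul_I]

theorem fiberLogs_rot (T S : ℝ) (s : ℝ × ℝ) (q : ℂ × ℂ) :
    fiberLogs T S (rot s q) = fiberLogs T S q := by
  simp only [fiberLogs, rot, norm_mul, norm_exp_rotation, one_mul]

theorem rot_rot (s s' : ℝ × ℝ) (q : ℂ × ℂ) : rot s (rot s' q) = rot (s + s') q := by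
  simp only [rot, Prod.fst_add, Prod.snd_add, Complex.ofReal_add, mul_add, Complex.exp_add]
  ext <;> simp only <;> ring

theorem rot_zero (q : ℂ × ℂ) : rot 0 q = q := by
  simp [rot]

theorem rot_int (a b : ℤ) (q : ℂ × ℂ) : rot ((a : ℝ), (b : ℝ)) q = q := by
  have e : ∀ n : ℤ, Complex.exp (2 * Real.pi * Complex.I * ((n : ℝ) : ℂ)) = 1 := fun n =>
    Complex.exp_eq_one_iff.2 ⟨n, by push_cast; ring⟩
  simp only [rot, e, one_mul]

/-! ### Horizontal lifts -/

theorem nonzero_of_v₀_ne_zero {q : ℂ × ℂ × ℂ} (h : v₀ q ≠ 0) : Nonzero q := by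
  unfold v₀ at h
  exact ⟨left_ne_zero_of_mul (left_ne_zero_of_mul h), right_ne_zero_of_mul (left_ne_zero_of_mul h),
    right_ne_zero_of_mul h⟩

theorem differentiable_v₀ : Differentiable ℂ v₀ := by
  unfold v₀
  fun_prop

theorem fderiv_v₀ {q : ℂ × ℂ × ℂ} (h : Nonzero q) (w : ℂ × ℂ × ℂ) :
    fderiv ℂ v₀ q w = v₀ q * (w.1 / q.1 + w.2.1 / q.2.1 + w.2.2 / q.2.2) := by
  obtain ⟨h1, h2, h3⟩ := h
  have k1 : HasFDerivAt (fun q : ℂ × ℂ × ℂ => q.1) (ContinuousLinearMap.fst ℂ ℂ (ℂ × ℂ)) q :=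
    hasFDerivAt_fst
  have k0 : HasFDerivAt (fun q : ℂ × ℂ × ℂ => q.2) (ContinuousLinearMap.snd ℂ ℂ (ℂ × ℂ)) q :=
    hasFDerivAt_snd
  have k2 : HasFDerivAt (fun q : ℂ × ℂ × ℂ => q.2.1) _ q := k0.fst
  have k3 : HasFDerivAt (fun q : ℂ × ℂ × ℂ => q.2.2) _ q := k0.snd
  have k : HasFDerivAt v₀ _ q := (k1.mul k2).mul k3
  rw [k.fderiv]
  simp only [v₀, Pi.mul_apply, add_apply, smul_apply, ContinuousLinearMap.comp_apply,
    ContinuousLinearMap.coe_fst', ContinuousLinearMap.coe_snd', smul_eq_mul]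
  field_simp
  ring

theorem logsDeriv_mul {q : ℂ × ℂ × ℂ} (h : Nonzero q) (a b c : ℂ) :
    logsDeriv q (q.1 * a, q.2.1 * b, q.2.2 * c) =
      (2 * a.re, 2 * b.re, 2 * a.re + 2 * b.re + 2 * c.re) ∧
    logsDeriv q (Complex.I • (q.1 * a, q.2.1 * b, q.2.2 * c)) =
      (-2 * a.im, -2 * b.im, -2 * a.im + -2 * b.im + -2 * c.im) := by
  obtain ⟨h1, h2, h3⟩ := h
  have e : ∀ x a : ℂ, x ≠ 0 → Complex.I * (x * a) / x = Complex.I * a := by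
    intro x a hx
    field_simp
  simp only [logsDeriv, Prod.smul_mk, smul_eq_mul, e _ _ h1, e _ _ h2, e _ _ h3,
    mul_div_cancel_left₀ _ h1, mul_div_cancel_left₀ _ h2, mul_div_cancel_left₀ _ h3,
    Complex.I_mul_re]
  simp

namespace IsModel

variable {b : Bumps} {T K r S : ℝ} {Φ : ℝ × ℝ × ℝ → ℝ}

theorem logs_of_norm_v₀ (h : IsModel b T K r Φ S) {q : ℂ × ℂ × ℂ} (hq : ‖v₀ q‖ = r) :
    Nonzero q ∧ (logs T q).2.2 = S := by
  have h1 : Nonzero q := nonzero_of_v₀_ne_zero (norm_pos_iff.1 (by rw [hq]; exact h.hr))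
  refine ⟨h1, ?_⟩
  rw [← log_scaled_v₀ h.hT h1, hq, h.hS]

theorem _root_.BananaMirror.norm_loop {r : ℝ} (hr : 0 < r) (t : ℝ) :
    ‖(r : ℂ) * Complex.exp (t * Complex.I)‖ = r := by
  rw [norm_mul, Complex.norm_exp_ofReal_mul_I, mul_one, Complex.norm_of_nonneg hr.le]

/-- The rotation with angular velocities `s₁, s₂, 1 - s₁ - s₂`. -/
noncomputable def _root_.BananaMirror.liftCurve (r : ℝ) (s : ℝ × ℝ) (q : ℂ × ℂ) (t : ℝ) :
    ℂ × ℂ × ℂ :=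
  (Complex.exp ((s.1 * t : ℝ) * Complex.I) * q.1, Complex.exp ((s.2 * t : ℝ) * Complex.I) * q.2,
    Complex.exp (((1 - s.1 - s.2) * t : ℝ) * Complex.I) * (r / (q.1 * q.2)))

theorem _root_.BananaMirror.hasDerivAt_exp_rotation (a t : ℝ) (x : ℂ) :
    HasDerivAt (fun t : ℝ => Complex.exp ((a * t : ℝ) * Complex.I) * x)
      (Complex.exp ((a * t : ℝ) * Complex.I) * x * (a * Complex.I)) t := by
  have h1 : HasDerivAt (fun t : ℝ => ((a * t : ℝ) : ℂ) * Complex.I) (a * Complex.I) t := by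
    have h2 : HasDerivAt (fun t : ℝ => a * t) a t := by
      simpa using (hasDerivAt_id t).const_mul a
    exact (h2.ofReal_comp).mul_const Complex.I
  refine (h1.cexp.mul_const x).congr_deriv ?_
  ring

/-- Norms, and with them $\sigma$, are constant along the curve. The velocity has no radial part,
and $i$ times it has logarithmic derivative $-2(\sigma_1,\sigma_2,1)$, which is orthogonal to the
fibre. -/
theorem isHorizontalLift_liftCurve (h : IsModel b T K r Φ S) {q : ℂ × ℂ} (hq : q ∈ torusDomain) :
    IsHorizontalLift b T K r (liftCurve r (twist Φ (fiberLogs T S q)) q) := by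
  set s := twist Φ (fiberLogs T S q) with hs
  have hv : ∀ t, v₀ (liftCurve r s q t) = r * Complex.exp (t * Complex.I) := by
    intro t
    have h1 := hq.1
    have h2 := hq.2
    have e : Complex.exp (t * Complex.I) = Complex.exp ((s.1 * t : ℝ) * Complex.I) *
        Complex.exp ((s.2 * t : ℝ) * Complex.I) *
        Complex.exp (((1 - s.1 - s.2) * t : ℝ) * Complex.I) := by
      rw [← Complex.exp_add, ← Complex.exp_add]
      congr 1
      push_cast
      ring
    rw [e]
    simp only [v₀, liftCurve]
    field_simp
  intro t _
  refine ⟨hv t, _, ((hasDerivAt_exp_rotation s.1 t q.1).prodMk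
    ((hasDerivAt_exp_rotation s.2 t q.2).prodMk
      (hasDerivAt_exp_rotation (1 - s.1 - s.2) t (r / (q.1 * q.2))))).hasDerivWithinAt, ?_⟩
  intro w hw
  have hnorm : ‖v₀ (liftCurve r s q t)‖ = r := by rw [hv, norm_loop h.hr]
  obtain ⟨hn, hS⟩ := h.logs_of_norm_v₀ hnorm
  have hR : logs T (liftCurve r s q t) = fiberLogs T S q := by
    refine Prod.ext ?_ (Prod.ext ?_ hS)
    · simp only [logs, liftCurve, fiberLogs, norm_mul, Complex.norm_exp_ofReal_mul_I, one_mul]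
    · simp only [logs, liftCurve, fiberLogs, norm_mul, Complex.norm_exp_ofReal_mul_I, one_mul]
  have hl := logsDeriv_mul hn (s.1 * Complex.I) (s.2 * Complex.I)
    (((1 - s.1 - s.2 : ℝ) : ℂ) * Complex.I)
  have hw' : (logsDeriv (liftCurve r s q t) w).2.2 = 0 := by
    rw [fderiv_v₀ hn] at hw
    have h0 := (mul_eq_zero.1 hw).resolve_left hn.v₀
    have h1 := congrArg Complex.re h0
    simp only [Complex.add_re, Complex.zero_re] at h1
    simp only [logsDeriv]
    linarith
  have ho := h.twist_orthogonal (R := fiberLogs T S q) rfl hw'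
  rw [← hs] at ho
  rw [h.omega_eq _ hn hS]
  have e1 := hl.1
  have e2 := hl.2
  simp only [Complex.re_ofReal_mul, Complex.im_ofReal_mul, Complex.I_re, Complex.I_im] at e1 e2
  have e3 : ((-2 * (s.1 * 1), -2 * (s.2 * 1),
      -2 * (s.1 * 1) + -2 * (s.2 * 1) + -2 * ((1 - s.1 - s.2) * 1)) : ℝ × ℝ × ℝ) =
      (-2 : ℝ) • (s.1, s.2, 1) := by
    simp only [Prod.smul_mk, smul_eq_mul, Prod.mk.injEq]
    refine ⟨by ring, by ring, by ring⟩
  rw [e3] at e2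
  have e4 : ((2 * (s.1 * 0), 2 * (s.2 * 0),
      2 * (s.1 * 0) + 2 * (s.2 * 0) + 2 * ((1 - s.1 - s.2) * 0)) : ℝ × ℝ × ℝ) = 0 := by
    simp
  rw [e4] at e1
  simp only [liftCurve] at e1 e2 hR ho ⊢
  rw [e1, e2, hR, map_zero, map_smul, smul_apply, ho]
  simp

/-- The velocity of a horizontal lift. -/
theorem velocity_eq (h : IsModel b T K r Φ S) {q v : ℂ × ℂ × ℂ} (hq : ‖v₀ q‖ = r)
    (hv : fderiv ℂ v₀ q v = Complex.I * v₀ q)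
    (ho : ∀ w, fderiv ℂ v₀ q w = 0 → omega b T K q v w = 0) :
    logsDeriv q v = 0 ∧ v.1 = q.1 * ((twist Φ (logs T q)).1 * Complex.I) ∧
      v.2.1 = q.2.1 * ((twist Φ (logs T q)).2 * Complex.I) := by
  obtain ⟨hn, hS⟩ := h.logs_of_norm_v₀ hq
  have hpi := Real.pi_pos
  obtain ⟨α, β, δ, rfl⟩ : ∃ α β δ : ℂ, v = (q.1 * α, q.2.1 * β, q.2.2 * δ) :=
    ⟨v.1 / q.1, v.2.1 / q.2.1, v.2.2 / q.2.2, by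
      rw [mul_div_cancel₀ _ hn.1, mul_div_cancel₀ _ hn.2.1, mul_div_cancel₀ _ hn.2.2]⟩
  have hsum : α + β + δ = Complex.I := by
    rw [fderiv_v₀ hn, mul_comm Complex.I] at hv
    have := mul_left_cancel₀ hn.v₀ hv
    simpa only [mul_div_cancel_left₀ _ hn.1, mul_div_cancel_left₀ _ hn.2.1,
      mul_div_cancel_left₀ _ hn.2.2] using this
  have hre : α.re + β.re + δ.re = 0 := by simpa using congrArg Complex.re hsum
  have him : α.im + β.im + δ.im = 1 := by simpa using congrArg Complex.im hsum
  obtain ⟨l1, l2⟩ := logsDeriv_mul hn α β δ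
  have eP : ((2 * α.re, 2 * β.re, 2 * α.re + 2 * β.re + 2 * δ.re) : ℝ × ℝ × ℝ) =
      (2 : ℝ) • (α.re, β.re, 0) := by
    simp only [Prod.smul_mk, smul_eq_mul, mul_zero, Prod.mk.injEq, true_and]
    linarith
  have eQ : ((-2 * α.im, -2 * β.im, -2 * α.im + -2 * β.im + -2 * δ.im) : ℝ × ℝ × ℝ) =
      (-2 : ℝ) • (α.im, β.im, 1) := by
    simp only [Prod.smul_mk, smul_eq_mul, Prod.mk.injEq, true_and]
    linarith
  rw [eP] at l1
  rw [eQ] at l2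
  -- This is horizontality tested on the fibre vector with logarithmic components $(x,y,-x-y)$.
  -- Purely imaginary $x,y$ force the radial part of the velocity to vanish; real $x,y$ then
  -- identify the angular part with the twist.
  have key : ∀ x y : ℂ, fderiv ℝ (fderiv ℝ Φ) (logs T q) (α.im, β.im, 1) (x.re, y.re, 0) =
      fderiv ℝ (fderiv ℝ Φ) (logs T q) (α.re, β.re, 0) (x.im, y.im, 0) := by
    intro x y
    have h1 := ho (q.1 * x, q.2.1 * y, q.2.2 * (-x - y)) (by
      rw [fderiv_v₀ hn]
      simp only [mul_div_cancel_left₀ _ hn.1, mul_div_cancel_left₀ _ hn.2.1,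
        mul_div_cancel_left₀ _ hn.2.2]
      ring)
    obtain ⟨m1, m2⟩ := logsDeriv_mul hn x y (-x - y)
    have f1 : ((2 * x.re, 2 * y.re, 2 * x.re + 2 * y.re + 2 * (-x - y).re) : ℝ × ℝ × ℝ) =
        (2 : ℝ) • (x.re, y.re, 0) := by
      simp only [Prod.smul_mk, smul_eq_mul, mul_zero, Prod.mk.injEq, true_and, Complex.sub_re,
        Complex.neg_re]
      ring
    have f2 : ((-2 * x.im, -2 * y.im, -2 * x.im + -2 * y.im + -2 * (-x - y).im) : ℝ × ℝ × ℝ) =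
        (-2 : ℝ) • (x.im, y.im, 0) := by
      simp only [Prod.smul_mk, smul_eq_mul, mul_zero, Prod.mk.injEq, true_and, Complex.sub_im,
        Complex.neg_im]
      ring
    rw [f1] at m1
    rw [f2] at m2
    rw [h.omega_eq _ hn hS, l1, l2, m1, m2] at h1
    simp only [map_smul, smul_apply, smul_eq_mul] at h1
    have h2 := (mul_eq_zero.1 h1).resolve_left (by positivity)
    linarith
  have hP : ((α.re, β.re, 0) : ℝ × ℝ × ℝ) = 0 := by
    refine h.eq_zero_of_orthogonal hS rfl ?_
    rintro ⟨x, y, s⟩ hs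
    obtain rfl : s = 0 := hs
    have := key (x * Complex.I) (y * Complex.I)
    simp only [Complex.re_ofReal_mul, Complex.im_ofReal_mul, Complex.I_re, Complex.I_im, mul_zero,
      mul_one] at this
    rw [← this]
    exact map_zero _
  have hQ : (α.im, β.im) = twist Φ (logs T q) := by
    refine h.twist_eq hS ?_
    rintro ⟨x, y, s⟩ hs
    obtain rfl : s = 0 := hs
    have := key x y
    simp only [Complex.ofReal_re, Complex.ofReal_im] at this
    rw [this, hP, map_zero, zero_apply]
  rw [← hQ]
  simp only [Prod.mk_eq_zero, and_true] at hP
  refine ⟨by rw [l1, hP.1, hP.2]; simp, ?_, ?_⟩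
  · apply Complex.ext <;> simp [hP.1]
  · apply Complex.ext <;> simp [hP.2]

theorem _root_.BananaMirror.eq_of_hasDerivWithinAt_zero {E : Type*} [NormedAddCommGroup E]
    [NormedSpace ℝ E] {f : ℝ → E} {a b : ℝ} (hab : a < b)
    (hf : ∀ t ∈ Set.Icc a b, HasDerivWithinAt f 0 (Set.Icc a b) t) {t : ℝ}
    (ht : t ∈ Set.Icc a b) : f t = f a := by
  refine constant_of_derivWithin_zero (fun t ht => (hf t ht).differentiableWithinAt)
    (fun t ht => ?_) t ht
  have h1 := Set.Ico_subset_Icc_self ht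
  exact (hf t h1).derivWithin (uniqueDiffOn_Icc hab t h1)

/-- The end of a horizontal lift. -/
theorem lift_end (h : IsModel b T K r Φ S) {γ : ℝ → ℂ × ℂ × ℂ} (hγ : IsHorizontalLift b T K r γ)
    {q q' : ℂ × ℂ} (hq : q ∈ torusDomain) (h0 : γ 0 = fiberIncl r q)
    (h1 : γ (2 * Real.pi) = fiberIncl r q') : q' = rot (twist Φ (fiberLogs T S q)) q := by
  have hpi : 0 < 2 * Real.pi := Real.two_pi_pos
  have hnorm : ∀ t ∈ Set.Icc 0 (2 * Real.pi), ‖v₀ (γ t)‖ = r := by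
    intro t ht
    rw [(hγ t ht).1, norm_loop h.hr]
  have hvel : ∀ t ∈ Set.Icc 0 (2 * Real.pi), ∃ v,
      HasDerivWithinAt γ v (Set.Icc 0 (2 * Real.pi)) t ∧ logsDeriv (γ t) v = 0 ∧
      v.1 = (γ t).1 * ((twist Φ (logs T (γ t))).1 * Complex.I) ∧
      v.2.1 = (γ t).2.1 * ((twist Φ (logs T (γ t))).2 * Complex.I) := by
    intro t ht
    obtain ⟨hv, v, hd, ho⟩ := hγ t ht
    refine ⟨v, hd, h.velocity_eq (hnorm t ht) ?_ ho⟩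
    have d1 : HasDerivWithinAt (fun t => v₀ (γ t)) (fderiv ℂ v₀ (γ t) v)
        (Set.Icc 0 (2 * Real.pi)) t :=
      ((differentiable_v₀ (γ t)).hasFDerivAt.restrictScalars ℝ).comp_hasDerivWithinAt t hd
    have d2 := (hasDerivAt_exp_rotation 1 t r).hasDerivWithinAt (s := Set.Icc 0 (2 * Real.pi))
    have d3 := d1.congr (f₁ := fun t : ℝ => Complex.exp ((1 * t : ℝ) * Complex.I) * r)
      (fun t ht => by rw [(hγ t ht).1, one_mul, mul_comm]) (by rw [hv, one_mul, mul_comm])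
    rw [(uniqueDiffOn_Icc hpi t ht).eq_deriv _ d3 d2, hv, one_mul]
    push_cast
    ring
  -- Since the norms do not move, the twist is constant along the lift, and the coordinates solve
  -- linear equations with constant coefficients.
  have hlogs : ∀ t ∈ Set.Icc 0 (2 * Real.pi), logs T (γ t) = fiberLogs T S q := by
    intro t ht
    rw [← logs_fiberIncl h.hT h.hr h.hS hq, ← h0]
    refine eq_of_hasDerivWithinAt_zero (f := fun t => logs T (γ t)) hpi (fun t ht => ?_) ht
    obtain ⟨v, hd, hz, -⟩ := hvel t ht
    rw [← hz]
    exact hasDerivWithinAt_logs h.hT hd (h.logs_of_norm_v₀ (hnorm t ht)).1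
  have key : ∀ (a : ℝ) (g : ℝ → ℂ), (∀ t ∈ Set.Icc 0 (2 * Real.pi),
      HasDerivWithinAt g (g t * (a * Complex.I)) (Set.Icc 0 (2 * Real.pi)) t) →
      g (2 * Real.pi) = Complex.exp (2 * Real.pi * Complex.I * a) * g 0 := by
    intro a g hg
    have e := eq_of_hasDerivWithinAt_zero
      (f := fun t : ℝ => Complex.exp ((-a * t : ℝ) * Complex.I) * 1 * g t) hpi (fun t ht => by
        refine ((hasDerivAt_exp_rotation (-a) t 1).hasDerivWithinAt.mul (hg t ht)).congr_deriv ?_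
        push_cast
        ring) (Set.right_mem_Icc.2 hpi.le)
    simp only [mul_zero, Complex.ofReal_zero, zero_mul, Complex.exp_zero, one_mul, mul_one] at e
    rw [← e, ← mul_assoc, ← Complex.exp_add]
    have : 2 * Real.pi * Complex.I * a + ((-a * (2 * Real.pi) : ℝ) : ℂ) * Complex.I = 0 := by
      push_cast
      ring
    rw [this, Complex.exp_zero, one_mul]
  have k1 := key (twist Φ (fiberLogs T S q)).1 (fun t => (γ t).1) (fun t ht => by
    obtain ⟨v, hd, -, h1, -⟩ := hvel t ht
    rw [hlogs t ht] at h1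
    rw [← h1]
    exact hd.fst)
  have k2 := key (twist Φ (fiberLogs T S q)).2 (fun t => (γ t).2.1) (fun t ht => by
    obtain ⟨v, hd, -, -, h2⟩ := hvel t ht
    rw [hlogs t ht] at h2
    rw [← h2]
    exact hd.snd.fst)
  rw [h0, h1] at k1 k2
  exact Prod.ext k1 k2

theorem _root_.BananaMirror.liftCurve_zero (r : ℝ) (s : ℝ × ℝ) (q : ℂ × ℂ) :
    liftCurve r s q 0 = fiberIncl r q := by
  simp [liftCurve, fiberIncl]

/-- The three speeds add up to $1$, so after a full turn the third coordinate is again determined by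
the first two. -/
theorem _root_.BananaMirror.liftCurve_two_pi (r : ℝ) (s : ℝ × ℝ) (q : ℂ × ℂ) :
    liftCurve r s q (2 * Real.pi) = fiberIncl r (rot s q) := by
  have e : ∀ a : ℝ, Complex.exp ((a * (2 * Real.pi) : ℝ) * Complex.I) =
      Complex.exp (2 * Real.pi * Complex.I * a) := by
    intro a
    congr 1
    push_cast
    ring
  have e3 : Complex.exp (2 * Real.pi * Complex.I * ((1 - s.1 - s.2 : ℝ) : ℂ)) =
      (Complex.exp (2 * Real.pi * Complex.I * s.1) *
        Complex.exp (2 * Real.pi * Complex.I * s.2))⁻¹ := by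
    rw [← Complex.exp_add, ← Complex.exp_neg]
    have : 2 * Real.pi * Complex.I * ((1 - s.1 - s.2 : ℝ) : ℂ) =
        -(2 * Real.pi * Complex.I * s.1 + 2 * Real.pi * Complex.I * s.2) +
          2 * Real.pi * Complex.I := by
      push_cast
      ring
    rw [this, Complex.exp_periodic]
  simp only [liftCurve, fiberIncl, rot, e, e3, Prod.mk.injEq, true_and]
  rw [div_eq_mul_inv, div_eq_mul_inv, ← mul_assoc, mul_mul_mul_comm, mul_inv, mul_inv, mul_inv]
  ring

end IsModel

/-! ### Descent to the quotient fibre: monodromy and Hamiltonian isotopy. -/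

/-! ### Self-maps of the fibre given by rotations -/

/-- Rotation numbers on the fibre that are well-defined modulo `ℤ²`. -/
def IsAngular (S : ℝ) (τ : ℝ × ℝ × ℝ → ℝ × ℝ) : Prop :=
  ∀ (R : ℝ × ℝ × ℝ) (i j : ℤ), R.2.2 = S →
    ∃ a b : ℤ, τ (deckLog i j R) = τ R + ((a : ℝ), (b : ℝ))

/-- Rotation of each point by its rotation numbers. -/
noncomputable def spinPt (T S : ℝ) (τ : ℝ × ℝ × ℝ → ℝ × ℝ) (q : torusDomain) : torusDomain :=
  ⟨rot (τ (fiberLogs T S q.1)) q.1, rot_mem _ q.2⟩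

theorem fiberLogs_deck {T r S : ℝ} (hT : 0 < T) (hr : 0 < r) (hS : 2 * Real.log (T ^ 3 * r) = S)
    {q q' : torusDomain} {m n : ℤ} (h1 : q'.1.1 = ((T ^ 3 * r : ℝ) : ℂ) ^ m * q.1.1)
    (h2 : q'.1.2 = ((T ^ 3 * r : ℝ) : ℂ) ^ n * q.1.2) :
    fiberLogs T S q'.1 = deckLog m n (fiberLogs T S q.1) := by
  have hr' : (r : ℂ) ≠ 0 := by simpa using hr.ne'
  have hS' : 2 * Real.log (T ^ 3 * ‖(r : ℂ)‖) = S := by rw [Complex.norm_of_nonneg hr.le, hS]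
  push_cast at h1 h2
  have k1 := log_deck_coord hT hr' q.2.1 m hS'
  have k2 := log_deck_coord hT hr' q.2.2 n hS'
  rw [← h1] at k1
  rw [← h2] at k2
  simp only [fiberLogs, deckLog, k1, k2]

theorem fiberRel_spinPt {T r S : ℝ} (hT : 0 < T) (hr : 0 < r) (hS : 2 * Real.log (T ^ 3 * r) = S)
    {τ : ℝ × ℝ × ℝ → ℝ × ℝ} (hτ : IsAngular S τ) {q q' : torusDomain} (h : fiberRel T r q q') :
    fiberRel T r (spinPt T S τ q) (spinPt T S τ q') := by
  obtain ⟨m, n, h1, h2⟩ := h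
  refine ⟨m, n, ?_⟩
  have e := fiberLogs_deck hT hr hS h1 h2
  obtain ⟨a, b, hab⟩ := hτ (fiberLogs T S q.1) m n rfl
  have e2 : (spinPt T S τ q').1 = rot (τ (fiberLogs T S q.1)) q'.1 := by
    simp only [spinPt]
    rw [e, hab, ← rot_rot, rot_int]
  rw [e2]
  simp only [spinPt, rot, h1, h2]
  constructor <;> ring

/-- The self-map of the fibre induced by rotations. -/
noncomputable def spin {T r S : ℝ} (hT : 0 < T) (hr : 0 < r) (hS : 2 * Real.log (T ^ 3 * r) = S)
    {τ : ℝ × ℝ × ℝ → ℝ × ℝ} (hτ : IsAngular S τ) : Fiber T r → Fiber T r :=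
  Quot.map (spinPt T S τ) fun _ _ => fiberRel_spinPt hT hr hS hτ

theorem spin_mk {T r S : ℝ} (hT : 0 < T) (hr : 0 < r) (hS : 2 * Real.log (T ^ 3 * r) = S)
    {τ : ℝ × ℝ × ℝ → ℝ × ℝ} (hτ : IsAngular S τ) (q : torusDomain) :
    spin hT hr hS hτ (Fiber.mk T r q) = Fiber.mk T r (spinPt T S τ q) := rfl

theorem spinPt_spinPt (T S : ℝ) (τ τ' : ℝ × ℝ × ℝ → ℝ × ℝ) (q : torusDomain) :
    spinPt T S τ (spinPt T S τ' q) = spinPt T S (fun R => τ R + τ' R) q := by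
  apply Subtype.ext
  simp only [spinPt]
  rw [fiberLogs_rot, rot_rot]

theorem spinPt_of_eq_zero (T S : ℝ) {τ : ℝ × ℝ × ℝ → ℝ × ℝ} (h : ∀ R, τ R = 0) (q : torusDomain) :
    spinPt T S τ q = q := by
  apply Subtype.ext
  simp only [spinPt]
  rw [h, rot_zero]

namespace IsModel

variable {b : Bumps} {T K r S : ℝ} {Φ : ℝ × ℝ × ℝ → ℝ}

/-! ### The monodromy -/

theorem isAngular_twist (h : IsModel b T K r Φ S) : IsAngular S (twist Φ) :=
  fun _ i j hR => ⟨i, j, h.twist_deck hR i j⟩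

theorem isMonodromy_spin (h : IsModel b T K r Φ S) :
    IsMonodromy b T K r (spin h.hT h.hr h.hS h.isAngular_twist) := by
  refine ⟨fun q => ⟨_, h.isHorizontalLift_liftCurve q.2, liftCurve_zero r _ _⟩, ?_⟩
  intro q q' γ hγ h0 h1
  rw [spin_mk]
  congr 1
  exact Subtype.ext (h.lift_end hγ q.2 h0 h1).symm

theorem monodromy_mk (h : IsModel b T K r Φ S) {φ : Fiber T r → Fiber T r}
    (hφ : IsMonodromy b T K r φ) (q : torusDomain) :
    φ (Fiber.mk T r q) = Fiber.mk T r (spinPt T S (twist Φ) q) :=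
  hφ.2 q _ _ (h.isHorizontalLift_liftCurve q.2) (liftCurve_zero r _ _) (liftCurve_two_pi r _ _)

/-! ### The Hamiltonian isotopy -/

/-- For real $t$, invariance modulo $\mathbb Z^2$ would not survive scaling; the sum
$\sigma+\lambda\xi$ is invariant exactly, unlike its two summands. -/
theorem isAngular_rotation (h : IsModel b T K r Φ S) (t : ℝ) :
    IsAngular S fun R => t • rotation Φ R := by
  intro R i j hR
  refine ⟨0, 0, ?_⟩
  simp only [h.rotation_deck hR]
  simp

/-- A point of the linear Lagrangian. -/
theorem _root_.BananaMirror.mem_linLag_iff {k : ℤ} {ξ : ℂ × ℂ → ℝ × ℝ} (q : ℂ × ℂ) :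
    (q.1 = ‖q.1‖ * Complex.exp (2 * Real.pi * Complex.I * ((-k * (lam (ξ q)).1 : ℝ) : ℂ)) ∧
      q.2 = ‖q.2‖ * Complex.exp (2 * Real.pi * Complex.I * ((-k * (lam (ξ q)).2 : ℝ) : ℂ))) ↔
    q = rot ((-k : ℝ) • lam (ξ q)) ((‖q.1‖ : ℂ), (‖q.2‖ : ℂ)) := by
  rw [Prod.ext_iff]
  simp only [rot, Prod.smul_fst, Prod.smul_snd, smul_eq_mul, mul_comm (‖_‖ : ℂ)]

/-- The linear Lagrangians in terms of the moment map. -/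
theorem linLag_eq (h : IsModel b T K r Φ S) {ξ : ℂ × ℂ → ℝ × ℝ} (hξ : IsActionCoord b T K r ξ)
    (k : ℤ) : linLag T r ξ k = Fiber.mk T r '' {q : torusDomain |
      q.1 = rot ((-k : ℝ) • lam (moment Φ (fiberLogs T S q.1)))
        ((‖q.1.1‖ : ℂ), (‖q.1.2‖ : ℂ))} := by
  unfold linLag
  congr 1
  ext q
  rw [Set.mem_ofPred_eq, Set.mem_ofPred_eq, mem_linLag_iff, h.eq_moment_of_isActionCoord hξ q.2]

/-- Rotation by a multiple of `λ ξ` maps linear Lagrangians to each other. -/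
theorem _root_.BananaMirror.spinPt_lam_mem {T S : ℝ} {Φ : ℝ × ℝ × ℝ → ℝ} {k : ℤ} (m : ℤ)
    {q : torusDomain}
    (hq : q.1 = rot ((-k : ℝ) • lam (moment Φ (fiberLogs T S q.1)))
      ((‖q.1.1‖ : ℂ), (‖q.1.2‖ : ℂ))) :
    (spinPt T S (fun R => (-m : ℝ) • lam (moment Φ R)) q).1 =
      rot ((-(k + m : ℤ) : ℝ) •
        lam (moment Φ (fiberLogs T S (spinPt T S (fun R => (-m : ℝ) • lam (moment Φ R)) q).1)))
      ((‖(spinPt T S (fun R => (-m : ℝ) • lam (moment Φ R)) q).1.1‖ : ℂ),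
        (‖(spinPt T S (fun R => (-m : ℝ) • lam (moment Φ R)) q).1.2‖ : ℂ)) := by
  have e1 : fiberLogs T S (spinPt T S (fun R => (-m : ℝ) • lam (moment Φ R)) q).1 =
    fiberLogs T S q.1 := fiberLogs_rot _ _ _ _
  have e2 : ‖(spinPt T S (fun R => (-m : ℝ) • lam (moment Φ R)) q).1.1‖ = ‖q.1.1‖ := by
    simp only [spinPt, rot, norm_mul, norm_exp_rotation, one_mul]
  have e3 : ‖(spinPt T S (fun R => (-m : ℝ) • lam (moment Φ R)) q).1.2‖ = ‖q.1.2‖ := by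
    simp only [spinPt, rot, norm_mul, norm_exp_rotation, one_mul]
  rw [e1, e2, e3]
  have e4 : ((-(k + m : ℤ) : ℝ) • lam (moment Φ (fiberLogs T S q.1))) =
      (-m : ℝ) • lam (moment Φ (fiberLogs T S q.1)) +
        (-k : ℝ) • lam (moment Φ (fiberLogs T S q.1)) := by
    rw [← add_smul]
    push_cast
    ring_nf
  rw [e4, ← rot_rot, ← hq]
  rfl

/-- The rotation numbers add: $\sigma-(\sigma+\lambda\xi)=-\lambda\xi$. The inverse inclusion uses
rotation by $+\lambda\xi$ on representatives in the cover. -/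
theorem image_monodromy_linLag (h : IsModel b T K r Φ S) {ξ : ℂ × ℂ → ℝ × ℝ}
    (hξ : IsActionCoord b T K r ξ) {φ : Fiber T r → Fiber T r} (hφ : IsMonodromy b T K r φ)
    (i : ℤ) :
    spin h.hT h.hr h.hS (h.isAngular_rotation 1) '' (φ '' linLag T r ξ i) =
      linLag T r ξ (i + 1) := by
  have hstep : ∀ q : torusDomain,
      spin h.hT h.hr h.hS (h.isAngular_rotation 1) (φ (Fiber.mk T r q)) =
        Fiber.mk T r (spinPt T S (fun R => (-(1 : ℤ) : ℝ) • lam (moment Φ R)) q) := by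
    intro q
    rw [h.monodromy_mk hφ, spin_mk, spinPt_spinPt]
    congr 2
    funext R
    simp [rotation]
  rw [h.linLag_eq hξ, h.linLag_eq hξ]
  ext x
  constructor
  · rintro ⟨_, ⟨_, ⟨q, hq, rfl⟩, rfl⟩, rfl⟩
    exact ⟨_, spinPt_lam_mem 1 hq, (hstep q).symm⟩
  · rintro ⟨q, hq, rfl⟩
    have h1 := spinPt_lam_mem (-1) hq
    rw [add_neg_cancel_right] at h1
    refine ⟨_, ⟨_, ⟨_, h1, rfl⟩, rfl⟩, ?_⟩
    rw [hstep, spinPt_spinPt, spinPt_of_eq_zero]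
    intro R
    simp

theorem _root_.BananaMirror.contDiffAt_rot {E : Type*} [NormedAddCommGroup E] [NormedSpace ℝ E] {s : E → ℝ × ℝ}
    {q : E → ℂ × ℂ} {x : E} (hs : ContDiffAt ℝ ∞ s x) (hq : ContDiffAt ℝ ∞ q x) :
    ContDiffAt ℝ ∞ (fun x => rot (s x) (q x)) x := by
  have key : ∀ {a : E → ℝ} {z : E → ℂ}, ContDiffAt ℝ ∞ a x → ContDiffAt ℝ ∞ z x →
      ContDiffAt ℝ ∞ (fun x => Complex.exp (2 * Real.pi * Complex.I * a x) * z x) x := by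
    intro a z ha hz
    have h1 : ContDiffAt ℝ ∞ (fun x => (a x : ℂ)) x :=
      Complex.ofRealCLM.contDiff.contDiffAt.comp x ha
    exact ((contDiffAt_const.mul h1).cexp).mul hz
  exact (key hs.fst hq.fst).prodMk (key hs.snd hq.snd)

theorem _root_.BananaMirror.hasDerivAt_rot (s : ℝ × ℝ) (q : ℂ × ℂ) (t : ℝ) :
    HasDerivAt (fun τ : ℝ => rot (τ • s) q)
      (2 * Real.pi * Complex.I * s.1 * (rot (t • s) q).1,
        2 * Real.pi * Complex.I * s.2 * (rot (t • s) q).2) t := by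
  have key : ∀ (a : ℝ) (x : ℂ), HasDerivAt
      (fun τ : ℝ => Complex.exp (2 * Real.pi * Complex.I * ((τ * a : ℝ) : ℂ)) * x)
      (2 * Real.pi * Complex.I * a *
        (Complex.exp (2 * Real.pi * Complex.I * ((t * a : ℝ) : ℂ)) * x)) t := by
    intro a x
    have h1 : HasDerivAt (fun τ : ℝ => ((τ * a : ℝ) : ℂ)) a t := by
      have h2 : HasDerivAt (fun τ : ℝ => τ * a) a t := by
        simpa using (hasDerivAt_id t).mul_const a
      exact h2.ofReal_comp
    refine (((h1.const_mul (2 * Real.pi * Complex.I)).cexp).mul_const x).congr_deriv ?_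
    ring
  exact (key s.1 q.1).prodMk (key s.2 q.2)

/-- The autonomous Hamiltonian depends on the norms only, and its flow preserves them, so the flow
is explicit: rotation by $t$ times the rotation numbers, with inverse at $-t$. -/
theorem hamiltonianIsotopic (h : IsModel b T K r Φ S) {ξ : ℂ × ℂ → ℝ × ℝ}
    (hξ : IsActionCoord b T K r ξ) {φ : Fiber T r → Fiber T r} (hφ : IsMonodromy b T K r φ)
    (i : ℤ) : HamiltonianIsotopic b T K r (φ '' linLag T r ξ i) (linLag T r ξ (i + 1)) := by
  have hham : ∀ q q' : torusDomain, fiberRel T r q q' →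
      hamiltonian Φ (fiberLogs T S q.1) = hamiltonian Φ (fiberLogs T S q'.1) := by
    rintro q q' ⟨m, n, h1, h2⟩
    rw [fiberLogs_deck h.hT h.hr h.hS h1 h2, h.hamiltonian_deck rfl]
  have hlogs : ∀ s : ℝ × (ℂ × ℂ), s ∈ (Set.univ ×ˢ torusDomain : Set (ℝ × (ℂ × ℂ))) →
      ContDiffAt ℝ ∞ (fun s : ℝ × (ℂ × ℂ) => fiberLogs T S s.2) s := fun s hs =>
    (contDiffAt_fiberLogs h.hT S hs.2).comp s contDiffAt_snd
  refine ⟨fun _ => Quot.lift (fun q => hamiltonian Φ (fiberLogs T S q.1)) hham,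
    fun t => spin h.hT h.hr h.hS (h.isAngular_rotation t),
    fun _ q => hamiltonian Φ (fiberLogs T S q),
    fun t q => rot (t • rotation Φ (fiberLogs T S q)) q,
    fun t q => rfl, fun t q => ⟨rot_mem _ q.2, rfl⟩, fun s hs => ?_, fun s hs => ?_, fun t => ?_,
    fun q hq => ?_, fun t q hq => ⟨_, hasDerivAt_rot _ q t, fun w => ?_⟩,
    h.image_monodromy_linLag hξ hφ i⟩
  · exact ((h.contDiffAt_hamiltonian (R := fiberLogs T S s.2) rfl).comp s
      (hlogs s hs)).contDiffWithinAt
  · have h1 := (h.contDiffAt_rotation (R := fiberLogs T S s.2) rfl).comp s (hlogs s hs)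
    exact (contDiffAt_rot (contDiffAt_fst.smul h1) contDiffAt_snd).contDiffWithinAt
  · have hinv : ∀ t x, spin h.hT h.hr h.hS (h.isAngular_rotation (-t))
        (spin h.hT h.hr h.hS (h.isAngular_rotation t) x) = x := by
      rintro t ⟨q⟩
      show spin h.hT h.hr h.hS (h.isAngular_rotation (-t))
        (spin h.hT h.hr h.hS (h.isAngular_rotation t) (Fiber.mk T r q)) = Fiber.mk T r q
      rw [spin_mk, spin_mk, spinPt_spinPt, spinPt_of_eq_zero]
      intro R
      simp
    refine Function.bijective_iff_has_inverse.2 ⟨_, hinv t, fun x => ?_⟩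
    have h1 := hinv (-t) x
    simp only [neg_neg] at h1
    exact h1
  · simp only [zero_smul, rot_zero]
  · rw [h.fiberForm_rotation (rot_mem _ hq), fiberLogs_rot,
      (h.fderiv_comp_fiberLogs (f := hamiltonian Φ) (rot_mem _ hq) _ w).2, fiberLogs_rot,
      h.fderiv_hamiltonian rfl rfl]
    rw [fiberLogs_rot]
    exact (h.contDiffAt_hamiltonian (R := fiberLogs T S q) rfl).differentiableAt (by simp)

end IsModel

/-! ### Numerical thresholds for large $l$. -/

/-! ### The profile of admissible bump functions -/

/-- The numerical inequalities that hold for large `l`. -/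
structure IsLarge (T p C l : ℝ) : Prop where
  pos : 0 < l
  r₂_lt : T ^ (l / 4 - 4 * l / p) < 1 / 10 ^ 6
  δ'_lt : T ^ (l / 2 - 2 * l / p + 2) < 1 / 10 ^ 7
  ε_le : T ^ (2 * l + 6) < 1 / 10 ^ 18
  ε_le_radial : T ^ (4 * l / p) < 1 / 128
  t₂_lt : T ^ (l / p - 2) < 1 / 16
  slow : C / l < 1 / 10 ^ 6
  slow_deriv : C / l / (2 * Real.log T⁻¹) < 1 / 10 ^ 6
  slow_deriv₂ : C / l / (2 * Real.log T⁻¹) ^ 2 < 1 / 10 ^ 6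

theorem eventually_rpow_lt {T : ℝ} (hT₀ : 0 < T) (hT₁ : T < 1) {a : ℝ} (ha : 0 < a) (b : ℝ) {η : ℝ}
    (hη : 0 < η) {f : ℝ → ℝ} (hf : ∀ l, f l = a * l + b) : ∀ᶠ l in atTop, T ^ f l < η := by
  have h1 : Tendsto f atTop atTop := by
    rw [funext hf]
    exact tendsto_atTop_add_const_right _ _ (tendsto_id.const_mul_atTop ha)
  exact ((tendsto_rpow_atTop_of_base_lt_one T (by linarith) hT₁).comp h1).eventually_lt_const hη

theorem eventually_isLarge {T : ℝ} (hT₀ : 0 < T) (hT₁ : T < 1) {p : ℝ} (hp : 16 < p) (C : ℝ) :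
    ∀ᶠ l in atTop, IsLarge T p C l := by
  have hp0 : 0 < p := by linarith
  have hpi : p⁻¹ < 1 / 16 := by
    rw [inv_eq_one_div]
    exact one_div_lt_one_div_of_lt (by norm_num) hp
  have hpi0 : 0 < p⁻¹ := inv_pos.2 hp0
  have hC : ∀ D η : ℝ, 0 < η → ∀ᶠ l in atTop, C / l / D < η := by
    intro D η hη
    have h1 : Tendsto (fun l : ℝ => C / l / D) atTop (𝓝 (0 / D)) :=
      (tendsto_const_nhds.div_atTop tendsto_id).div_const D
    rw [zero_div] at h1
    exact h1.eventually_lt_const hη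
  filter_upwards [eventually_gt_atTop 0,
    -- This is the inequality that needs $p>16$: $\alpha_6$ must already equal $1$ at a ratio $Y/X$
    -- that tends to $0$.
    eventually_rpow_lt hT₀ hT₁ (a := 1 / 4 - 4 * p⁻¹) (by linarith) 0 (η := 1 / 10 ^ 6)
      (by norm_num) (f := fun l => l / 4 - 4 * l / p) (fun l => by ring),
    eventually_rpow_lt hT₀ hT₁ (a := 1 / 2 - 2 * p⁻¹) (by linarith) 2 (η := 1 / 10 ^ 7)
      (by norm_num) (f := fun l => l / 2 - 2 * l / p + 2) (fun l => by ring),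
    eventually_rpow_lt hT₀ hT₁ (a := 2) (by norm_num) 6 (η := 1 / 10 ^ 18) (by norm_num)
      (f := fun l => 2 * l + 6) (fun l => rfl),
    eventually_rpow_lt hT₀ hT₁ (a := 4 * p⁻¹) (by positivity) 0 (η := 1 / 128) (by norm_num)
      (f := fun l => 4 * l / p) (fun l => by ring),
    eventually_rpow_lt hT₀ hT₁ (a := p⁻¹) hpi0 (-2) (η := 1 / 16) (by norm_num)
      (f := fun l => l / p - 2) (fun l => by ring),
    hC 1 (1 / 10 ^ 6) (by norm_num), hC (2 * Real.log T⁻¹) (1 / 10 ^ 6) (by norm_num),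
    hC ((2 * Real.log T⁻¹) ^ 2) (1 / 10 ^ 6) (by norm_num)] with l k0 k1 k2 k3 k4 k5 k6 k7 k8
  rw [div_one] at k6
  exact ⟨k0, k1, k2, k3, k4, k5, k6, k7, k8⟩

theorem LogSlow.mono {α : ℝ → ℝ} {η η' : ℝ} (h : LogSlow α η) (hη : η ≤ η') : LogSlow α η' :=
  fun μ => ⟨(h μ).1.trans hη, (h μ).2.trans hη⟩

/-- A monotone function that is constant near both ends lies between the two values. -/
theorem mem_of_monotone {α : ℝ → ℝ} (h : Monotone α) {a b x y : ℝ} (ha : ∀ s ≤ a, α s = x)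
    (hb : ∀ s ≥ b, α s = y) (s : ℝ) : x ≤ α s ∧ α s ≤ y := by
  constructor
  · rw [← ha (min s a) (min_le_right _ _)]
    exact h (min_le_left _ _)
  · rw [← hb (max s b) (le_max_right _ _)]
    exact h (le_max_left _ _)

theorem log_inv_pos {T : ℝ} (hT₀ : 0 < T) (hT₁ : T < 1) : 0 < Real.log T⁻¹ :=
  Real.log_pos (one_lt_inv₀ hT₀ |>.2 hT₁)

theorem deriv_comp_div (α : ℝ → ℝ) (D : ℝ) :
    (deriv fun r => α (r / D)) = fun r => deriv α (r / D) / D := by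
  funext r
  have e : (fun r => α (r / D)) = fun r => α (D⁻¹ * r) := by
    funext r
    rw [div_eq_inv_mul]
  rw [e, deriv_comp_mul_left, smul_eq_mul, div_eq_inv_mul, div_eq_inv_mul]

/-- Admissible bump functions give a profile if `l` is large. -/
theorem exists_profile {T p C l : ℝ} (hT₀ : 0 < T) (hT₁ : T < 1) (hp : 16 < p)
    (hl : IsLarge T p C l) {b : Bumps} (hb : b.Admissible T p l C) :
    ∃ c : Profile, c.ε = T ^ (2 * l + 6) ∧ Matches b T c := by
  have hL := log_inv_pos hT₀ hT₁
  have hlT : Real.log T = -Real.log T⁻¹ := by rw [Real.log_inv, neg_neg]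
  have hl0 := hl.pos
  have hp0 : 0 < p := by linarith
  have hlp : l / p < l / 16 := div_lt_div_of_pos_left hl0 (by norm_num) hp
  have hlp0 : 0 < l / p := div_pos hl0 hp0
  have e2 : 2 * l / p = 2 * (l / p) := by ring
  have e4 : 4 * l / p = 4 * (l / p) := by ring
  have hα₄0 : b.α₄ 0 = 0 := hb.inner₄ 0 (by rw [abs_zero]; positivity)
  -- These identities of exponents are the size conditions on the fibre, where $XYZ=T^{2l+6}$:
  -- respectively $\varepsilon$ against $r_1^2\delta^3$, $t_2$ against $r_1\delta$, and the value of
  -- $\delta t_1^2$.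
  have hrad : T ^ (2 * l + 6) =
      T ^ (4 * l / p) * ((T ^ (l / 4 - 2 * l / p)) ^ 2 * (T ^ (l / 2 + 2)) ^ 3) := by
    rw [← Real.rpow_natCast, ← Real.rpow_natCast, ← Real.rpow_mul hT₀.le, ← Real.rpow_mul hT₀.le,
      ← Real.rpow_add hT₀, ← Real.rpow_add hT₀]
    congr 1
    push_cast
    ring
  have hang : T ^ (3 * l / 4 - l / p) =
      T ^ (l / p - 2) * (T ^ (l / 4 - 2 * l / p) * T ^ (l / 2 + 2)) := by
    rw [← Real.rpow_add hT₀, ← Real.rpow_add hT₀]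
    congr 1
    ring
  have hang₁ : T ^ (l / 2 + 2) * (T ^ (3 * l / 4 + 1)) ^ 2 = T ^ (2 * l + 4) := by
    rw [← Real.rpow_natCast, ← Real.rpow_mul hT₀.le, ← Real.rpow_add hT₀]
    congr 1
    push_cast
    ring
  have hd6 : ∀ s, |deriv b.α₆ s / (2 * Real.log T⁻¹)| ≤ 1 / 10 ^ 6 ∧
      |deriv (deriv b.α₆) s / (2 * Real.log T⁻¹) / (2 * Real.log T⁻¹)| ≤ 1 / 10 ^ 6 := by
    intro s
    have hD : 0 < 2 * Real.log T⁻¹ := by positivity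
    obtain ⟨h1, h2⟩ := hb.slow₆ s
    rw [div_div, ← sq, abs_div, abs_div, abs_of_pos hD, abs_of_pos (pow_pos hD 2)]
    exact ⟨(div_le_div_of_nonneg_right h1 hD.le).trans hl.slow_deriv.le,
      (div_le_div_of_nonneg_right h2 (pow_pos hD 2).le).trans hl.slow_deriv₂.le⟩
  let c : Profile :=
    { a₃ := b.α₃
      a₄ := b.α₄
      a₅ := b.α₅
      -- $\log_{1/T}(|y|/|x|)$ is $\log(Y/X)$ divided by $2\log T^{-1}$, since $X$ and $Y$ are
      -- squares; hence the thresholds $r_1,r_2$ carry twice the exponents of $\alpha_6$.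
      a₆ := fun r => b.α₆ (r / (2 * Real.log T⁻¹))
      κ := 1 / 10 ^ 6
      ε := T ^ (2 * l + 6)
      δ := T ^ (l / 2 + 2)
      δ' := T ^ (l / 2 - 2 * l / p + 2)
      t₁ := T ^ (3 * l / 4 + 1)
      t₂ := T ^ (3 * l / 4 - l / p)
      r₁ := T ^ (l / 4 - 2 * l / p)
      r₂ := T ^ (l / 4 - 4 * l / p)
      smooth₃ := hb.smooth₃
      smooth₄ := hb.smooth₄
      smooth₅ := hb.smooth₅
      smooth₆ := hb.smooth₆.comp (contDiff_id.div_const _)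
      mem₃ := mem_of_monotone hb.mono₃ hb.inner₃ hb.outer₃
      inner₃ := hb.inner₃
      outer₃ := hb.outer₃
      mem₅ := mem_of_monotone hb.mono₅ hb.inner₅ hb.outer₅
      inner₅ := hb.inner₅
      outer₅ := hb.outer₅
      odd₄ := hb.odd₄
      mem₄ := fun θ hθ => by
        refine ⟨hα₄0 ▸ hb.mono₄ hθ, ?_⟩
        rw [← hb.outer₄ _ (le_max_right θ _)]
        exact hb.mono₄ (le_max_left _ _)
      inner₄ := hb.inner₄
      outer₄ := hb.outer₄
      mem₆ := fun r => mem_of_monotone hb.mono₆ hb.inner₆ hb.outer₆ _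
      inner₆ := fun r hr => by
        refine hb.inner₆ _ ?_
        rw [← Real.le_log_iff_exp_le (Real.rpow_pos_of_pos hT₀ _), Real.log_rpow hT₀, hlT, e2] at hr
        rw [div_le_iff₀ (by positivity)]
        linarith
      outer₆ := fun r hr => by
        refine hb.outer₆ _ ?_
        rw [← Real.log_le_iff_le_exp (Real.rpow_pos_of_pos hT₀ _), Real.log_rpow hT₀, hlT, e4] at hr
        rw [ge_iff_le, le_div_iff₀ (by positivity), e2]
        linarith
      slow₃ := hb.slow₃.mono hl.slow.le
      slow₄ := hb.slow₄.mono hl.slow.le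
      slow₅ := hb.slow₅.mono hl.slow.le
      slow₆ := fun r => by
        have e : (deriv fun r => deriv b.α₆ (r / (2 * Real.log T⁻¹)) / (2 * Real.log T⁻¹)) =
            fun r => deriv (deriv b.α₆) (r / (2 * Real.log T⁻¹)) / (2 * Real.log T⁻¹) /
              (2 * Real.log T⁻¹) := by
          funext r
          rw [deriv_div_const, deriv_comp_div]
        rw [deriv_comp_div, e]
        exact hd6 _
      κ_eq := rfl
      δ_pos := Real.rpow_pos_of_pos hT₀ _
      t₁_nonneg := Real.rpow_nonneg hT₀.le _
      r₁_pos := Real.rpow_pos_of_pos hT₀ _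
      r₁_lt := Real.rpow_lt_one hT₀.le hT₁ (by linarith)
      r₂_lt := hl.r₂_lt
      δ_le := Real.rpow_le_rpow_of_exponent_ge hT₀ hT₁.le (by linarith)
      δ'_lt := by
        have := hl.δ'_lt
        norm_num at this ⊢
        linarith
      ε_le := by
        have := hl.ε_le
        norm_num at this ⊢
        linarith
      ε_le_radial := by
        have h1 := hl.ε_le_radial
        have h2 : 0 < (T ^ (l / 4 - 2 * l / p)) ^ 2 * (T ^ (l / 2 + 2)) ^ 3 := by positivity
        rw [hrad]
        nlinarith
      t₂_lt := by
        have h1 := hl.t₂_lt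
        have h2 : 0 < T ^ (l / 4 - 2 * l / p) * T ^ (l / 2 + 2) := by positivity
        rw [hang]
        nlinarith
      ε_le_angular := by
        rw [hang₁]
        exact Real.rpow_le_rpow_of_exponent_ge hT₀ hT₁.le (by linarith) }
  refine ⟨c, rfl, fun u v w => ?_⟩
  have hphi : ∀ u v w : ℝ, phi (Real.exp u) (Real.exp v) (Real.exp w) = logPhi u v w := by
    intro u v w
    rw [phi, logPhi, softplus, softplus, ← Real.exp_add, Real.log_div (by positivity)
      (by positivity)]
  have hg : gPot (Real.exp v) (Real.exp w) = logTile v w := by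
    rw [gPot, logTile, softplus, softplus, softplus, ← Real.exp_add,
      Real.log_mul (by positivity) (by positivity), Real.log_mul (by positivity) (by positivity)]
  have hs : Real.logb T⁻¹ (Real.sqrt (Real.exp v / Real.exp u)) =
      (v - u) / (2 * Real.log T⁻¹) := by
    rw [← Real.exp_sub, Real.logb, Real.log_sqrt (Real.exp_pos _).le, Real.log_exp, div_div]
  have hr : c.radial (u, v, w) = logPhi u v w - (logPhi v u w + logPhi w u v) / 2 +
      3 / 2 * b.α₆ ((v - u) / (2 * Real.log T⁻¹)) * logPhi v u w := by
    simp only [Profile.radial, c]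
    ring
  unfold chamberPot Profile.chamber
  simp only [hphi, hg, hs, hr, angular]
  simp only [c]
  ring

/-- The form `ω` of admissible bump functions is given by a convex quasi-periodic potential. -/
theorem exists_isModel {T p C l : ℝ} (hT₀ : 0 < T) (hT₁ : T < 1) (hp : 16 < p)
    (hl : IsLarge T p C l) {b : Bumps} (hb : b.Admissible T p l C) (K : ℝ) :
    ∃ Φ S, IsModel b T K (T ^ l) Φ S := by
  obtain ⟨c, hε, hm⟩ := exists_profile hT₀ hT₁ hp hl hb
  have hr : 0 < T ^ l := Real.rpow_pos_of_pos hT₀ l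
  have hS : Real.exp (2 * Real.log (T ^ 3 * T ^ l)) = c.ε := by
    rw [hε, two_mul, Real.exp_add, Real.exp_log (by positivity), ← Real.rpow_natCast,
      ← Real.rpow_add hT₀, ← Real.rpow_add hT₀]
    congr 1
    push_cast
    ring
  refine ⟨c.total (K / T ^ 6), _, ⟨?_, fun R hR => ?_, fun R hR w => ?_, fun i j R => ?_, ?_⟩, hT₀, hr,
    rfl, fun q hq hqS => hm.omega hT₀ K hq (by rw [hqS, hS])⟩
  · exact (Profile.log_ε_neg hS).ne
  · exact Profile.contDiffAt_total _ (by rw [hR, hS])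
  · exact Profile.total_pos _ (by rw [hR, hS])
  · exact Profile.total_deckLog _ i j
  · exact Profile.fderiv_total_center _ hS

end BananaMirror

theorem lemma4p10 (T : ℝ) (hT₀ : 0 < T) (hT₁ : T < 1) (p : ℝ) (hp : 16 < p) (C : ℝ) :
    ∃ l₀ : ℝ, ∀ l ≥ l₀, ∀ b : BananaMirror.Bumps, b.Admissible T p l C → ∀ K : ℝ,
      (∃ ξ, BananaMirror.IsActionCoord b T K (T ^ l) ξ) ∧
      (∃ φ, BananaMirror.IsMonodromy b T K (T ^ l) φ) ∧
      ∀ ξ φ, BananaMirror.IsActionCoord b T K (T ^ l) ξ →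
        BananaMirror.IsMonodromy b T K (T ^ l) φ →
        ∀ i : ℤ, BananaMirror.HamiltonianIsotopic b T K (T ^ l)
          (φ '' BananaMirror.linLag T (T ^ l) ξ i) (BananaMirror.linLag T (T ^ l) ξ (i + 1)) := by
  obtain ⟨l₀, hl₀⟩ := Filter.eventually_atTop.1 (BananaMirror.eventually_isLarge hT₀ hT₁ hp C)
  refine ⟨l₀, fun l hl b hb K => ?_⟩
  obtain ⟨Φ, S, h⟩ := BananaMirror.exists_isModel hT₀ hT₁ hp (hl₀ l hl) hb K
  exact ⟨⟨_, h.isActionCoord_moment⟩, ⟨_, h.isMonodromy_spin⟩,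
    fun ξ φ hξ hφ i => h.hamiltonianIsotopic hξ hφ i⟩
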